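/- **Definitions.** Write $\mathbb N=\{1,2,\dots\}$. For a $\{0,1\}$-valued sequence $\mathbf Y=(Y_n)_{n\ge1}$ and $d\ge 1$, a $d$-string occurs at time $n\ge1$ if $(Y_n,\dots,Y_{n+d})=(1,0,\dots,0,1)$ with exactly $d-1$ zeros; $Z_d\in\{0,1,\dots,\infty\}$ is the number of times $n\ge1$ at which a $d$-string occurs, and $\mathbf Z=(Z_d)_{d\ge1}$ is the count vector of $\mathbf Y$. For $a>0$, $b\ge0$, $\mathbf Y$ is a $\mathrm{Bern}(a,b)$ sequence if the $Y_n$ are independent and $P(Y_n=1)=\frac{a}{a+b+n-1}$ for $n\ge1$. $\mathrm{Po}(\lambda)$ is the Poisson law of mean $\lambda$. Random variables $(X_i,L_i)_{i\ge0}$ in $\mathbb R\times\mathbb N$ form a conditional marked Poisson process $\mathcal M(g,r,\lambda,q)$ if (1) $X_0$ has density $g$; (2) conditionally on $X_0=x_0$, the point process $N=\sum_{i\ge1}\delta_{X_i}$ is a Poisson process with intensity function $\lambda_{x_0}(\cdot)$; (3) $P(L_0=k\mid \mathbf X)=r(X_0,k)$ for $k\ge1$; (4) $P(L_n=k\mid\mathbf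 X,L_0,\dots,L_{n-1})=q(X_n,k)$ for $k,n\ge1$. It generates the sequence $\mathbf Y$ given by $Y_n=1$ if $n=L_0+\dots+L_r$ for some $r\ge0$, and $Y_n=0$ otherwise. For $a,b>0$ let $\bar g(x)=x^{b-1}(1-x)^{a-1}/B(b,a)$ on $0<x<1$ (the $\mathrm{Beta}(b,a)$ density), $\bar r(x,k)=\bar q(x,k)=x^{k-1}(1-x)$ for $k\ge1$, and $\bar\lambda_w(x)=\frac{a}{1-x}$ for $w<x<1$, $\bar\lambda_w(x)=0$ otherwise. **Proposition.** Let $a>0$. 1. For every $b>0$ the model $\mathcal M(\bar g,\bar r,\bar\lambda,\bar q)$ exists, with its points listed in increasing order: $X_1<X_2<\cdots$ almost surely. 2. Let $b>0$ and let $(\mathbf X,\mathbf L)=\mathcal M(\bar g,\bar r,\bar\lambda,\bar q)$. If $X_1<X_2<\cdots$ almost surely, then the generated sequence $\mathbf Y$ is a $\mathrm{Bern}(a,b)$ sequence. For any ordering of the points, the count vector $\mathbf Z$ of $\mathbf Y$ has, conditionally on $X_0=x_0$, the law $\prod_{k\ge1}\mathrm{Po}\big(a(1-x_0^k)/k\big)$,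 for almost every $x_0$ with respect to the $\mathrm{Beta}(b,a)$ law. 3. Consequently, for $b>0$, the count vector of any $\mathrm{Bern}(a,b)$ sequence has the mixture law $$P(\mathbf Z\in S)=\int_0^1\Big(\prod_{k\ge1}\mathrm{Po}\big(a(1-x^k)/k\big)\Big)(S)\,\bar g(x)\,dx\qquad\text{for all measurable }S.$$ 4. As $b\downarrow0$, the count vectors of $\mathrm{Bern}(a,b)$ sequences converge in distribution to $\prod_{k\ge1}\mathrm{Po}(a/k)$, and this is the law of the count vector of any $\mathrm{Bern}(a,0)$ sequence. -/

import Mathlib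

open MeasureTheory ProbabilityTheory Filter Topology
open scoped ENNReal NNReal BoundedContinuousFunction

/-- The discrete σ-algebra on the positive integers. -/
instance pnatMeasurableSpace : MeasurableSpace ℕ+ := ⊤

instance pnatDiscreteMeasurableSpace : DiscreteMeasurableSpace ℕ+ := ⟨fun _ => trivial⟩

noncomputable section

/-! ### Bernoulli sequences and counts of strings

A `{0,1}`-valued sequence is a function `ℕ+ → Fin 2`: its entries are indexed by `n = 1, 2, …`. -/

/-- A `d`-string occurs at time `n`: `⟨y n, …, y (n + d)⟩ = ⟨1, 0, …, 0, 1⟩` with `d - 1` zeros. -/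
def IsStringAt (y : ℕ+ → Fin 2) (d n : ℕ+) : Prop :=
  y n = 1 ∧ (∀ m : ℕ+, n < m → m < n + d → y m = 0) ∧ y (n + d) = 1

/-- The count vector: the `d`-th entry is the number, possibly infinite, of times `n ≥ 1` at which
a `d`-string occurs. -/
def countVector (y : ℕ+ → Fin 2) (d : ℕ+) : ℕ∞ :=
  Set.encard {n : ℕ+ | IsStringAt y d n}

/-- `Y` is a `Bern(a, b)` sequence: independent `{0,1}`-valued random variables with
`P(Y n = 1) = a / (a + b + n - 1)` for `n ≥ 1`. -/
structure IsBern {Ω : Type*} [MeasurableSpace Ω] (P : Measure Ω) (a b : ℝ)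
    (Y : ℕ+ → Ω → Fin 2) : Prop where
  measurable : ∀ n, Measurable (Y n)
  indep : iIndepFun Y P
  prob_eq_one : ∀ n : ℕ+, P {ω | Y n ω = 1} = ENNReal.ofReal (a / (a + b + (n : ℝ) - 1))

/-! ### Poisson laws -/

/-- The product of Poisson laws `∏_{k ≥ 1} Po(rate k)`, as a law on vectors of possibly infinite
counts. -/
def poissonProd (rate : ℕ+ → ℝ) : Measure (ℕ+ → ℕ∞) :=
  (Measure.infinitePi fun k : ℕ+ => poissonMeasure (rate k).toNNReal).map
    fun (z : ℕ+ → ℕ) (k : ℕ+) => (z k : ℕ∞)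

/-- The random measure `N` is, under `μ`, a Poisson process with intensity measure `Λ`. -/
structure IsPoissonProcess {Ω E : Type*} [MeasurableSpace Ω] [MeasurableSpace E]
    (μ : Measure Ω) (N : Ω → Measure E) (Λ : Measure E) : Prop where
  measurable : ∀ A, MeasurableSet A → Measurable fun ω => N ω A
  law_of_finite : ∀ A, MeasurableSet A → Λ A ≠ ∞ →
    μ.map (fun ω => N ω A) = (poissonMeasure (Λ A).toNNReal).map fun n : ℕ => (n : ℝ≥0∞)
  law_of_infinite : ∀ A, MeasurableSet A → Λ A = ∞ → ∀ᵐ ω ∂μ, N ω A = ∞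
  indep : ∀ (m : ℕ) (A : Fin m → Set E), (∀ j, MeasurableSet (A j)) →
    Pairwise (fun i j => Disjoint (A i) (A j)) → iIndepFun (fun j ω => N ω (A j)) μ

/-! ### Conditional marked Poisson processes -/

/-- The point process `N = ∑_{i ≥ 1} δ_{x i}` of a sequence `x 0, x 1, …` (the term `x 0` is not
counted). -/
def pointProcess (x : ℕ → ℝ) : Measure ℝ :=
  Measure.sum fun i : ℕ => Measure.dirac (x (i + 1))

/-- `(X, L)` is a conditional marked Poisson process `M(g, r, lam, q)`. The points
`X 1, X 2, …` may be listed in any order. -/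
structure IsCMPP {Ω : Type*} [MeasurableSpace Ω] (P : Measure Ω) [IsProbabilityMeasure P]
    (g : ℝ → ℝ) (r : ℝ → ℕ+ → ℝ) (lam : ℝ → ℝ → ℝ) (q : ℝ → ℕ+ → ℝ)
    (X : ℕ → Ω → ℝ) (L : ℕ → Ω → ℕ+) : Prop where
  measurable_X : ∀ n, Measurable (X n)
  measurable_L : ∀ n, Measurable (L n)
  /-- `X 0` has density `g`. -/
  law_X_zero : P.map (X 0) = volume.withDensity fun x => ENNReal.ofReal (g x)
  /-- Conditionally on `X 0 = x₀`, the process `∑_{i ≥ 1} δ_{X i}` is a Poisson process with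
  intensity function `lam x₀`. -/
  poisson : ∀ᵐ x₀ ∂(P.map (X 0)),
    IsPoissonProcess (condDistrib (fun ω n => X n ω) (X 0) P x₀) pointProcess
      (volume.withDensity fun x => ENNReal.ofReal (lam x₀ x))
  /-- `P(L 0 = k | X) = r (X 0) k`. -/
  mark_zero : ∀ k : ℕ+,
    P⟦{ω | L 0 ω = k} | MeasurableSpace.comap (fun ω (i : ℕ) => X i ω) inferInstance⟧
      =ᵐ[P] fun ω => r (X 0 ω) k
  /-- `P(L n = k | X, L 0, …, L (n - 1)) = q (X n) k` for `n ≥ 1`. -/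
  mark : ∀ (n : ℕ) (k : ℕ+), 1 ≤ n →
    P⟦{ω | L n ω = k} | MeasurableSpace.comap
        (fun ω => ((fun i : ℕ => X i ω), (fun j : Fin n => L j ω))) inferInstance⟧
      =ᵐ[P] fun ω => q (X n ω) k

/-- The partial sums `l 0 + l 1 + ⋯ + l r` of the marks. -/
def markSum (l : ℕ → ℕ+) : ℕ → ℕ+
  | 0 => l 0
  | r + 1 => markSum l r + l (r + 1)

open Classical in
/-- The `{0,1}`-valued sequence generated by marks: its `n`-th entry is `1` exactly when `n` is a
partial sum of the marks. -/
def bernoulliOfMarks (l : ℕ → ℕ+) (n : ℕ+) : Fin 2 :=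
  if ∃ r : ℕ, n = markSum l r then 1 else 0

/-! ### The parameters of the model -/

/-- The mass function `x ^ (k - 1) * (1 - x)`, `k ≥ 1`, of a geometric mark, for `x ∈ (0, 1)`. -/
def geomMark (x : ℝ) (k : ℕ+) : ℝ := x ^ ((k : ℕ) - 1) * (1 - x)

/-- The intensity function `x ↦ a / (1 - x)` on `(w, 1)`, and `0` elsewhere. -/
def recordIntensity (a w x : ℝ) : ℝ := if w < x ∧ x < 1 then a / (1 - x) else 0

end

/-! Ones of the generated sequence sit at the partial sums of the marks, so its strings are exactly
the marks `L 1, L 2, …`, and the count vector is their histogram, whatever the order of the points.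
Given `X 0 = x`, the points form a Poisson process with intensity `a / (1 - y)` on `(x, 1)`, and
each receives an independent geometric mark. By the marking theorem the points with mark `k` form
independent Poisson processes, of mean `∫ a / (1 - y) * y ^ (k - 1) * (1 - y) dy = a (1 - x ^ k) /
k` over `(x, 1)`. This is `IsCMPP.condDistrib_countVector`.

Order matters only for the Bernoulli property. In increasing order the points are a Markov chain, `1
- X (n + 1) = (1 - X n) * v n` with independent `v n` of law Beta(a, 1). That this chain is the
Poisson process follows from Laplace functionals: if `V x` is the functional of the process on `(x,
1)` with factor `h` per point, then `V` solves `V x = E (h (X 1) V (X 1))`, so `∏ h (X i) * V (X n)`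
is a martingale, and `X n → 1`. Conversely, ordered points are a measurable function of the counts
on half-lines, so every ordered model has the law of the chain (`IsCMPP.condDistrib_points`).

The beta laws are conjugate to this chain (`lintegral_geomMark_mul_step_betaMeasure`): starting from
Beta(b, a), drawing mark `k` and moving one step leaves the next point with law Beta(b + k, a), and
the weight is the probability of `k - 1` zeros and a one in a Bern(a, b) sequence. Iteration gives
the cylinder probabilities of Bern(a, b) on words ending in `1`, and these determine the law
(`IsCMPP.isBern`). As a model exists for each `b > 0`, the mixture formula passes to every Bern(a,
b) sequence.

As `b ↓ 0`, the mean `b / (a + b)` of the mixing law tends to `0`, and the Laplace transforms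
converge to those with rates `a / k`. A Bern(a, 0) sequence is a one followed by a Bern(a, 1)
sequence. The added one turns the initial mark of the latter into a string as well, and Beta(1, a)
is the law of one step of the chain from `0`; so all strings come from the Poisson process on `(0,
1)`.

Laws are compared through Laplace transforms with values of exponents in `[0, ∞]`. There the state
spaces are compact, so Stone–Weierstrass yields uniqueness and convergence at once, with no
tightness argument. -/

noncomputable section

/-! ### The function `t ↦ exp (-t)` on `[0, ∞]` -/

/-- The decreasing bijection `t ↦ exp (-t)` from `[0, ∞]` onto `[0, 1]`. -/
def expNeg (t : ℝ≥0∞) : ℝ≥0∞ := EReal.exp (-(t : EReal))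

@[simp] lemma expNeg_zero : expNeg 0 = 1 := by simp [expNeg]

@[simp] lemma expNeg_top : expNeg ∞ = 0 := by simp [expNeg]

lemma expNeg_add (s t : ℝ≥0∞) : expNeg (s + t) = expNeg s * expNeg t := by
  rw [expNeg, EReal.coe_ennreal_add, EReal.neg_add, sub_eq_add_neg, EReal.exp_add]
  · rfl
  · left; simp
  · right; simp

lemma expNeg_le_one (t : ℝ≥0∞) : expNeg t ≤ 1 := by
  simp [expNeg, EReal.coe_ennreal_nonneg]

lemma expNeg_ne_top (t : ℝ≥0∞) : expNeg t ≠ ∞ :=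
  ne_top_of_le_ne_top ENNReal.one_ne_top (expNeg_le_one t)

lemma expNeg_antitone : Antitone expNeg := fun s t h => by
  simpa [expNeg] using h

lemma expNeg_injective : Function.Injective expNeg := fun s t h => by
  simpa using EReal.exp_strictMono.injective h

@[fun_prop] lemma continuous_expNeg : Continuous expNeg :=
  ENNReal.continuous_exp.comp (continuous_coe_ennreal_ereal.neg)

@[fun_prop] lemma measurable_expNeg : Measurable expNeg := continuous_expNeg.measurable

lemma expNeg_ofReal {x : ℝ} (hx : 0 ≤ x) :
    expNeg (ENNReal.ofReal x) = ENNReal.ofReal (Real.exp (-x)) := by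
  rw [expNeg, EReal.coe_ennreal_ofReal, max_eq_left hx, ← EReal.coe_neg, EReal.exp_coe]

lemma expNeg_of_ne_top {t : ℝ≥0∞} (ht : t ≠ ∞) :
    expNeg t = ENNReal.ofReal (Real.exp (-t.toReal)) := by
  rw [← expNeg_ofReal ENNReal.toReal_nonneg, ENNReal.ofReal_toReal ht]

lemma expNeg_sum {ι : Type*} (s : Finset ι) (f : ι → ℝ≥0∞) :
    expNeg (∑ i ∈ s, f i) = ∏ i ∈ s, expNeg (f i) := by
  classical
  induction s using Finset.induction_on with
  | empty => simp
  | insert i s hi ih => rw [Finset.sum_insert hi, Finset.prod_insert hi, expNeg_add, ih]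

lemma expNeg_natCast_mul (n : ℕ) (t : ℝ≥0∞) : expNeg (n * t) = expNeg t ^ n := by
  induction n with
  | zero => simp
  | succ n ih => rw [Nat.cast_succ, add_mul, expNeg_add, ih, pow_succ, one_mul]

/-- The inverse of `expNeg` on `[0, 1]`. -/
def negLog (h : ℝ≥0∞) : ℝ≥0∞ := (-ENNReal.log h).toENNReal

lemma expNeg_negLog {h : ℝ≥0∞} (hh : h ≤ 1) : expNeg (negLog h) = h := by
  have : 0 ≤ -ENNReal.log h := by simpa using hh
  rw [expNeg, negLog, EReal.coe_toENNReal this, neg_neg, ENNReal.exp_log]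

lemma negLog_one : negLog 1 = 0 := by simp [negLog]

@[fun_prop] lemma measurable_negLog : Measurable negLog :=
  measurable_ereal_toENNReal.comp ENNReal.measurable_log.neg

lemma tendsto_prod_expNeg (f : ℕ → ℝ≥0∞) :
    Tendsto (fun n => ∏ i ∈ Finset.range n, expNeg (f i)) atTop (𝓝 (expNeg (∑' i, f i))) := by
  simp_rw [← expNeg_sum]
  exact (continuous_expNeg.tendsto _).comp (ENNReal.tendsto_nat_tsum f)

/-! ### Laplace transforms determine finite measures -/

/-- Stone–Weierstrass: polynomials in the separating family are uniformly dense, their integrals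
converge by linearity, and the common mass bound `C` controls the approximation error uniformly in
`b`. -/
lemma tendsto_integral_of_monomials {K ι β : Type*} [TopologicalSpace K] [CompactSpace K]
    [MeasurableSpace K] [OpensMeasurableSpace K] (u : ι → C(K, ℝ))
    (hsep : ∀ x y, (∀ i, u i x = u i y) → x = y) (l : Filter β) (μ : β → Measure K)
    [∀ b, IsFiniteMeasure (μ b)] (ν : Measure K) [IsFiniteMeasure ν] (C : ℝ)
    (hμ : ∀ b, (μ b).real Set.univ ≤ C) (hν : ν.real Set.univ ≤ C)
    (h : ∀ n : ι →₀ ℕ, Tendsto (fun b => ∫ x, n.prod (fun i k => u i x ^ k) ∂(μ b)) l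
      (𝓝 (∫ x, n.prod (fun i k => u i x ^ k) ∂ν))) (f : C(K, ℝ)) :
    Tendsto (fun b => ∫ x, f x ∂(μ b)) l (𝓝 (∫ x, f x ∂ν)) := by
  have hint : ∀ (g : C(K, ℝ)) (m : Measure K) [IsFiniteMeasure m], Integrable g m := by
    intro g m _
    exact (BoundedContinuousFunction.mkOfCompact g).integrable m
  have hC : 0 ≤ C := measureReal_nonneg.trans hν
  have hpoly : ∀ g ∈ Algebra.adjoin ℝ (Set.range u),
      Tendsto (fun b => ∫ x, g x ∂(μ b)) l (𝓝 (∫ x, g x ∂ν)) := by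
    intro g hg
    rw [Algebra.adjoin_range_eq_range_aeval] at hg
    obtain ⟨p, rfl⟩ := hg
    have heq : ∀ x, (MvPolynomial.aeval u p) x =
        ∑ d ∈ p.support, p.coeff d * d.prod fun i k => u i x ^ k := by
      intro x
      simp [MvPolynomial.aeval_def, MvPolynomial.eval₂_eq, Finsupp.prod]
    have hmon : ∀ d : ι →₀ ℕ, ∀ (m : Measure K) [IsFiniteMeasure m],
        Integrable (fun x => p.coeff d * d.prod fun i k => u i x ^ k) m := by
      intro d m _
      have := hint (d.prod fun i k => u i ^ k) m
      simpa [Finsupp.prod] using this.const_mul (p.coeff d)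
    change Tendsto (fun b => ∫ x, (MvPolynomial.aeval u p) x ∂(μ b)) l
      (𝓝 (∫ x, (MvPolynomial.aeval u p) x ∂ν))
    simp only [heq]
    simp_rw [fun b => integral_finsetSum (μ := μ b) p.support (fun d _ => hmon d _),
      integral_finsetSum (μ := ν) p.support (fun d _ => hmon d _), integral_const_mul]
    exact tendsto_finsetSum _ fun d _ => (h d).const_mul _
  have hdense : f ∈ (Algebra.adjoin ℝ (Set.range u)).topologicalClosure := by
    rw [ContinuousMap.subalgebra_topologicalClosure_eq_top_of_separatesPoints]
    · trivial
    · intro x y hxy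
      by_contra hne
      refine hxy (hsep x y fun i => ?_)
      by_contra hi
      exact hne ⟨u i, ⟨u i, Algebra.subset_adjoin ⟨i, rfl⟩, rfl⟩, hi⟩
  have happ : ∀ ε > 0, ∃ g ∈ Algebra.adjoin ℝ (Set.range u), ‖f - g‖ < ε := by
    intro ε hε
    obtain ⟨g, hg, hfg⟩ := Metric.mem_closure_iff.1 hdense ε hε
    exact ⟨g, hg, by rwa [← dist_eq_norm]⟩
  rw [Metric.tendsto_nhds]
  intro ε hε
  -- `C + 1` because `C` may be `0`; each of the two replacements of `f` by `g` then costs at most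
  -- `ε / 3`.
  obtain ⟨g, hg, hfg⟩ := happ (ε / (3 * (C + 1))) (by positivity)
  have hclose : ∀ (m : Measure K) [IsFiniteMeasure m], m.real Set.univ ≤ C →
      |∫ x, f x ∂m - ∫ x, g x ∂m| ≤ ε / 3 := by
    intro m _ hm
    rw [← integral_sub (hint f m) (hint g m), ← Real.norm_eq_abs]
    refine (norm_integral_le_of_norm_le_const (C := ε / (3 * (C + 1)))
      (ae_of_all _ fun x => ?_)).trans ?_
    · exact ((f - g).norm_coe_le_norm x).trans hfg.le
    · calc ε / (3 * (C + 1)) * m.real Set.univ ≤ ε / (3 * (C + 1)) * (C + 1) := by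
            gcongr; linarith
        _ = ε / 3 := by field_simp
  filter_upwards [(Metric.tendsto_nhds.1 (hpoly g hg)) (ε / 3) (by positivity)] with b hb
  have h1 := hclose (μ b) (hμ b)
  have h2 := hclose ν hν
  rw [Real.dist_eq] at hb ⊢
  rw [abs_le] at h1 h2
  rw [abs_lt] at hb ⊢
  constructor <;> linarith

/-- Convergence of Laplace transforms implies weak convergence, on a compact space. -/
lemma tendsto_integral_of_expNeg {K ι β : Type*} [TopologicalSpace K] [CompactSpace K]
    [MeasurableSpace K] [OpensMeasurableSpace K] (v : ι → K → ℝ≥0∞) (hv : ∀ i, Continuous (v i))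
    (hsep : ∀ x y, (∀ i, v i x = v i y) → x = y) (l : Filter β) (μ : β → Measure K)
    [∀ b, IsFiniteMeasure (μ b)] (ν : Measure K) [IsFiniteMeasure ν] (C : ℝ)
    (hμ : ∀ b, (μ b).real Set.univ ≤ C) (hν : ν.real Set.univ ≤ C)
    (h : ∀ n : ι →₀ ℕ, Tendsto (fun b => ∫⁻ x, expNeg (n.sum fun i k => k * v i x) ∂(μ b)) l
      (𝓝 (∫⁻ x, expNeg (n.sum fun i k => k * v i x) ∂ν))) (f : C(K, ℝ)) :
    Tendsto (fun b => ∫ x, f x ∂(μ b)) l (𝓝 (∫ x, f x ∂ν)) := by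
  have hcont : ∀ i, Continuous fun x => (expNeg (v i x)).toReal := fun i =>
    ENNReal.continuousOn_toReal.comp_continuous (continuous_expNeg.comp (hv i))
      fun x => expNeg_ne_top _
  refine tendsto_integral_of_monomials (fun i => ⟨_, hcont i⟩) (fun x y hxy => hsep x y fun i => ?_)
    l μ ν C hμ hν (fun n => ?_) f
  · refine expNeg_injective ?_
    have := hxy i
    simp only [ContinuousMap.coe_mk] at this
    rwa [ENNReal.toReal_eq_toReal_iff' (expNeg_ne_top _) (expNeg_ne_top _)] at this
  · have key : ∀ (m : Measure K) [IsFiniteMeasure m],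
        ∫ x, n.prod (fun i k => (expNeg (v i x)).toReal ^ k) ∂m =
          (∫⁻ x, expNeg (n.sum fun i k => k * v i x) ∂m).toReal := by
      intro m _
      have : ∀ x, n.prod (fun i k => (expNeg (v i x)).toReal ^ k) =
          (expNeg (n.sum fun i k => k * v i x)).toReal := by
        intro x
        simp [Finsupp.prod, Finsupp.sum, expNeg_sum, expNeg_natCast_mul, ENNReal.toReal_prod]
      simp_rw [this]
      rw [integral_toReal]
      · have hm : Measurable fun x => n.sum fun i (k : ℕ) => (k : ℝ≥0∞) * v i x := by
          unfold Finsupp.sum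
          exact Finset.measurable_fun_sum _ fun i _ => (hv i).measurable.const_mul _
        exact (measurable_expNeg.comp hm).aemeasurable
      · exact ae_of_all _ fun x => (expNeg_ne_top _).lt_top
    simp only [ContinuousMap.coe_mk]
    simp_rw [key]
    refine (ENNReal.tendsto_toReal ?_).comp (h n)
    refine ne_top_of_le_ne_top (measure_ne_top ν Set.univ) ?_
    calc _ ≤ ∫⁻ _, 1 ∂ν := lintegral_mono fun x => expNeg_le_one _
      _ = ν Set.univ := by simp

/-- Uniqueness is the convergence statement for a constant family: the family constantly `ν`
converges to `μ`, and limits are unique. -/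
lemma Measure.ext_of_expNeg {K ι : Type*} [TopologicalSpace K] [CompactSpace K]
    [MeasurableSpace K] [BorelSpace K] [HasOuterApproxClosed K] (v : ι → K → ℝ≥0∞)
    (hv : ∀ i, Continuous (v i)) (hsep : ∀ x y, (∀ i, v i x = v i y) → x = y)
    (μ ν : Measure K) [IsFiniteMeasure μ] [IsFiniteMeasure ν]
    (h : ∀ n : ι →₀ ℕ, ∫⁻ x, expNeg (n.sum fun i k => k * v i x) ∂μ =
      ∫⁻ x, expNeg (n.sum fun i k => k * v i x) ∂ν) : μ = ν := by
  refine ext_of_forall_integral_eq_of_IsFiniteMeasure fun f => ?_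
  exact (tendsto_nhds_unique (tendsto_integral_of_expNeg v hv hsep (atTop : Filter ℕ) (fun _ => ν) μ
    (max (μ.real Set.univ) (ν.real Set.univ)) (fun _ => le_max_right _ _) (le_max_left _ _)
    (fun n => by rw [h n]; exact tendsto_const_nhds) f.toContinuousMap) tendsto_const_nhds)

instance ENat.borelSpace : BorelSpace ℕ∞ := ⟨borel_eq_top_of_countable.symm⟩

lemma Measure.pi_ennreal_ext {ι : Type*} [Countable ι] (μ ν : Measure (ι → ℝ≥0∞))
    [IsFiniteMeasure μ] [IsFiniteMeasure ν]
    (h : ∀ n : ι →₀ ℕ, ∫⁻ x, expNeg (n.sum fun i k => k * x i) ∂μ =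
      ∫⁻ x, expNeg (n.sum fun i k => k * x i) ∂ν) : μ = ν := by
  exact Measure.ext_of_expNeg (fun i x => x i) (fun i => continuous_apply i)
    (fun x y hxy => funext hxy) μ ν h

lemma Measure.pi_enat_ext {ι : Type*} [Countable ι] (μ ν : Measure (ι → ℕ∞))
    [IsFiniteMeasure μ] [IsFiniteMeasure ν]
    (h : ∀ n : ι →₀ ℕ, ∫⁻ x, expNeg (n.sum fun i k => k * (x i : ℝ≥0∞)) ∂μ =
      ∫⁻ x, expNeg (n.sum fun i k => k * (x i : ℝ≥0∞)) ∂ν) : μ = ν := by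
  exact Measure.ext_of_expNeg (fun i x => (x i : ℝ≥0∞))
    (fun i => ENat.continuous_toENNReal.comp (continuous_apply i))
    (fun x y hxy => funext fun i => ENat.toENNReal_inj.1 (hxy i)) μ ν h

/-! ### Laplace functionals of Poisson processes -/

/-- The generating function of the Poisson law at `s = exp (-t)`, by the exponential series. The
value `t = ∞` is included and gives the probability of `0`. -/
lemma lintegral_expNeg_poissonMeasure (r : ℝ≥0) (t : ℝ≥0∞) :
    ∫⁻ n, expNeg (n * t) ∂(poissonMeasure r) = expNeg ((1 - expNeg t) * r) := by
  obtain ⟨s, hs⟩ : ∃ s : ℝ≥0, expNeg t = s := ⟨_, (ENNReal.coe_toNNReal (expNeg_ne_top t)).symm⟩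
  have hs1 : (s : ℝ) ≤ 1 := by exact_mod_cast hs ▸ expNeg_le_one t
  simp_rw [expNeg_natCast_mul, hs]
  have hr : (1 - (s : ℝ≥0∞)) * r = ENNReal.ofReal ((1 - s) * r) := by
    rw [ENNReal.ofReal_mul (by linarith), ENNReal.ofReal_sub _ s.coe_nonneg]
    simp
  rw [hr, expNeg_ofReal (mul_nonneg (by linarith) r.coe_nonneg), poissonMeasure, lintegral_sum_measure]
  simp_rw [lintegral_smul_measure, lintegral_dirac, smul_eq_mul]
  have : ∀ n : ℕ, ENNReal.ofReal (Real.exp (-r) * r ^ n / n.factorial) * (s : ℝ≥0∞) ^ n =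
      ENNReal.ofReal (Real.exp (-r) * ((r * s : ℝ) ^ n / n.factorial)) := by
    intro n
    rw [← ENNReal.ofReal_coe_nnreal, ← ENNReal.ofReal_pow s.coe_nonneg, ← ENNReal.ofReal_mul (by positivity)]
    congr 1
    rw [mul_pow]
    ring
  simp_rw [this]
  have hsum := (NormedSpace.expSeries_div_hasSum_exp (r * s : ℝ)).mul_left (Real.exp (-r))
  rw [← ENNReal.ofReal_tsum_of_nonneg (fun n => by positivity) hsum.summable, hsum.tsum_eq,
    ← Real.exp_eq_exp_ℝ, ← Real.exp_add]
  congr 2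
  ring

lemma lintegral_prod_infinitePi {ι : Type*} {E : ι → Type*} [∀ i, MeasurableSpace (E i)]
    (P : ∀ i, Measure (E i)) [∀ i, IsProbabilityMeasure (P i)] (s : Finset ι)
    (g : ∀ i, E i → ℝ≥0∞) (hg : ∀ i, Measurable (g i)) :
    ∫⁻ x, ∏ i ∈ s, g i (x i) ∂(Measure.infinitePi P) = ∏ i ∈ s, ∫⁻ y, g i y ∂(P i) := by
  refine (lintegral_prod_eq_prod_lintegral_of_indepFun s
    (fun i (x : ∀ i, E i) => g i (x i))
    (iIndepFun_infinitePi hg) (fun i => (hg i).comp (measurable_pi_apply i))).trans ?_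
  refine Finset.prod_congr rfl fun i _ => ?_
  conv_rhs => rw [← Measure.infinitePi_map_eval P i]
  rw [lintegral_map (hg i) (measurable_pi_apply i)]

lemma measurable_natCast_pi {ι : Type*} :
    Measurable fun (z : ι → ℕ) (k : ι) => (z k : ℕ∞) :=
  measurable_pi_iff.2 fun k => (Measurable.of_discrete (f := fun n : ℕ => (n : ℕ∞))).comp
    (measurable_pi_apply k)

instance poissonProd.isProbabilityMeasure (rate : ℕ+ → ℝ) :
    IsProbabilityMeasure (poissonProd rate) :=
  Measure.isProbabilityMeasure_map measurable_natCast_pi.aemeasurable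

lemma lintegral_expNeg_poissonProd (rate : ℕ+ → ℝ) (n : ℕ+ →₀ ℕ) :
    ∫⁻ z, expNeg (n.sum fun i k => k * (z i : ℝ≥0∞)) ∂(poissonProd rate) =
      expNeg (n.sum fun i k => (1 - expNeg k) * ENNReal.ofReal (rate i)) := by
  have hm : Measurable fun z : ℕ+ → ℕ∞ => expNeg (n.sum fun i k => k * (z i : ℝ≥0∞)) := by
    unfold Finsupp.sum; fun_prop
  rw [poissonProd, lintegral_map hm measurable_natCast_pi]
  simp only [Finsupp.sum, expNeg_sum, ENat.toENNReal_coe]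
  rw [lintegral_prod_infinitePi _ n.support
    (fun (i : ℕ+) (z : ℕ) => expNeg (n i * (z : ℝ≥0∞))) (fun i => by fun_prop)]
  refine Finset.prod_congr rfl fun i _ => ?_
  simp_rw [mul_comm (n i : ℝ≥0∞)]
  rw [lintegral_expNeg_poissonMeasure]
  rfl

section Poisson

variable {Ω E : Type*} [MeasurableSpace Ω] [MeasurableSpace E]

lemma measurable_lintegral_randomMeasure {N : Ω → Measure E}
    (hN : ∀ A, MeasurableSet A → Measurable fun ω => N ω A) {f : E → ℝ≥0∞} (hf : Measurable f) :
    Measurable fun ω => ∫⁻ x, f x ∂(N ω) :=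
  (Measure.measurable_lintegral hf).comp (Measure.measurable_of_measurable_coe _ hN)

/-- The Laplace functional formula of Poisson processes passes to increasing limits. -/
lemma laplace_of_tendsto {μ : Measure Ω} [IsProbabilityMeasure μ] {N : Ω → Measure E}
    {Λ : Measure E} (hN : ∀ A, MeasurableSet A → Measurable fun ω => N ω A)
    {f : E → ℝ≥0∞} {F : ℕ → E → ℝ≥0∞} (hF : ∀ n, Measurable (F n))
    (hmono : ∀ x, Monotone fun n => F n x) (hlim : ∀ x, Tendsto (fun n => F n x) atTop (𝓝 (f x)))
    (h : ∀ n, ∫⁻ ω, expNeg (∫⁻ x, F n x ∂(N ω)) ∂μ = expNeg (∫⁻ x, (1 - expNeg (F n x)) ∂Λ)) :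
    ∫⁻ ω, expNeg (∫⁻ x, f x ∂(N ω)) ∂μ = expNeg (∫⁻ x, (1 - expNeg (f x)) ∂Λ) := by
  have h1 : Tendsto (fun n => ∫⁻ ω, expNeg (∫⁻ x, F n x ∂(N ω)) ∂μ) atTop
      (𝓝 (∫⁻ ω, expNeg (∫⁻ x, f x ∂(N ω)) ∂μ)) := by
    refine tendsto_lintegral_of_dominated_convergence (fun _ => 1)
      (fun n => measurable_expNeg.comp (measurable_lintegral_randomMeasure hN (hF n)))
      (fun n => ae_of_all _ fun ω => expNeg_le_one _) (by simp) (ae_of_all _ fun ω => ?_)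
    exact (continuous_expNeg.tendsto _).comp (lintegral_tendsto_of_tendsto_of_monotone
      (fun n => (hF n).aemeasurable) (ae_of_all _ hmono) (ae_of_all _ hlim))
  have h2 : Tendsto (fun n => expNeg (∫⁻ x, (1 - expNeg (F n x)) ∂Λ)) atTop
      (𝓝 (expNeg (∫⁻ x, (1 - expNeg (f x)) ∂Λ))) := by
    refine (continuous_expNeg.tendsto _).comp (lintegral_tendsto_of_tendsto_of_monotone
      (fun n => ?_) (ae_of_all _ fun x m n hmn => ?_) (ae_of_all _ fun x => ?_))
    · exact (measurable_const.sub (measurable_expNeg.comp (hF n))).aemeasurable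
    · exact tsub_le_tsub_left (expNeg_antitone (hmono x hmn)) _
    · exact ENNReal.Tendsto.sub tendsto_const_nhds ((continuous_expNeg.tendsto _).comp (hlim x))
        (Or.inl ENNReal.one_ne_top)
  simp_rw [h] at h1
  exact tendsto_nhds_unique h1 h2

/-- The Laplace functional for a multiple of an indicator, the building block of simple functions.
When `Λ A = ∞`, the value `c = 0` is separate, since `0 * ∞ = 0` on both sides. -/
lemma IsPoissonProcess.lintegral_expNeg_mul {μ : Measure Ω} [IsProbabilityMeasure μ]
    {N : Ω → Measure E} {Λ : Measure E} (hP : IsPoissonProcess μ N Λ) {A : Set E}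
    (hA : MeasurableSet A) (c : ℝ≥0∞) :
    ∫⁻ ω, expNeg (c * N ω A) ∂μ = expNeg ((1 - expNeg c) * Λ A) := by
  by_cases hΛ : Λ A = ∞
  · rcases eq_or_ne c 0 with rfl | hc
    · simp
    have h1 : 1 - expNeg c ≠ 0 := by
      intro h0
      have : expNeg c = expNeg 0 := by
        rw [expNeg_zero]; exact le_antisymm (expNeg_le_one c) (tsub_eq_zero_iff_le.1 h0)
      exact hc (expNeg_injective this)
    rw [hΛ, ENNReal.mul_top h1, expNeg_top, lintegral_eq_zero_iff'
      (f := fun ω => expNeg (c * N ω A))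
      (measurable_expNeg.comp ((hP.measurable A hA).const_mul c)).aemeasurable]
    filter_upwards [hP.law_of_infinite A hA hΛ] with ω hω
    simp [hω, ENNReal.mul_top hc]
  · have : ∫⁻ ω, expNeg (c * N ω A) ∂μ = ∫⁻ y, expNeg (c * y) ∂(μ.map fun ω => N ω A) := by
      rw [lintegral_map (by fun_prop) (hP.measurable A hA)]
    rw [this, hP.law_of_finite A hA hΛ, lintegral_map (by fun_prop) (by fun_prop)]
    simp_rw [mul_comm c]
    rw [lintegral_expNeg_poissonMeasure, ENNReal.coe_toNNReal hΛ]

/-- The Laplace functional of a Poisson process. -/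
lemma IsPoissonProcess.laplace {μ : Measure Ω} [IsProbabilityMeasure μ]
    {N : Ω → Measure E} {Λ : Measure E} (hP : IsPoissonProcess μ N Λ) {f : E → ℝ≥0∞}
    (hf : Measurable f) :
    ∫⁻ ω, expNeg (∫⁻ x, f x ∂(N ω)) ∂μ = expNeg (∫⁻ x, (1 - expNeg (f x)) ∂Λ) := by
  refine laplace_of_tendsto hP.measurable (F := fun n x => SimpleFunc.eapprox f n x)
    (fun n => (SimpleFunc.eapprox f n).measurable)
    (fun x m n hmn => SimpleFunc.monotone_eapprox f hmn x)
    (fun x => SimpleFunc.tendsto_eapprox hf x) fun n => ?_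
  -- The level sets of a simple function are finitely many and disjoint, so the exponential of its
  -- integral is a product of independent factors.
  generalize SimpleFunc.eapprox f n = g
  have h1 : ∀ ω, ∫⁻ x, g x ∂(N ω) =
      ∑ j : g.range, (j : ℝ≥0∞) * N ω (g ⁻¹' {(j : ℝ≥0∞)}) := by
    intro ω
    rw [SimpleFunc.lintegral_eq_lintegral, SimpleFunc.lintegral, Finset.sum_coe_sort g.range
      (fun c => c * N ω (g ⁻¹' {c}))]
  have h2 : ∫⁻ x, (1 - expNeg (g x)) ∂Λ =
      ∑ j : g.range, (1 - expNeg (j : ℝ≥0∞)) * Λ (g ⁻¹' {(j : ℝ≥0∞)}) := by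
    have := SimpleFunc.lintegral_eq_lintegral (g.map fun y => 1 - expNeg y) Λ
    simp only [SimpleFunc.coe_map, Function.comp] at this
    rw [this, SimpleFunc.map_lintegral, Finset.sum_coe_sort g.range
      (fun c => (1 - expNeg c) * Λ (g ⁻¹' {c}))]
  simp_rw [h1, h2]
  -- Independence is given for families indexed by `Fin m`, hence the numbering of the values.
  let e := Fintype.equivFin g.range
  simp_rw [← fun F : g.range → ℝ≥0∞ => Equiv.sum_comp e.symm F, expNeg_sum]
  have hind := hP.indep _ (fun j => g ⁻¹' {(e.symm j : ℝ≥0∞)})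
    (fun j => g.measurableSet_fiber _) (fun i j hij => by
      change Disjoint (g ⁻¹' {(e.symm i : ℝ≥0∞)}) (g ⁻¹' {(e.symm j : ℝ≥0∞)})
      rw [Set.disjoint_left]
      rintro x hx hy
      exact hij (e.symm.injective (Subtype.ext (hx.symm.trans hy))))
  have hind' := hind.comp (fun j y => expNeg ((e.symm j : ℝ≥0∞) * y)) (fun j => by fun_prop)
  refine (lintegral_prod_eq_prod_lintegral_of_indepFun Finset.univ _ hind'
    (fun j => (by fun_prop : Measurable fun y => expNeg ((e.symm j : ℝ≥0∞) * y)).comp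
      (hP.measurable _ (g.measurableSet_fiber _)))).trans ?_
  exact Finset.prod_congr rfl fun j _ => hP.lintegral_expNeg_mul (g.measurableSet_fiber _) _

/-- A random measure whose Laplace functional is that of a Poisson process is one. -/
lemma IsPoissonProcess.of_laplace {μ : Measure Ω} [IsProbabilityMeasure μ]
    {N : Ω → Measure E} {Λ : Measure E}
    (hN : ∀ A, MeasurableSet A → Measurable fun ω => N ω A)
    (h : ∀ f : E → ℝ≥0∞, Measurable f →
      ∫⁻ ω, expNeg (∫⁻ x, f x ∂(N ω)) ∂μ = expNeg (∫⁻ x, (1 - expNeg (f x)) ∂Λ)) :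
    IsPoissonProcess μ N Λ := by
  have h1 : ∀ (c : ℝ≥0∞) A, MeasurableSet A →
      ∫⁻ ω, expNeg (c * N ω A) ∂μ = expNeg ((1 - expNeg c) * Λ A) := by
    intro c A hA
    have := h (A.indicator fun _ => c) (measurable_const.indicator hA)
    have heq : (fun x => 1 - expNeg (A.indicator (fun _ => c) x)) =
        A.indicator fun _ => 1 - expNeg c := by
      ext x; by_cases hx : x ∈ A <;> simp [hx]
    simpa only [heq, lintegral_indicator hA, lintegral_const, Measure.restrict_apply,
      MeasurableSet.univ, Set.univ_inter] using this
  refine ⟨hN, fun A hA hΛ => ?_, fun A hA hΛ => ?_, fun m A hA hdisj => ?_⟩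
  · have : IsProbabilityMeasure (μ.map fun ω => N ω A) :=
      Measure.isProbabilityMeasure_map (hN A hA).aemeasurable
    have : IsProbabilityMeasure
        ((poissonMeasure (Λ A).toNNReal).map fun n : ℕ => (n : ℝ≥0∞)) :=
      Measure.isProbabilityMeasure_map (by fun_prop)
    refine Measure.ext_of_expNeg (fun (_ : Unit) (x : ℝ≥0∞) => x) (fun _ => continuous_id)
      (fun x y hxy => hxy ()) _ _ fun n => ?_
    have hn : ∀ x : ℝ≥0∞, n.sum (fun _ k => (k : ℝ≥0∞) * x) = n () * x := fun x => by
      rw [Finsupp.sum_fintype _ _ (by simp)]; simp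
    simp_rw [hn]
    rw [lintegral_map (by fun_prop) (hN A hA), h1 _ _ hA, lintegral_map (by fun_prop) (by fun_prop)]
    simp_rw [mul_comm (n _ : ℝ≥0∞)]
    rw [lintegral_expNeg_poissonMeasure, ENNReal.coe_toNNReal hΛ]
  -- Any positive multiple would do: a transform equal to `0` forces the count to be infinite almost
  -- surely.
  · have := h1 1 A hA
    have h0 : 1 - expNeg 1 ≠ 0 := by
      intro h0
      have : expNeg 1 = expNeg 0 := by
        rw [expNeg_zero]; exact le_antisymm (expNeg_le_one _) (tsub_eq_zero_iff_le.1 h0)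
      exact one_ne_zero (expNeg_injective this)
    rw [hΛ, ENNReal.mul_top h0, expNeg_top, lintegral_eq_zero_iff'
      (f := fun ω => expNeg (1 * N ω A))
      (measurable_expNeg.comp ((hN A hA).const_mul 1)).aemeasurable] at this
    filter_upwards [this] with ω hω
    refine expNeg_injective ?_
    simpa using hω
  · rw [iIndepFun_iff_map_fun_eq_infinitePi_map (fun j => hN _ (hA j))]
    have hmeas : Measurable fun ω j => N ω (A j) := measurable_pi_iff.2 fun j => hN _ (hA j)
    have : IsProbabilityMeasure (μ.map fun ω j => N ω (A j)) :=
      Measure.isProbabilityMeasure_map hmeas.aemeasurable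
    have : ∀ j, IsProbabilityMeasure (μ.map fun ω => N ω (A j)) := fun j =>
      Measure.isProbabilityMeasure_map (hN _ (hA j)).aemeasurable
    refine Measure.pi_ennreal_ext _ _ fun n => ?_
    have hn : ∀ x : Fin m → ℝ≥0∞, n.sum (fun i k => (k : ℝ≥0∞) * x i) = ∑ j, n j * x j :=
      fun x => Finsupp.sum_fintype _ _ (by simp)
    simp_rw [hn]
    rw [lintegral_map (by fun_prop) hmeas]
    have hR : ∫⁻ x, expNeg (∑ j, n j * x j) ∂(Measure.infinitePi fun j => μ.map fun ω => N ω (A j))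
        = ∏ j, expNeg ((1 - expNeg (n j)) * Λ (A j)) := by
      simp_rw [expNeg_sum]
      rw [lintegral_prod_infinitePi _ Finset.univ (fun j y => expNeg (n j * y))
        (fun j => by fun_prop)]
      refine Finset.prod_congr rfl fun j _ => ?_
      rw [lintegral_map (by fun_prop) (hN _ (hA j)), h1 _ _ (hA j)]
    rw [hR, ← expNeg_sum]
    have hL := h (fun x => ∑ j, (A j).indicator (fun _ => (n j : ℝ≥0∞)) x)
      (Finset.measurable_fun_sum _ fun j _ => measurable_const.indicator (hA j))
    -- By disjointness at most one indicator is nonzero at `x`, which makes the nonlinear map `1 -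
    -- expNeg` additive here; the joint transform then factorises.
    have heq : (fun x => 1 - expNeg (∑ j, (A j).indicator (fun _ => (n j : ℝ≥0∞)) x)) =
        fun x => ∑ j, (A j).indicator (fun _ => 1 - expNeg (n j)) x := by
      ext x
      by_cases hx : ∃ j, x ∈ A j
      · obtain ⟨j, hj⟩ := hx
        have hne : ∀ i, i ≠ j → x ∉ A i := fun i hij hi =>
          Set.disjoint_left.1 (hdisj hij) hi hj
        rw [Finset.sum_eq_single j (fun i _ hij => by simp [hne i hij]) (by simp),
          Finset.sum_eq_single j (fun i _ hij => by simp [hne i hij]) (by simp)]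
        simp [hj]
      · push Not at hx
        simp [hx]
    simp_rw [heq, lintegral_finsetSum _ (fun j _ => measurable_const.indicator (hA j)),
      lintegral_indicator (hA _)] at hL
    simpa using hL

end Poisson

/-! ### Integrating out a fresh coordinate of an infinite product -/

/-- `F` sees only the coordinates before `n`, hence is independent of coordinate `n`, and Fubini
integrates the latter alone. It serves both the gaps of the chain and the uniform variables behind
the marks. -/
lemma lintegral_infinitePi_fresh {E α : Type*} [MeasurableSpace E] [MeasurableSpace α]
    (ν : Measure E) [IsProbabilityMeasure ν] {F : (ℕ → E) → α} (hF : Measurable F) (n : ℕ)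
    (hdep : ∀ v w : ℕ → E, (∀ i < n, v i = w i) → F v = F w) {ρ : α → E → ℝ≥0∞}
    (hρ : Measurable (Function.uncurry ρ)) :
    ∫⁻ v, ρ (F v) (v n) ∂(Measure.infinitePi fun _ : ℕ => ν) =
      ∫⁻ v, ∫⁻ e, ρ (F v) e ∂ν ∂(Measure.infinitePi fun _ : ℕ => ν) := by
  obtain ⟨e₀⟩ : Nonempty E := nonempty_of_isProbabilityMeasure ν
  -- Padding with an arbitrary `e₀` factors `F` measurably through finitely many coordinates, as
  -- independence of finite blocks requires.
  let ext : ((i : Finset.range n) → E) → ℕ → E :=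
    fun u i => if h : i ∈ Finset.range n then u ⟨i, h⟩ else e₀
  have hext : Measurable ext := measurable_pi_iff.2 fun i => by
    by_cases h : i ∈ Finset.range n
    · simp only [ext, dif_pos h]
      exact measurable_pi_apply (⟨i, h⟩ : Finset.range n)
    · simp only [ext, dif_neg h]
      exact measurable_const
  have hFext : ∀ v, F v = F (ext fun i => v i) := fun v => hdep _ _ fun i hi => by
    simp [ext, hi]
  have hind : IndepFun F (fun v => v n) (Measure.infinitePi fun _ : ℕ => ν) := by
    have h1 : iIndepFun (fun (i : ℕ) (v : ℕ → E) => v i) (Measure.infinitePi fun _ : ℕ => ν) :=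
      iIndepFun_infinitePi (X := fun _ x => x) fun _ => measurable_id
    have h2 := h1.indepFun_finset (Finset.range n) {n} (by simp) fun i => measurable_pi_apply i
    have h3 := h2.comp (hF.comp hext)
      (measurable_pi_apply (⟨n, by simp⟩ : ({n} : Finset ℕ)))
    have h4 : F = (F ∘ ext) ∘ fun a (i : Finset.range n) => a i := funext hFext
    rw [h4]
    exact h3
  have hmap := (indepFun_iff_map_prod_eq_prod_map_map hF.aemeasurable
    (measurable_pi_apply n).aemeasurable).1 hind
  rw [Measure.infinitePi_map_eval (fun _ : ℕ => ν) n] at hmap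
  calc ∫⁻ v, ρ (F v) (v n) ∂(Measure.infinitePi fun _ : ℕ => ν)
      = ∫⁻ p, Function.uncurry ρ p
          ∂((Measure.infinitePi fun _ : ℕ => ν).map fun v => (F v, v n)) := by
        rw [lintegral_map hρ (hF.prodMk (measurable_pi_apply n))]; rfl
    _ = _ := by
        have : IsProbabilityMeasure ((Measure.infinitePi fun _ : ℕ => ν).map F) :=
          Measure.isProbabilityMeasure_map hF.aemeasurable
        rw [hmap, lintegral_prod _ hρ.aemeasurable, lintegral_map hρ.lintegral_prod_right' hF]
        rfl

/-! ### Beta laws -/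

lemma beta_one_right {a : ℝ} (ha : 0 < a) : beta a 1 = 1 / a := by
  have := (Real.Gamma_pos_of_pos ha).ne'
  rw [beta, Real.Gamma_one, Real.Gamma_add_one ha.ne']
  field_simp

lemma beta_succ_left {a b : ℝ} (hb : 0 < b) (ha : 0 < a) :
    beta (b + 1) a = b / (a + b) * beta b a := by
  have h1 := (Real.Gamma_pos_of_pos ha).ne'
  have h2 := (Real.Gamma_pos_of_pos (add_pos hb ha)).ne'
  have h3 : b + a ≠ 0 := (add_pos hb ha).ne'
  rw [beta, beta, show b + 1 + a = (b + a) + 1 by ring, Real.Gamma_add_one hb.ne',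
    Real.Gamma_add_one h3, add_comm a b]
  field_simp

lemma lintegral_betaMeasure (b a : ℝ) {φ : ℝ → ℝ≥0∞} (hφ : Measurable φ) :
    ∫⁻ x, φ x ∂(betaMeasure b a) = ∫⁻ x in Set.Ioo 0 1,
      ENNReal.ofReal (1 / beta b a * x ^ (b - 1) * (1 - x) ^ (a - 1)) * φ x := by
  have hm : Measurable (betaPDF b a) := (measurable_betaPDFReal b a).ennreal_ofReal
  rw [betaMeasure, lintegral_withDensity_eq_lintegral_mul _ hm hφ, ← lintegral_indicator
    measurableSet_Ioo]
  refine lintegral_congr fun x => ?_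
  by_cases hx : x ∈ Set.Ioo (0 : ℝ) 1
  · rw [Set.indicator_of_mem hx, Pi.mul_apply, betaPDF_of_pos_lt_one hx.1 hx.2]
  · rw [Set.indicator_of_notMem hx, Pi.mul_apply, betaPDF, betaPDFReal, if_neg (by exact hx)]
    simp

lemma ae_betaMeasure_mem_Ioo (b a : ℝ) : ∀ᵐ x ∂(betaMeasure b a), x ∈ Set.Ioo (0 : ℝ) 1 := by
  rw [ae_iff]
  change betaMeasure b a (Set.Ioo (0 : ℝ) 1)ᶜ = 0
  rw [← lintegral_indicator_one measurableSet_Ioo.compl,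
    lintegral_betaMeasure b a (measurable_one.indicator measurableSet_Ioo.compl)]
  rw [setLIntegral_eq_zero measurableSet_Ioo]
  intro x hx
  simp [hx]

/-- Size-biasing a beta law. -/
lemma lintegral_ofReal_mul_betaMeasure {a b : ℝ} (hb : 0 < b) (ha : 0 < a) {φ : ℝ → ℝ≥0∞}
    (hφ : Measurable φ) :
    ∫⁻ x, ENNReal.ofReal x * φ x ∂(betaMeasure b a) =
      ENNReal.ofReal (b / (a + b)) * ∫⁻ x, φ x ∂(betaMeasure (b + 1) a) := by
  rw [lintegral_betaMeasure _ _ (by fun_prop), lintegral_betaMeasure _ _ hφ,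
    ← lintegral_const_mul _ (by fun_prop)]
  refine setLIntegral_congr_fun measurableSet_Ioo fun x hx => ?_
  have hB := (beta_pos hb ha)
  have h1x : 0 < 1 - x := sub_pos.2 hx.2
  have hx0 := hx.1
  rw [← mul_assoc, ← mul_assoc, ← ENNReal.ofReal_mul (by positivity),
    ← ENNReal.ofReal_mul (by positivity)]
  congr 2
  rw [beta_succ_left hb ha, show b + 1 - 1 = (b - 1) + 1 by ring, Real.rpow_add_one hx0.ne']
  field_simp

/-! ### The step kernel of the chain of points -/

lemma lintegral_comp_one_sub_mul {c : ℝ} (hc : 0 < c) {G : ℝ → ℝ≥0∞} (hG : Measurable G) :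
    ∫⁻ v, ENNReal.ofReal c * G (1 - c * v) = ∫⁻ y, G y := by
  rw [← lintegral_sub_left_eq_self G 1, lintegral_const_mul _ (by fun_prop)]
  have h := lintegral_map (μ := volume) (f := fun u => G (1 - u)) (g := fun v => c * v)
    (by fun_prop) (by fun_prop)
  rw [← h, Real.map_volume_mul_left hc.ne', lintegral_smul_measure, smul_eq_mul, ← mul_assoc,
    ← ENNReal.ofReal_mul hc.le, abs_of_pos (inv_pos.2 hc), mul_inv_cancel₀ hc.ne',
    ENNReal.ofReal_one, one_mul]

/-- The density on `(x, 1)` of the next point after `x`. -/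
def stepDensity (a x y : ℝ) : ℝ := a * (1 - y) ^ (a - 1) / (1 - x) ^ a

@[fun_prop] lemma measurable_stepDensity (a x : ℝ) : Measurable (stepDensity a x) := by
  unfold stepDensity; fun_prop

/-- The substitution `y = 1 - (1 - x) v`: shrinking the distance to `1` by a Beta(a, 1) factor is a
jump with density `stepDensity a x`. -/
lemma lintegral_step {a x : ℝ} (ha : 0 < a) (hx : x < 1) {φ : ℝ → ℝ≥0∞} (hφ : Measurable φ) :
    ∫⁻ v, φ (1 - (1 - x) * v) ∂(betaMeasure a 1) =
      ∫⁻ y in Set.Ioo x 1, ENNReal.ofReal (stepDensity a x y) * φ y := by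
  have hc : 0 < 1 - x := sub_pos.2 hx
  rw [lintegral_betaMeasure _ _ (by fun_prop), ← lintegral_indicator measurableSet_Ioo,
    ← lintegral_indicator measurableSet_Ioo, ← lintegral_comp_one_sub_mul hc
      ((by fun_prop : Measurable fun y => ENNReal.ofReal (stepDensity a x y) * φ y).indicator
        measurableSet_Ioo)]
  refine lintegral_congr fun v => ?_
  have hiff : 1 - (1 - x) * v ∈ Set.Ioo x 1 ↔ v ∈ Set.Ioo (0 : ℝ) 1 := by
    constructor
    · rintro ⟨h1, h2⟩
      exact ⟨by nlinarith, by nlinarith⟩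
    · rintro ⟨h1, h2⟩
      exact ⟨by nlinarith, by nlinarith⟩
  by_cases hv : v ∈ Set.Ioo (0 : ℝ) 1
  · rw [Set.indicator_of_mem hv, Set.indicator_of_mem (hiff.2 hv), ← mul_assoc,
      ← ENNReal.ofReal_mul hc.le]
    congr 2
    rw [beta_one_right ha, stepDensity, sub_sub_cancel, Real.mul_rpow hc.le hv.1.le,
      Real.rpow_sub_one hc.ne', sub_self, Real.rpow_zero]
    have := (Real.rpow_pos_of_pos hc a).ne'
    field_simp
  · rw [Set.indicator_of_notMem hv, Set.indicator_of_notMem (mt hiff.1 hv), mul_zero]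

lemma lintegral_stepDensity {a x : ℝ} (ha : 0 < a) (hx : x < 1) :
    ∫⁻ y in Set.Ioo x 1, ENNReal.ofReal (stepDensity a x y) = 1 := by
  have := isProbabilityMeasureBeta ha one_pos
  simpa using (lintegral_step ha hx (φ := fun _ => 1) measurable_const).symm

/-! ### The backward equation of the chain of points -/

lemma abs_exp_neg_sub_le {s t : ℝ} (hs : 0 ≤ s) (ht : 0 ≤ t) :
    |Real.exp (-s) - Real.exp (-t)| ≤ |s - t| := by
  wlog hst : s ≤ t generalizing s t
  · rw [abs_sub_comm, abs_sub_comm s]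
    exact this ht hs (le_of_not_ge hst)
  have h1 : Real.exp (-t) ≤ Real.exp (-s) := Real.exp_le_exp.2 (by linarith)
  rw [abs_of_nonneg (by linarith), abs_of_nonpos (by linarith)]
  have h2 : Real.exp (-s) ≤ 1 := Real.exp_le_one_iff.2 (by linarith)
  have h3 : Real.exp (-t) = Real.exp (-s) * Real.exp (s - t) := by rw [← Real.exp_add]; ring_nf
  have h4 := Real.add_one_le_exp (s - t)
  nlinarith [Real.exp_pos (-s)]

/-- The integrand is minus the derivative of `exp (-∫ ψ)`, but only almost everywhere, as `ψ` is
merely measurable. Boundedness of `ψ` makes this function Lipschitz, hence absolutely continuous,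
which is enough for the fundamental theorem. -/
lemma integral_mul_exp_neg_integral {ψ : ℝ → ℝ} (hψ : Measurable ψ) {M : ℝ}
    (h0 : ∀ y, 0 ≤ ψ y) (hM : ∀ y, ψ y ≤ M) {x c : ℝ} (hxc : x ≤ c) :
    ∫ y in x..c, ψ y * Real.exp (-∫ t in x..y, ψ t) = 1 - Real.exp (-∫ t in x..c, ψ t) := by
  have hbd : ∀ y, ‖ψ y‖ ≤ M := fun y => by rw [Real.norm_of_nonneg (h0 y)]; exact hM y
  have hint : ∀ u v : ℝ, IntervalIntegrable ψ volume u v := fun u v =>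
    (intervalIntegrable_const (c := M)).mono_fun' hψ.aestronglyMeasurable (ae_of_all _ hbd)
  let F : ℝ → ℝ := fun y => Real.exp (-∫ t in x..y, ψ t)
  have hlip : LipschitzOnWith M.toNNReal F (Set.uIcc x c) := by
    refine LipschitzOnWith.of_dist_le_mul fun y hy z hz => ?_
    rw [Set.uIcc_of_le hxc] at hy hz
    have hM0 : 0 ≤ M := (h0 0).trans (hM 0)
    rw [Real.dist_eq, Real.dist_eq, Real.coe_toNNReal _ hM0]
    refine (abs_exp_neg_sub_le (intervalIntegral.integral_nonneg hy.1 fun t _ => h0 t)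
      (intervalIntegral.integral_nonneg hz.1 fun t _ => h0 t)).trans ?_
    rw [intervalIntegral.integral_interval_sub_left (hint _ _) (hint _ _)]
    exact intervalIntegral.norm_integral_le_of_norm_le_const fun t _ => hbd t
  have hder : ∀ᵐ y, y ∈ Set.uIcc x c → deriv F y = -(ψ y * Real.exp (-∫ t in x..y, ψ t)) := by
    filter_upwards [(hint x c).ae_hasDerivAt_integral] with y hy hyc
    have := ((hy hyc x Set.left_mem_uIcc).neg.exp).deriv
    rw [mul_neg, mul_comm] at this
    exact this
  have hFTC := hlip.absolutelyContinuousOnInterval.integral_deriv_eq_sub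
  rw [intervalIntegral.integral_congr_ae (g := fun y => -(ψ y * Real.exp (-∫ t in x..y, ψ t)))
    (by filter_upwards [hder] with y hy hyc using hy (Set.uIoc_subset_uIcc hyc)),
    intervalIntegral.integral_neg] at hFTC
  simp only [F, intervalIntegral.integral_same, neg_zero, Real.exp_zero] at hFTC
  linarith

/-- The intensity measure of the points, given that the initial one is `x`. -/
def recordMeasure (a x : ℝ) : Measure ℝ :=
  volume.withDensity fun y => ENNReal.ofReal (recordIntensity a x y)

lemma measurable_uncurry_recordIntensity (a : ℝ) :
    Measurable (Function.uncurry (recordIntensity a)) := by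
  unfold recordIntensity Function.uncurry
  exact Measurable.ite ((measurableSet_lt measurable_fst measurable_snd).inter
    (measurableSet_lt measurable_snd measurable_const)) (by fun_prop) measurable_const

@[fun_prop] lemma measurable_recordIntensity (a x : ℝ) : Measurable (recordIntensity a x) :=
  (measurable_uncurry_recordIntensity a).comp measurable_prodMk_left

lemma lintegral_recordMeasure (a x : ℝ) {G : ℝ → ℝ≥0∞} (hG : Measurable G) :
    ∫⁻ y, G y ∂(recordMeasure a x) = ∫⁻ y in Set.Ioo x 1, ENNReal.ofReal (a / (1 - y)) * G y := by
  rw [recordMeasure, lintegral_withDensity_eq_lintegral_mul _ (by fun_prop) hG,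
    ← lintegral_indicator measurableSet_Ioo]
  refine lintegral_congr fun y => ?_
  by_cases hy : y ∈ Set.Ioo x 1
  · rw [Set.indicator_of_mem hy, Pi.mul_apply, recordIntensity, if_pos (by exact hy)]
  · rw [Set.indicator_of_notMem hy, Pi.mul_apply, recordIntensity, if_neg (by exact hy)]
    simp

lemma measurable_lintegral_recordMeasure (a : ℝ) {G : ℝ → ℝ≥0∞} (hG : Measurable G) :
    Measurable fun x => ∫⁻ y, G y ∂(recordMeasure a x) := by
  have : ∀ x, ∫⁻ y, G y ∂(recordMeasure a x) =
      ∫⁻ y, ENNReal.ofReal (recordIntensity a x y) * G y := fun x => by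
    rw [recordMeasure, lintegral_withDensity_eq_lintegral_mul _ (by fun_prop) hG]; rfl
  simp_rw [this]
  exact Measurable.lintegral_prod_right'
    (f := fun p : ℝ × ℝ => ENNReal.ofReal (recordIntensity a p.1 p.2) * G p.2)
    ((measurable_uncurry_recordIntensity a).ennreal_ofReal.mul (hG.comp measurable_snd))

/-- The Laplace functional of a Poisson process with intensity measure `recordMeasure a x`, as a
function of the factor `h` contributed by each point. -/
def recordLaplace (a : ℝ) (h : ℝ → ℝ≥0∞) (x : ℝ) : ℝ≥0∞ :=
  expNeg (∫⁻ y, (1 - h y) ∂(recordMeasure a x))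

lemma measurable_recordLaplace (a : ℝ) {h : ℝ → ℝ≥0∞} (hh : Measurable h) :
    Measurable (recordLaplace a h) :=
  measurable_expNeg.comp (measurable_lintegral_recordMeasure a (measurable_const.sub hh))

lemma recordLaplace_eq_one {a c x : ℝ} {h : ℝ → ℝ≥0∞} (hh : Measurable h)
    (hc1 : ∀ y, c < y → h y = 1) (hx : c ≤ x) : recordLaplace a h x = 1 := by
  rw [recordLaplace, lintegral_recordMeasure a x (G := fun y => 1 - h y) (measurable_const.sub hh),
    setLIntegral_eq_zero measurableSet_Ioo, expNeg_zero]
  intro y hy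
  simp [hc1 y (hx.trans_lt hy.1)]

/-- The one-step equation, for factors that are `1` beyond `c < 1`. -/
lemma lintegral_stepDensity_mul_recordLaplace {a c x : ℝ} (ha : 0 < a) (hc : c < 1) (hx : x < 1)
    {h : ℝ → ℝ≥0∞} (hh : Measurable h) (h1 : ∀ y, h y ≤ 1) (hc1 : ∀ y, c < y → h y = 1) :
    ∫⁻ y in Set.Ioo x 1, ENNReal.ofReal (stepDensity a x y) * (h y * recordLaplace a h y) =
      recordLaplace a h x := by
  -- Past `c` no point contributes: both sides are `1`, the left one as the total mass of the step
  -- density.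
  rcases le_or_gt c x with hcx | hxc
  · rw [recordLaplace_eq_one hh hc1 hcx, ← lintegral_stepDensity ha hx]
    refine setLIntegral_congr_fun measurableSet_Ioo fun y hy => ?_
    simp only [hc1 y (hcx.trans_lt hy.1), recordLaplace_eq_one hh hc1 (hcx.trans hy.1.le), mul_one]
  -- real-valued versions
  let k : ℝ → ℝ := fun y => (h y).toReal
  have hk : Measurable k := hh.ennreal_toReal
  have hk0 : ∀ y, 0 ≤ k y := fun y => ENNReal.toReal_nonneg
  have hk1 : ∀ y, k y ≤ 1 := fun y => by simpa using ENNReal.toReal_mono ENNReal.one_ne_top (h1 y)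
  have hhk : ∀ y, h y = ENNReal.ofReal (k y) := fun y =>
    (ENNReal.ofReal_toReal (ne_top_of_le_ne_top ENNReal.one_ne_top (h1 y))).symm
  -- The rate `a / (1 - y)` switched off after `c`, hence bounded by `a / (1 - c)`. The `min`
  -- changes no value and only eases that bound.
  let α : ℝ → ℝ := fun y => if y ≤ c then a / (1 - min y c) else 0
  have hα : Measurable α := Measurable.ite measurableSet_Iic (by fun_prop) measurable_const
  have hα0 : ∀ y, 0 ≤ α y := fun y => by
    have : min y c ≤ c := min_le_right _ _
    simp only [α]; split_ifs
    · exact div_nonneg ha.le (by linarith)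
    · exact le_rfl
  have hαM : ∀ y, α y ≤ a / (1 - c) := fun y => by
    have : min y c ≤ c := min_le_right _ _
    have : 0 < 1 - c := by linarith
    simp only [α]; split_ifs
    · gcongr
    · positivity
  have hαeq : ∀ y, y ≤ c → α y = a / (1 - y) := fun y hy => by simp [α, hy]
  let ψ : ℝ → ℝ := fun y => k y * α y
  have hψ : Measurable ψ := hk.mul hα
  have hψ0 : ∀ y, 0 ≤ ψ y := fun y => mul_nonneg (hk0 y) (hα0 y)
  have hψα : ∀ y, ψ y ≤ α y := fun y => mul_le_of_le_one_left (hα0 y) (hk1 y)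
  have hψM : ∀ y, ψ y ≤ a / (1 - c) := fun y => (hψα y).trans (hαM y)
  have hint : ∀ (f : ℝ → ℝ), Measurable f → (∀ y, 0 ≤ f y) → (∀ y, f y ≤ a / (1 - c)) →
      ∀ u v : ℝ, IntervalIntegrable f volume u v := fun f hf h0 hM u v =>
    (intervalIntegrable_const (c := a / (1 - c))).mono_fun' hf.aestronglyMeasurable
      (ae_of_all _ fun y => by simpa [abs_of_nonneg (h0 y)] using hM y)
  have hintα := hint α hα hα0 hαM
  have hintψ := hint ψ hψ hψ0 hψM
  -- the Laplace functional before `c`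
  have hV : ∀ y, y ≤ c → recordLaplace a h y =
      ENNReal.ofReal (Real.exp (-((∫ t in y..c, α t) - ∫ t in y..c, ψ t))) := by
    intro y hy
    rw [← intervalIntegral.integral_sub (hintα _ _) (hintψ _ _), ← expNeg_ofReal
      (intervalIntegral.integral_nonneg hy fun t _ => sub_nonneg.2 (hψα t)), recordLaplace,
      lintegral_recordMeasure _ _ (G := fun y => 1 - h y) (measurable_const.sub hh), intervalIntegral.integral_of_le hy,
      ofReal_integral_eq_lintegral_ofReal
        ((intervalIntegrable_iff_integrableOn_Ioc_of_le hy).1 ((hintα _ _).sub (hintψ _ _)))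
        (ae_of_all _ fun t => sub_nonneg.2 (hψα t)), ← lintegral_indicator measurableSet_Ioo,
      ← lintegral_indicator measurableSet_Ioc]
    congr 1
    refine lintegral_congr fun t => ?_
    by_cases ht : t ∈ Set.Ioc y c
    · have ht1 : t ∈ Set.Ioo y 1 := ⟨ht.1, ht.2.trans_lt hc⟩
      rw [Set.indicator_of_mem ht, Set.indicator_of_mem ht1, hhk, ← ENNReal.ofReal_one,
        ← ENNReal.ofReal_sub _ (hk0 t), ← hαeq t ht.2, ← ENNReal.ofReal_mul (hα0 t)]
      congr 1
      simp only [ψ]; ring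
    · rw [Set.indicator_of_notMem ht]
      by_cases ht1 : t ∈ Set.Ioo y 1
      · rw [Set.indicator_of_mem ht1, hc1 t (not_le.1 fun htc => ht ⟨ht1.1, htc⟩)]
        simp
      · rw [Set.indicator_of_notMem ht1]
  have hcpos : 0 < 1 - c := by linarith
  have hxpos : 0 < 1 - x := by linarith
  -- the survival function of the step
  have hsurv : ∀ y, x ≤ y → y ≤ c →
      (1 - y) ^ a / (1 - x) ^ a = Real.exp (-∫ t in x..y, α t) := by
    intro y hxy hyc
    have hy : 0 < 1 - y := by linarith
    have : ∫ t in x..y, α t = a * Real.log (1 - x) - a * Real.log (1 - y) := by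
      rw [intervalIntegral.integral_congr (g := fun t => a / (1 - t))
        (fun t ht => hαeq t (by rw [Set.uIcc_of_le hxy] at ht; exact ht.2.trans hyc))]
      rw [intervalIntegral.integral_eq_sub_of_hasDerivAt
        (f := fun t => -(a * Real.log (1 - t)))]
      · ring
      · intro t ht
        rw [Set.uIcc_of_le hxy] at ht
        have ht1 : 1 - t ≠ 0 := by have := ht.2; intro h; linarith
        have := ((((hasDerivAt_id t).const_sub 1).log ht1).const_mul a).neg
        convert this using 1
        · rfl
        · simp only [id]
          ring
      · refine ContinuousOn.intervalIntegrable (ContinuousOn.div continuousOn_const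
          (by fun_prop) fun t ht => ?_)
        rw [Set.uIcc_of_le hxy] at ht
        have := ht.2; intro h; linarith
    rw [this, Real.rpow_def_of_pos hy, Real.rpow_def_of_pos hxpos, ← Real.exp_sub]
    congr 1; ring
  have hsplit : Set.Ioo x 1 = Set.Ioc x c ∪ Set.Ioo c 1 := by
    rw [Set.Ioc_union_Ioo_eq_Ioo hxc.le hc]
  have hdisj : Disjoint (Set.Ioc x c) (Set.Ioo c 1) :=
    Set.disjoint_left.2 fun y h1 h2 => h1.2.not_gt h2.1
  rw [hsplit, lintegral_union measurableSet_Ioo hdisj]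
  have hpart2 : ∫⁻ y in Set.Ioo c 1, ENNReal.ofReal (stepDensity a x y) *
      (h y * recordLaplace a h y) = ENNReal.ofReal (Real.exp (-∫ t in x..c, α t)) := by
    rw [← hsurv c hxc.le le_rfl]
    calc _ = ∫⁻ y in Set.Ioo c 1, ENNReal.ofReal ((1 - c) ^ a / (1 - x) ^ a) *
          ENNReal.ofReal (stepDensity a c y) := by
          refine setLIntegral_congr_fun measurableSet_Ioo fun y hy => ?_
          simp only [hc1 y hy.1, recordLaplace_eq_one hh hc1 hy.1.le, mul_one]
          rw [← ENNReal.ofReal_mul (by positivity), stepDensity, stepDensity]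
          congr 1
          have := (Real.rpow_pos_of_pos hcpos a).ne'
          field_simp
      _ = _ := by
          rw [lintegral_const_mul _ (by fun_prop), lintegral_stepDensity ha hc, mul_one]
  -- With `V` the functional, the integrand is `ψ y * exp (-∫_x^y α) * exp (-∫_y^c (α - ψ)) = V x *
  -- ψ y * exp (-∫_x^y ψ)`, so this part is `V x * (1 - exp (-∫_x^c ψ))`. The part beyond `c` is
  -- `exp (-∫_x^c α) = V x * exp (-∫_x^c ψ)`, and the two add up to `V x`.
  have hpart1 : ∫⁻ y in Set.Ioc x c, ENNReal.ofReal (stepDensity a x y) *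
      (h y * recordLaplace a h y) =
      ENNReal.ofReal (Real.exp (-((∫ t in x..c, α t) - ∫ t in x..c, ψ t)) *
        (1 - Real.exp (-∫ t in x..c, ψ t))) := by
    rw [← integral_mul_exp_neg_integral hψ hψ0 hψM hxc.le, ← intervalIntegral.integral_const_mul,
      intervalIntegral.integral_of_le hxc.le, ofReal_integral_eq_lintegral_ofReal]
    · refine setLIntegral_congr_fun measurableSet_Ioc fun y hy => ?_
      have hy1 : 0 < 1 - y := by have := hy.2; linarith
      rw [hV y hy.2, hhk, ← ENNReal.ofReal_mul (hk0 y), ← ENNReal.ofReal_mul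
        (by unfold stepDensity; positivity)]
      congr 1
      have hd : stepDensity a x y = α y * Real.exp (-∫ t in x..y, α t) := by
        rw [← hsurv y hy.1.le hy.2, stepDensity, hαeq y hy.2, Real.rpow_sub_one hy1.ne']
        field_simp
      rw [hd]
      have e1 := intervalIntegral.integral_add_adjacent_intervals (hintα x y) (hintα y c)
      have e2 := intervalIntegral.integral_add_adjacent_intervals (hintψ x y) (hintψ y c)
      calc α y * Real.exp (-∫ t in x..y, α t) *
            (k y * Real.exp (-((∫ t in y..c, α t) - ∫ t in y..c, ψ t)))
          = ψ y * (Real.exp (-∫ t in x..y, α t) *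
            Real.exp (-((∫ t in y..c, α t) - ∫ t in y..c, ψ t))) := by simp only [ψ]; ring
        _ = ψ y * (Real.exp (-((∫ t in x..c, α t) - ∫ t in x..c, ψ t)) *
            Real.exp (-∫ t in x..y, ψ t)) := by
            rw [← Real.exp_add, ← Real.exp_add]
            congr 2
            linarith
        _ = _ := by ring
    · refine Integrable.const_mul ?_ _
      have hmeas : AEStronglyMeasurable (fun y => Real.exp (-∫ t in x..y, ψ t))
          (volume.restrict (Set.Ioc x c)) := by
        have : Continuous fun y => ∫ t in x..y, ψ t :=
          intervalIntegral.continuous_primitive hintψ x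
        exact (Real.continuous_exp.comp this.neg).aestronglyMeasurable
      refine Integrable.mono' (g := fun _ => a / (1 - c)) (by simp)
        (hψ.aestronglyMeasurable.mul hmeas) ?_
      filter_upwards [ae_restrict_mem measurableSet_Ioc] with y hy
      rw [Real.norm_of_nonneg (mul_nonneg (hψ0 y) (Real.exp_pos _).le)]
      refine (mul_le_of_le_one_right (hψ0 y) ?_).trans (hψM y)
      rw [Real.exp_le_one_iff, neg_nonpos]
      exact intervalIntegral.integral_nonneg hy.1.le fun t _ => hψ0 t
    · exact ae_of_all _ fun y => mul_nonneg (Real.exp_pos _).le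
        (mul_nonneg (hψ0 y) (Real.exp_pos _).le)
  rw [hpart1, hpart2, hV x hxc.le, ← ENNReal.ofReal_add]
  · congr 1
    have : Real.exp (-∫ t in x..c, α t) =
        Real.exp (-((∫ t in x..c, α t) - ∫ t in x..c, ψ t)) * Real.exp (-∫ t in x..c, ψ t) := by
      rw [← Real.exp_add]; congr 1; ring
    rw [this]; ring
  · refine mul_nonneg (Real.exp_pos _).le (sub_nonneg.2 ?_)
    rw [Real.exp_le_one_iff, neg_nonpos]
    exact intervalIntegral.integral_nonneg hxc.le fun t _ => hψ0 t
  · exact (Real.exp_pos _).le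

/-! ### The chain of points -/

/-- The chain `X 0 = x`, `X (n + 1) = 1 - (1 - X n) * v n`. -/
def recordChain (x : ℝ) (v : ℕ → ℝ) : ℕ → ℝ
  | 0 => x
  | n + 1 => 1 - (1 - recordChain x v n) * v n

/-- The law of the relative gaps of the chain. -/
def gapLaw (a : ℝ) : Measure (ℕ → ℝ) := Measure.infinitePi fun _ : ℕ => betaMeasure a 1

lemma isProbabilityMeasure_gapLaw {a : ℝ} (ha : 0 < a) : IsProbabilityMeasure (gapLaw a) := by
  have := isProbabilityMeasureBeta ha one_pos
  unfold gapLaw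
  infer_instance

lemma recordChain_congr (x : ℝ) {n : ℕ} {v w : ℕ → ℝ} (h : ∀ i < n, v i = w i) :
    recordChain x v n = recordChain x w n := by
  induction n with
  | zero => rfl
  | succ n ih => rw [recordChain, recordChain, ih fun i hi => h i (by omega), h n (by omega)]

lemma measurable_uncurry_recordChain (n : ℕ) :
    Measurable fun p : ℝ × (ℕ → ℝ) => recordChain p.1 p.2 n := by
  induction n with
  | zero => exact measurable_fst
  | succ n ih =>
    exact measurable_const.sub ((measurable_const.sub ih).mul
      ((measurable_pi_apply n).comp measurable_snd))

@[fun_prop] lemma measurable_recordChain (x : ℝ) (n : ℕ) :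
    Measurable fun v => recordChain x v n :=
  (measurable_uncurry_recordChain n).comp measurable_prodMk_left

lemma ae_gapLaw_mem_Ioo {a : ℝ} (ha : 0 < a) : ∀ᵐ v ∂(gapLaw a), ∀ i, v i ∈ Set.Ioo (0 : ℝ) 1 := by
  have := isProbabilityMeasureBeta ha one_pos
  rw [ae_all_iff]
  intro i
  have h := ae_betaMeasure_mem_Ioo a 1
  rw [← Measure.infinitePi_map_eval (fun _ : ℕ => betaMeasure a 1) i] at h
  exact ae_of_ae_map (measurable_pi_apply i).aemeasurable h

lemma recordChain_lt_one {x : ℝ} (hx : x < 1) {v : ℕ → ℝ} (hv : ∀ i, v i ∈ Set.Ioo (0 : ℝ) 1)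
    (n : ℕ) : recordChain x v n < 1 := by
  induction n with
  | zero => exact hx
  | succ n ih =>
    have := mul_pos (sub_pos.2 ih) (hv n).1
    rw [recordChain]; linarith

lemma recordChain_lt_succ {x : ℝ} (hx : x < 1) {v : ℕ → ℝ} (hv : ∀ i, v i ∈ Set.Ioo (0 : ℝ) 1)
    (n : ℕ) : recordChain x v n < recordChain x v (n + 1) := by
  have h1 := recordChain_lt_one hx hv n
  have h2 := (hv n).2
  rw [recordChain]; nlinarith

/-- The Markov property of the chain. -/
lemma lintegral_mul_recordChain_succ {a x : ℝ} (ha : 0 < a) {n : ℕ} {Φ : (ℕ → ℝ) → ℝ≥0∞}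
    (hΦ : Measurable Φ) (hdep : ∀ v w : ℕ → ℝ, (∀ i < n, v i = w i) → Φ v = Φ w) {ρ : ℝ → ℝ≥0∞}
    (hρ : Measurable ρ) :
    ∫⁻ v, Φ v * ρ (recordChain x v (n + 1)) ∂(gapLaw a) =
      ∫⁻ v, Φ v * ∫⁻ e, ρ (1 - (1 - recordChain x v n) * e) ∂(betaMeasure a 1) ∂(gapLaw a) := by
  have := isProbabilityMeasureBeta ha one_pos
  have h := lintegral_infinitePi_fresh (betaMeasure a 1)
    (F := fun v => (Φ v, recordChain x v n)) (by fun_prop) n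
    (fun v w hvw => by simp only [hdep v w hvw, recordChain_congr x hvw])
    (ρ := fun p e => p.1 * ρ (1 - (1 - p.2) * e)) (by unfold Function.uncurry; fun_prop)
  refine h.trans (lintegral_congr fun v => ?_)
  rw [lintegral_const_mul _ (by fun_prop)]

lemma lintegral_mul_recordChain_succ' {a x : ℝ} (ha : 0 < a) (hx : x < 1) {n : ℕ}
    {Φ : (ℕ → ℝ) → ℝ≥0∞} (hΦ : Measurable Φ)
    (hdep : ∀ v w : ℕ → ℝ, (∀ i < n, v i = w i) → Φ v = Φ w) {ρ : ℝ → ℝ≥0∞} (hρ : Measurable ρ) :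
    ∫⁻ v, Φ v * ρ (recordChain x v (n + 1)) ∂(gapLaw a) =
      ∫⁻ v, Φ v * (∫⁻ y in Set.Ioo (recordChain x v n) 1,
        ENNReal.ofReal (stepDensity a (recordChain x v n) y) * ρ y) ∂(gapLaw a) := by
  rw [lintegral_mul_recordChain_succ ha hΦ hdep hρ]
  refine lintegral_congr_ae ?_
  filter_upwards [ae_gapLaw_mem_Ioo ha] with v hv
  rw [lintegral_step ha (recordChain_lt_one hx hv n) hρ]

/-- By the Markov property and the one-step equation the integrand is a martingale in `n`, so its
mean keeps its initial value. -/
lemma lintegral_prod_mul_recordLaplace {a c x : ℝ} (ha : 0 < a) (hc : c < 1) (hx : x < 1)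
    {h : ℝ → ℝ≥0∞} (hh : Measurable h) (h1 : ∀ y, h y ≤ 1) (hc1 : ∀ y, c < y → h y = 1) (n : ℕ) :
    ∫⁻ v, (∏ i ∈ Finset.range n, h (recordChain x v (i + 1))) *
      recordLaplace a h (recordChain x v n) ∂(gapLaw a) = recordLaplace a h x := by
  have := isProbabilityMeasure_gapLaw ha
  induction n with
  | zero => simp [recordChain]
  | succ n ih =>
    have hm := measurable_recordLaplace a hh
    simp_rw [Finset.prod_range_succ, mul_assoc]
    rw [lintegral_mul_recordChain_succ' ha hx (n := n) (by fun_prop)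
      (fun v w hvw => Finset.prod_congr rfl fun i hi => by
        rw [recordChain_congr x fun j hj => hvw j (by simp at hi; omega)])
      (ρ := fun y => h y * recordLaplace a h y) (by fun_prop), ← ih]
    refine lintegral_congr_ae ?_
    filter_upwards [ae_gapLaw_mem_Ioo ha] with v hv
    rw [lintegral_stepDensity_mul_recordLaplace ha hc (recordChain_lt_one hx hv n) hh h1 hc1]

/-- Each gap factor has mean `a / (1 + a) < 1`. By Markov's inequality this bounds the probability
that the chain has not yet passed a level `c < 1`. -/
lemma lintegral_one_sub_recordChain {a x : ℝ} (ha : 0 < a) (hx : x < 1) (n : ℕ) :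
    ∫⁻ v, ENNReal.ofReal (1 - recordChain x v n) ∂(gapLaw a) =
      ENNReal.ofReal (1 - x) * ENNReal.ofReal (a / (1 + a)) ^ n := by
  have := isProbabilityMeasure_gapLaw ha
  induction n with
  | zero => simp [recordChain]
  | succ n ih =>
    have h := lintegral_mul_recordChain_succ (x := x) ha (n := n) (Φ := fun _ => 1)
      measurable_const (fun _ _ _ => rfl) (ρ := fun y => ENNReal.ofReal (1 - y)) (by fun_prop)
    simp only [one_mul] at h
    rw [h, pow_succ, ← mul_assoc, ← ih, ← lintegral_mul_const _ (by fun_prop)]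
    refine lintegral_congr_ae ?_
    filter_upwards [ae_gapLaw_mem_Ioo ha] with v hv
    have h0 := sub_pos.2 (recordChain_lt_one hx hv n)
    have hsize := lintegral_ofReal_mul_betaMeasure ha one_pos (φ := fun _ => 1) measurable_const
    have := isProbabilityMeasureBeta (add_pos ha one_pos) one_pos
    simp only [mul_one, lintegral_const, measure_univ] at hsize
    simp_rw [sub_sub_cancel, ENNReal.ofReal_mul h0.le]
    rw [lintegral_const_mul _ (by fun_prop), hsize]

/-- The mean of the finite product is squeezed. It is at least the martingale value, because
`recordLaplace` is at most `1`. It exceeds that value by at most the probability that the chain is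
still at or below `c`, because `recordLaplace` equals `1` past `c`; this probability decays
geometrically. -/
lemma lintegral_expNeg_tsum_recordChain_of_compact {a c x : ℝ} (ha : 0 < a) (hc : c < 1)
    (hx : x < 1) {f : ℝ → ℝ≥0∞} (hf : Measurable f) (hfc : ∀ y, c < y → f y = 0) :
    ∫⁻ v, expNeg (∑' i, f (recordChain x v (i + 1))) ∂(gapLaw a) =
      recordLaplace a (fun y => expNeg (f y)) x := by
  have := isProbabilityMeasure_gapLaw ha
  let h : ℝ → ℝ≥0∞ := fun y => expNeg (f y)
  have hh : Measurable h := by fun_prop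
  have h1 : ∀ y, h y ≤ 1 := fun y => expNeg_le_one _
  have hc1 : ∀ y, c < y → h y = 1 := fun y hy => by simp [h, hfc y hy]
  have hlim : Tendsto (fun n => ∫⁻ v, ∏ i ∈ Finset.range n, h (recordChain x v (i + 1)) ∂(gapLaw a))
      atTop (𝓝 (∫⁻ v, expNeg (∑' i, f (recordChain x v (i + 1))) ∂(gapLaw a))) :=
    tendsto_lintegral_of_dominated_convergence (fun _ => 1) (fun n => by fun_prop)
      (fun n => ae_of_all _ fun v => Finset.prod_le_one' fun i _ => h1 _) (by simp)
      (ae_of_all _ fun v => tendsto_prod_expNeg _)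
  refine tendsto_nhds_unique hlim ?_
  have hkey := lintegral_prod_mul_recordLaplace ha hc hx hh h1 hc1
  have hV1 : ∀ y, recordLaplace a h y ≤ 1 := fun y => expNeg_le_one _
  have hub : Tendsto (fun n : ℕ => recordLaplace a h x + ENNReal.ofReal (1 - x) *
      ENNReal.ofReal (a / (1 + a)) ^ n / ENNReal.ofReal (1 - c)) atTop
      (𝓝 (recordLaplace a h x + ENNReal.ofReal (1 - x) * 0 / ENNReal.ofReal (1 - c))) := by
    have hpow : Tendsto (fun n : ℕ => ENNReal.ofReal (a / (1 + a)) ^ n) atTop (𝓝 0) := by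
      refine ENNReal.tendsto_pow_atTop_nhds_zero_of_lt_one ?_
      rw [ENNReal.ofReal_lt_one, div_lt_one (by positivity)]
      linarith
    refine tendsto_const_nhds.add (ENNReal.Tendsto.div_const
      (ENNReal.Tendsto.const_mul hpow (Or.inr ENNReal.ofReal_ne_top)) (Or.inr ?_))
    simpa using hc
  simp only [mul_zero, ENNReal.zero_div, add_zero] at hub
  refine tendsto_of_tendsto_of_tendsto_of_le_of_le tendsto_const_nhds hub (fun n => ?_) fun n => ?_
  · simp only []
    rw [← hkey n]
    exact lintegral_mono fun v => mul_le_of_le_one_right' (hV1 _)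
  · simp only []
    have hmark : gapLaw a {v | ENNReal.ofReal (1 - c) ≤ ENNReal.ofReal (1 - recordChain x v n)} ≤
        ENNReal.ofReal (1 - x) * ENNReal.ofReal (a / (1 + a)) ^ n / ENNReal.ofReal (1 - c) := by
      rw [← lintegral_one_sub_recordChain ha hx n]
      exact meas_ge_le_lintegral_div (by fun_prop) (by simpa using hc) ENNReal.ofReal_ne_top
    refine le_trans ?_ (add_le_add (hkey n).le hmark)
    have hms : MeasurableSet
        {v | ENNReal.ofReal (1 - c) ≤ ENNReal.ofReal (1 - recordChain x v n)} :=
      measurableSet_le measurable_const (by fun_prop)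
    rw [← lintegral_indicator_one hms, ← lintegral_add_right _
      (measurable_one.indicator hms)]
    refine lintegral_mono fun v => ?_
    by_cases hv : ENNReal.ofReal (1 - c) ≤ ENNReal.ofReal (1 - recordChain x v n)
    · refine le_trans (Finset.prod_le_one' fun i _ => h1 _) (le_trans ?_ le_add_self)
      rw [Set.indicator_of_mem (by exact hv)]
      rfl
    · refine le_trans ?_ le_self_add
      rw [recordLaplace_eq_one hh hc1, mul_one]
      by_contra hlt
      exact hv (ENNReal.ofReal_le_ofReal (by linarith))

lemma lintegral_pointProcess (x : ℕ → ℝ) {f : ℝ → ℝ≥0∞} (hf : Measurable f) :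
    ∫⁻ y, f y ∂(pointProcess x) = ∑' i, f (x (i + 1)) := by
  rw [pointProcess, lintegral_sum_measure]
  simp_rw [lintegral_dirac' _ hf]

lemma measurable_pointProcess_apply {A : Set ℝ} (hA : MeasurableSet A) :
    Measurable fun x : ℕ → ℝ => pointProcess x A := by
  simp_rw [pointProcess, Measure.sum_apply _ hA, Measure.dirac_apply' _ hA]
  exact Measurable.tsum fun i => (measurable_one.indicator hA).comp (measurable_pi_apply _)

/-- The law of the chain started at `x`. -/
def recordChainLaw (a x : ℝ) : Measure (ℕ → ℝ) := (gapLaw a).map (recordChain x)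

lemma measurable_recordChain_pi (x : ℝ) : Measurable (recordChain x) :=
  measurable_pi_iff.2 fun n => measurable_recordChain x n

lemma isProbabilityMeasure_recordChainLaw {a : ℝ} (ha : 0 < a) (x : ℝ) :
    IsProbabilityMeasure (recordChainLaw a x) := by
  have := isProbabilityMeasure_gapLaw ha
  exact Measure.isProbabilityMeasure_map (measurable_recordChain_pi x).aemeasurable

/-- Almost every chain is strictly increasing and stays below `1`. -/
lemma ae_recordChainLaw {a x : ℝ} (ha : 0 < a) (hx : x < 1) :
    ∀ᵐ z ∂(recordChainLaw a x), z 0 = x ∧ ∀ n, z n < z (n + 1) ∧ z n < 1 := by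
  refine (ae_map_iff (measurable_recordChain_pi x).aemeasurable ?_).2 ?_
  · refine (measurableSet_eq_fun (measurable_pi_apply 0) measurable_const).inter ?_
    refine MeasurableSet.congr (s := ⋂ n, {z : ℕ → ℝ | z n < z (n + 1) ∧ z n < 1}) ?_
      (by ext z; exact Set.mem_iInter)
    exact MeasurableSet.iInter fun n =>
      (measurableSet_lt (measurable_pi_apply n) (measurable_pi_apply (n + 1))).inter
        (measurableSet_lt (measurable_pi_apply n) measurable_const)
  · filter_upwards [ae_gapLaw_mem_Ioo ha] with v hv
    exact ⟨rfl, fun n => ⟨recordChain_lt_succ hx hv n, recordChain_lt_one hx hv n⟩⟩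

/-- Laplace functionals characterise Poisson processes. Both the chain and the intensity live below
`1`, so a test function may be cut off at `1`, and it is then the increasing limit of its
restrictions to `(-∞, c n]` with `c n ↑ 1`, for which the functional is known. -/
lemma isPoissonProcess_recordChainLaw {a x : ℝ} (ha : 0 < a) (hx : x < 1) :
    IsPoissonProcess (recordChainLaw a x) pointProcess (recordMeasure a x) := by
  have := isProbabilityMeasure_recordChainLaw ha x
  have hN : ∀ A, MeasurableSet A → Measurable fun z : ℕ → ℝ => pointProcess z A :=
    fun A hA => measurable_pointProcess_apply hA
  refine IsPoissonProcess.of_laplace hN fun f hf => ?_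
  let g : ℝ → ℝ≥0∞ := (Set.Iio 1).indicator f
  have hg : Measurable g := hf.indicator measurableSet_Iio
  have hL : ∫⁻ z, expNeg (∫⁻ y, f y ∂(pointProcess z)) ∂(recordChainLaw a x) =
      ∫⁻ z, expNeg (∫⁻ y, g y ∂(pointProcess z)) ∂(recordChainLaw a x) := by
    refine lintegral_congr_ae ?_
    filter_upwards [ae_recordChainLaw ha hx] with z hz
    rw [lintegral_pointProcess z hf, lintegral_pointProcess z hg]
    congr 2
    ext i
    exact (Set.indicator_of_mem (s := Set.Iio 1) (hz.2 (i + 1)).2 f).symm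
  have hR : ∫⁻ y, (1 - expNeg (f y)) ∂(recordMeasure a x) =
      ∫⁻ y, (1 - expNeg (g y)) ∂(recordMeasure a x) := by
    rw [lintegral_recordMeasure a x (G := fun y => 1 - expNeg (f y)) (by fun_prop),
      lintegral_recordMeasure a x (G := fun y => 1 - expNeg (g y)) (by fun_prop)]
    refine setLIntegral_congr_fun measurableSet_Ioo fun y hy => ?_
    simp only [g, Set.indicator_of_mem (show y ∈ Set.Iio 1 from hy.2)]
  rw [hL, hR]
  let c : ℕ → ℝ := fun n => 1 - 1 / ((n : ℝ) + 1)
  have hcmono : Monotone c := fun m n hmn => by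
    simp only [c]
    gcongr
  refine laplace_of_tendsto hN (F := fun n => (Set.Iic (c n)).indicator g)
    (fun n => hg.indicator measurableSet_Iic) (fun y m n hmn => ?_) (fun y => ?_) fun n => ?_
  · exact Set.indicator_le_indicator_of_subset (Set.Iic_subset_Iic.2 (hcmono hmn))
      (fun _ => zero_le) y
  · by_cases hy : y < 1
    · refine tendsto_const_nhds.congr' ?_
      have hlim : Tendsto c atTop (𝓝 (1 - 0)) :=
        tendsto_const_nhds.sub tendsto_one_div_add_atTop_nhds_zero_nat
      filter_upwards [hlim.eventually (lt_mem_nhds (by simpa using hy))] with n hn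
      rw [Set.indicator_of_mem (show y ∈ Set.Iic (c n) from hn.le)]
    · have : g y = 0 := Set.indicator_of_notMem (by simpa using hy) _
      simp [Set.indicator, this]
  · have hgn : Measurable ((Set.Iic (c n)).indicator g) := hg.indicator measurableSet_Iic
    have hcn : c n < 1 := by
      simp only [c]
      have : 0 < 1 / ((n : ℝ) + 1) := by positivity
      linarith
    have key := lintegral_expNeg_tsum_recordChain_of_compact ha hcn hx hgn
      (fun y hy => Set.indicator_of_notMem (by simpa using hy) _)
    rw [recordLaplace] at key
    simp_rw [← key, lintegral_pointProcess _ hgn]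
    rw [recordChainLaw, lintegral_map (by fun_prop) (measurable_recordChain_pi x)]

/-! ### The law of the ordered points of a Poisson process -/

/-- For an increasing list, the points below `q` are an initial stretch of the list. The term `z 0`
is not a point of the process, whence the shift. -/
lemma le_pointProcess_Iic_iff {z : ℕ → ℝ} (hz : ∀ i, z (i + 1) < z (i + 2)) (i : ℕ) (q : ℝ) :
    ((i + 1 : ℕ) : ℝ≥0∞) ≤ pointProcess z (Set.Iic q) ↔ z (i + 1) ≤ q := by
  have hmono : StrictMono fun j => z (j + 1) := strictMono_nat_of_lt_succ hz
  have hN : pointProcess z (Set.Iic q) = ∑' j, (Set.Iic q).indicator 1 (z (j + 1)) := by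
    simp_rw [pointProcess, Measure.sum_apply _ measurableSet_Iic,
      Measure.dirac_apply' _ measurableSet_Iic]
  rw [hN]
  constructor
  · intro h
    by_contra hlt
    rw [not_le] at hlt
    have h0 : ∀ j ∉ Finset.range i, (Set.Iic q).indicator (1 : ℝ → ℝ≥0∞) (z (j + 1)) = 0 := by
      intro j hj
      refine Set.indicator_of_notMem (fun hjq => ?_) _
      have : z (i + 1) ≤ z (j + 1) := hmono.monotone (by simpa using hj)
      exact absurd (this.trans hjq) (not_le.2 hlt)
    rw [tsum_eq_sum h0] at h
    have : ∑ j ∈ Finset.range i, (Set.Iic q).indicator (1 : ℝ → ℝ≥0∞) (z (j + 1)) ≤ (i : ℝ≥0∞) := by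
      refine (Finset.sum_le_card_nsmul _ _ 1 fun j _ => ?_).trans (by simp)
      exact Set.indicator_le_self' (fun _ _ => zero_le) _
    have h2 := h.trans this
    norm_cast at h2
    omega
  · intro h
    refine le_trans ?_ (ENNReal.sum_le_tsum (Finset.range (i + 1)))
    rw [Finset.sum_congr rfl (g := fun _ => 1)]
    · simp
    · intro j hj
      refine Set.indicator_of_mem ?_ _
      exact (hmono.monotone (by simp at hj; omega)).trans h

/-- Recovers the points from the counts on half-lines. -/
def pointsOfCounts (x : ℝ) (θ : ℚ → ℝ≥0∞) : ℕ → ℝ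
  | 0 => x
  | i + 1 => (⨅ q : ℚ, if ((i + 1 : ℕ) : ℝ≥0∞) ≤ θ q then ((q : ℝ) : EReal) else ⊤).toReal

lemma measurable_pointsOfCounts (x : ℝ) : Measurable (pointsOfCounts x) := by
  refine measurable_pi_iff.2 fun i => ?_
  cases i with
  | zero => exact measurable_const
  | succ i =>
    refine measurable_ereal_toReal.comp (Measurable.iInf fun q => ?_)
    exact Measurable.ite (measurableSet_le measurable_const (measurable_pi_apply q))
      measurable_const measurable_const

lemma pointsOfCounts_eq {z : ℕ → ℝ} (hz : ∀ i, z (i + 1) < z (i + 2)) :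
    pointsOfCounts (z 0) (fun q => pointProcess z (Set.Iic (q : ℝ))) = z := by
  ext i
  cases i with
  | zero => rfl
  | succ i =>
    have : (⨅ q : ℚ, if ((i + 1 : ℕ) : ℝ≥0∞) ≤ pointProcess z (Set.Iic (q : ℝ))
        then ((q : ℝ) : EReal) else ⊤) = (z (i + 1) : EReal) := by
      refine le_antisymm ?_ (le_iInf fun q => ?_)
      · refine EReal.le_of_forall_lt_iff_le.1 fun c hc => ?_
        obtain ⟨q, hq1, hq2⟩ := exists_rat_btwn (EReal.coe_lt_coe_iff.1 hc)
        refine (iInf_le _ q).trans ?_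
        rw [if_pos ((le_pointProcess_Iic_iff hz i q).2 hq1.le)]
        exact EReal.coe_le_coe_iff.2 hq2.le
      · split_ifs with h
        · exact EReal.coe_le_coe_iff.2 ((le_pointProcess_Iic_iff hz i q).1 h)
        · exact le_top
    rw [pointsOfCounts, this, EReal.toReal_coe]

/-- The Laplace functional fixes the joint law of the counts on rational half-lines, and an
increasing list is recovered measurably from them. Without the order, only the law of the unlabelled
set of points would be determined. -/
lemma IsPoissonProcess.map_eq_of_ordered {μ ν : Measure (ℕ → ℝ)} [IsProbabilityMeasure μ]
    [IsProbabilityMeasure ν] {Λ : Measure ℝ} (hμ : IsPoissonProcess μ pointProcess Λ)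
    (hν : IsPoissonProcess ν pointProcess Λ) {x : ℝ}
    (hμx : ∀ᵐ z ∂μ, z 0 = x ∧ ∀ i, z (i + 1) < z (i + 2))
    (hνx : ∀ᵐ z ∂ν, z 0 = x ∧ ∀ i, z (i + 1) < z (i + 2)) : μ = ν := by
  let Θ : (ℕ → ℝ) → ℚ → ℝ≥0∞ := fun z q => pointProcess z (Set.Iic (q : ℝ))
  have hΘ : Measurable Θ :=
    measurable_pi_iff.2 fun q => measurable_pointProcess_apply measurableSet_Iic
  have key : ∀ (m : Measure (ℕ → ℝ)) [IsProbabilityMeasure m], IsPoissonProcess m pointProcess Λ →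
      ∀ n : ℚ →₀ ℕ, ∫⁻ θ, expNeg (n.sum fun q k => k * θ q) ∂(m.map Θ) =
        expNeg (∫⁻ y, (1 - expNeg (n.sum fun q k =>
          (k : ℝ≥0∞) * (Set.Iic (q : ℝ)).indicator 1 y)) ∂Λ) := by
    intro m _ hm n
    have hmeas : ∀ q : ℚ, Measurable ((Set.Iic (q : ℝ)).indicator (1 : ℝ → ℝ≥0∞)) := fun q =>
      measurable_one.indicator measurableSet_Iic
    have hf : Measurable fun y => n.sum fun q k =>
        (k : ℝ≥0∞) * (Set.Iic (q : ℝ)).indicator 1 y := by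
      unfold Finsupp.sum
      exact Finset.measurable_fun_sum _ fun q _ => (hmeas q).const_mul _
    rw [lintegral_map (by unfold Finsupp.sum; fun_prop) hΘ, ← hm.laplace hf]
    refine lintegral_congr fun z => ?_
    unfold Finsupp.sum
    rw [lintegral_finsetSum _ fun q _ => (hmeas q).const_mul _]
    congr 1
    refine Finset.sum_congr rfl fun q _ => ?_
    rw [lintegral_const_mul _ (hmeas q), lintegral_indicator_one measurableSet_Iic]
  have hmap : μ.map Θ = ν.map Θ := by
    have := Measure.isProbabilityMeasure_map (μ := μ) hΘ.aemeasurable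
    have := Measure.isProbabilityMeasure_map (μ := ν) hΘ.aemeasurable
    exact Measure.pi_ennreal_ext _ _ fun n => by rw [key μ hμ n, key ν hν n]
  have hrec : ∀ m : Measure (ℕ → ℝ), (∀ᵐ z ∂m, z 0 = x ∧ ∀ i, z (i + 1) < z (i + 2)) →
      (m.map Θ).map (pointsOfCounts x) = m := by
    intro m hm
    rw [Measure.map_map (measurable_pointsOfCounts x) hΘ]
    conv_rhs => rw [← Measure.map_id (μ := m)]
    refine Measure.map_congr ?_
    filter_upwards [hm] with z hz
    rw [Function.comp, ← hz.1]
    exact pointsOfCounts_eq hz.2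
  rw [← hrec μ hμx, hmap, hrec ν hνx]

/-! ### Integrating out the marks -/

/-- The defining property of conditional expectation says that `P` restricted to `s` and `P`
weighted by `u` have the same image under `Z`; hence all nonnegative functions of `Z` have the same
integrals. -/
lemma setLIntegral_eq_of_condExp {Ω β : Type*} [MeasurableSpace Ω] [MeasurableSpace β]
    {P : Measure Ω} [IsProbabilityMeasure P] {Z : Ω → β} (hZ : Measurable Z) {s : Set Ω}
    (hs : MeasurableSet s) {u : Ω → ℝ} (hu : P⟦s | MeasurableSpace.comap Z inferInstance⟧ =ᵐ[P] u)
    {φ : β → ℝ≥0∞} (hφ : Measurable φ) :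
    ∫⁻ ω in s, φ (Z ω) ∂P = ∫⁻ ω, ENNReal.ofReal (u ω) * φ (Z ω) ∂P := by
  set w := P⟦s | MeasurableSpace.comap Z inferInstance⟧ with hw
  have hwm : Measurable w := (stronglyMeasurable_condExp.mono hZ.comap_le).measurable
  have hint : Integrable (s.indicator fun _ => (1 : ℝ)) P := (integrable_const 1).indicator hs
  have hw0 : 0 ≤ᵐ[P] w := condExp_nonneg (ae_of_all _ fun ω => Set.indicator_nonneg (by simp) ω)
  have hmeas : (P.restrict s).map Z = (P.withDensity fun ω => ENNReal.ofReal (w ω)).map Z := by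
    ext B hB
    rw [Measure.map_apply hZ hB, Measure.map_apply hZ hB, Measure.restrict_apply (hZ hB),
      withDensity_apply _ (hZ hB), ← ofReal_integral_eq_lintegral_ofReal
        integrable_condExp.integrableOn (ae_restrict_of_ae hw0),
      setIntegral_condExp hZ.comap_le hint ⟨B, hB, rfl⟩, integral_indicator hs]
    simp [Measure.restrict_apply hs, Set.inter_comm]
  calc ∫⁻ ω in s, φ (Z ω) ∂P = ∫⁻ y, φ y ∂((P.restrict s).map Z) := (lintegral_map hφ hZ).symm
    _ = ∫⁻ ω, ENNReal.ofReal (w ω) * φ (Z ω) ∂P := by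
      rw [hmeas, lintegral_map hφ hZ, lintegral_withDensity_eq_lintegral_mul _
        hwm.ennreal_ofReal (g := fun ω => φ (Z ω)) (hφ.comp hZ)]
      rfl
    _ = _ := lintegral_congr_ae (by filter_upwards [hu] with ω hω; rw [hω])

lemma measurable_geomMark (k : ℕ+) : Measurable fun x => geomMark x k := by
  unfold geomMark; fun_prop

/-- The mean of `σ` under the geometric law with parameter `x`. -/
def geomMean (σ : ℕ+ → ℝ≥0∞) (x : ℝ) : ℝ≥0∞ := ∑' k, σ k * ENNReal.ofReal (geomMark x k)

@[fun_prop] lemma measurable_geomMean (σ : ℕ+ → ℝ≥0∞) : Measurable (geomMean σ) :=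
  Measurable.tsum fun k => (measurable_geomMark k).ennreal_ofReal.const_mul _

/-- The last mark is integrated out given the points and the earlier marks, by summing over its
value. Its mean is a function of the points and is absorbed into `φ`, which is why the induction
varies `φ`. -/
lemma IsCMPP.lintegral_marks {Ω : Type*} [MeasurableSpace Ω] {P : Measure Ω}
    [IsProbabilityMeasure P] {g : ℝ → ℝ} {lam : ℝ → ℝ → ℝ} {X : ℕ → Ω → ℝ} {L : ℕ → Ω → ℕ+}
    (h : IsCMPP P g geomMark lam geomMark X L) (σ : ℕ → ℕ+ → ℝ≥0∞) (n : ℕ)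
    {φ : (ℕ → ℝ) → ℝ≥0∞} (hφ : Measurable φ) :
    ∫⁻ ω, φ (fun i => X i ω) * ∏ i ∈ Finset.range n, σ i (L i ω) ∂P =
      ∫⁻ ω, φ (fun i => X i ω) * ∏ i ∈ Finset.range n, geomMean (σ i) (X i ω) ∂P := by
  have hXm : Measurable fun ω (i : ℕ) => X i ω := measurable_pi_iff.2 h.measurable_X
  have hLm := h.measurable_L
  have hXm' := h.measurable_X
  have hσ : ∀ i, Measurable (σ i) := fun i => Measurable.of_discrete
  induction n generalizing φ with
  | zero => simp
  | succ n ih =>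
    have hone : ∀ k, ∫⁻ ω in {ω | L n ω = k},
        φ (fun i => X i ω) * ∏ i ∈ Finset.range n, σ i (L i ω) ∂P =
        ∫⁻ ω, ENNReal.ofReal (geomMark (X n ω) k) *
          (φ (fun i => X i ω) * ∏ i ∈ Finset.range n, σ i (L i ω)) ∂P := by
      intro k
      have hs : MeasurableSet {ω | L n ω = k} := hLm n (measurableSet_singleton k)
      -- The mark `L 0` has its own axiom, with conditioning on the points alone.
      rcases Nat.eq_zero_or_pos n with rfl | hn
      · simpa using setLIntegral_eq_of_condExp hXm hs (h.mark_zero k) hφ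
      · have := setLIntegral_eq_of_condExp (hXm.prodMk (measurable_pi_iff.2 fun j : Fin n => hLm j))
          hs (h.mark n k hn) (φ := fun z => φ z.1 * ∏ j : Fin n, σ j (z.2 j))
          ((hφ.comp measurable_fst).mul (Finset.measurable_fun_prod _ fun j _ =>
            (hσ j).comp ((measurable_pi_apply j).comp measurable_snd)))
        simp only [Finset.prod_range]
        exact this
    have hG : Measurable fun ω => φ (fun i => X i ω) * ∏ i ∈ Finset.range n, σ i (L i ω) := by
      fun_prop
    calc ∫⁻ ω, φ (fun i => X i ω) * ∏ i ∈ Finset.range (n + 1), σ i (L i ω) ∂P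
        = ∫⁻ ω, ∑' k, σ n k * {ω | L n ω = k}.indicator
            (fun ω => φ (fun i => X i ω) * ∏ i ∈ Finset.range n, σ i (L i ω)) ω ∂P := by
          refine lintegral_congr fun ω => ?_
          rw [tsum_eq_single (L n ω), Set.indicator_of_mem (show ω ∈ {ω' | L n ω' = L n ω} from rfl), Finset.prod_range_succ]
          · ring
          · intro k hk
            rw [Set.indicator_of_notMem (fun h => hk h.symm), mul_zero]
      _ = ∑' k, σ n k * ∫⁻ ω, ENNReal.ofReal (geomMark (X n ω) k) *
            (φ (fun i => X i ω) * ∏ i ∈ Finset.range n, σ i (L i ω)) ∂P := by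
          have hs : ∀ k, MeasurableSet {ω | L n ω = k} := fun k =>
            hLm n (measurableSet_singleton k)
          rw [lintegral_tsum fun k => ((hG.indicator (hs k)).const_mul _).aemeasurable]
          refine tsum_congr fun k => ?_
          rw [lintegral_const_mul _ (hG.indicator (hs k)), lintegral_indicator (hs k), hone k]
      _ = ∫⁻ ω, (φ (fun i => X i ω) * geomMean (σ n) (X n ω)) *
            ∏ i ∈ Finset.range n, σ i (L i ω) ∂P := by
          have hq : ∀ k, Measurable fun ω => ENNReal.ofReal (geomMark (X n ω) k) := fun k =>
            ((measurable_geomMark k).comp (hXm' n)).ennreal_ofReal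
          refine (tsum_congr fun k =>
            (lintegral_const_mul (μ := P) (σ n k) ((hq k).mul hG)).symm).trans ?_
          rw [← lintegral_tsum fun k => (((hq k).mul hG).const_mul _).aemeasurable]
          refine lintegral_congr fun ω => ?_
          simp only [Pi.mul_apply, ← mul_assoc]
          rw [ENNReal.tsum_mul_right, ENNReal.tsum_mul_right, ← geomMean]
          ring
      _ = _ := by
          rw [ih (φ := fun z => φ z * geomMean (σ n) (z n)) (by fun_prop)]
          refine lintegral_congr fun ω => ?_
          rw [Finset.prod_range_succ]
          ring

/-! ### Conditioning on the initial point -/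

lemma lintegral_condDistrib_prod {Ω α β : Type*} [MeasurableSpace Ω] [MeasurableSpace α]
    [MeasurableSpace β] [StandardBorelSpace β] [Nonempty β] {P : Measure Ω} [IsFiniteMeasure P]
    {U : Ω → α} {Z : Ω → β} (hU : Measurable U) (hZ : Measurable Z) {F : α × β → ℝ≥0∞}
    (hF : Measurable F) :
    ∫⁻ ω, F (U ω, Z ω) ∂P = ∫⁻ u, ∫⁻ z, F (u, z) ∂(condDistrib Z U P u) ∂(P.map U) := by
  rw [← Measure.lintegral_compProd hF, compProd_map_condDistrib hZ.aemeasurable,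
    lintegral_map hF (hU.prodMk hZ)]

lemma ae_condDistrib_of_ae {Ω α β : Type*} [MeasurableSpace Ω] [MeasurableSpace α]
    [MeasurableSpace β] [StandardBorelSpace β] [Nonempty β] {P : Measure Ω} [IsFiniteMeasure P]
    {U : Ω → α} {Z : Ω → β} (hU : Measurable U) (hZ : Measurable Z) {p : α × β → Prop}
    (hp : MeasurableSet {y | p y}) (h : ∀ᵐ ω ∂P, p (U ω, Z ω)) :
    ∀ᵐ u ∂(P.map U), ∀ᵐ z ∂(condDistrib Z U P u), p (u, z) := by
  refine Measure.ae_ae_of_ae_compProd ?_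
  rw [compProd_map_condDistrib hZ.aemeasurable]
  exact (ae_map_iff (hU.prodMk hZ).aemeasurable hp).2 h

/-! ### Strings of the generated sequence -/

lemma markSum_strictMono (l : ℕ → ℕ+) : StrictMono (markSum l) :=
  strictMono_nat_of_lt_succ fun _ => PNat.lt_add_right _ _

lemma bernoulliOfMarks_eq_one_iff (l : ℕ → ℕ+) (n : ℕ+) :
    bernoulliOfMarks l n = 1 ↔ ∃ r, n = markSum l r := by
  unfold bernoulliOfMarks
  split_ifs with h <;> simp [h]

lemma bernoulliOfMarks_eq_zero_iff (l : ℕ → ℕ+) (n : ℕ+) :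
    bernoulliOfMarks l n = 0 ↔ ¬ ∃ r, n = markSum l r := by
  unfold bernoulliOfMarks
  split_ifs with h <;> simp [h]

/-- A string joins consecutive ones, that is, consecutive partial sums, and its length is the mark
between them. The mark `l 0` is the wait for the first one and gives no string, hence the index `r +
1`. -/
lemma isStringAt_bernoulliOfMarks_iff (l : ℕ → ℕ+) (d n : ℕ+) :
    IsStringAt (bernoulliOfMarks l) d n ↔ ∃ r, l (r + 1) = d ∧ markSum l r = n := by
  constructor
  · rintro ⟨h1, h0, h2⟩
    obtain ⟨r, hr⟩ := (bernoulliOfMarks_eq_one_iff l n).1 h1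
    obtain ⟨s, hs⟩ := (bernoulliOfMarks_eq_one_iff l (n + d)).1 h2
    have hrs : r < s := (markSum_strictMono l).lt_iff_lt.1
      (by rw [← hr, ← hs]; exact PNat.lt_add_right n d)
    have hs1 : s = r + 1 := by
      by_contra hne
      have hlt : r + 1 < s := by omega
      have := h0 (markSum l (r + 1)) (by rw [hr]; exact markSum_strictMono l (by omega))
        (by rw [hs]; exact markSum_strictMono l hlt)
      exact (bernoulliOfMarks_eq_zero_iff l _).1 this ⟨r + 1, rfl⟩
    refine ⟨r, ?_, hr.symm⟩
    rw [hs1, markSum, ← hr] at hs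
    exact (add_left_cancel hs).symm
  · rintro ⟨r, rfl, rfl⟩
    refine ⟨(bernoulliOfMarks_eq_one_iff l _).2 ⟨r, rfl⟩, fun m hm1 hm2 => ?_,
      (bernoulliOfMarks_eq_one_iff l _).2 ⟨r + 1, rfl⟩⟩
    rw [bernoulliOfMarks_eq_zero_iff]
    rintro ⟨s, rfl⟩
    have h1 := (markSum_strictMono l).lt_iff_lt.1 hm1
    have h2 : s < r + 1 := (markSum_strictMono l).lt_iff_lt.1 hm2
    omega

lemma toENNReal_countVector (y : ℕ+ → Fin 2) (d : ℕ+) :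
    (countVector y d : ℝ≥0∞) = ∑' n, {n | IsStringAt y d n}.indicator 1 n := by
  rw [countVector, ← ENNReal.tsum_set_one, ← tsum_subtype]
  rfl

lemma toENNReal_countVector_bernoulliOfMarks (l : ℕ → ℕ+) (d : ℕ+) :
    (countVector (bernoulliOfMarks l) d : ℝ≥0∞) = ∑' i, if l (i + 1) = d then 1 else 0 := by
  have : {n | IsStringAt (bernoulliOfMarks l) d n} = markSum l '' {i | l (i + 1) = d} := by
    ext n
    exact isStringAt_bernoulliOfMarks_iff l d n
  rw [countVector, this, (markSum_strictMono l).injective.encard_image, ← ENNReal.tsum_set_one,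
    tsum_subtype {i | l (i + 1) = d} fun _ => (1 : ℝ≥0∞)]
  refine tsum_congr fun i => ?_
  by_cases h : l (i + 1) = d
  · rw [if_pos h, Set.indicator_of_mem (by exact h)]
  · rw [if_neg h, Set.indicator_of_notMem (by exact h)]

/-- Linear functionals of the histogram are additive over the marks, so their Laplace transforms are
means of products over the points. The sum ignores the order of the marks. -/
lemma sum_mul_countVector_bernoulliOfMarks (l : ℕ → ℕ+) (n : ℕ+ →₀ ℕ) :
    (n.sum fun d k => (k : ℝ≥0∞) * (countVector (bernoulliOfMarks l) d : ℝ≥0∞)) =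
      ∑' i, (n (l (i + 1)) : ℝ≥0∞) := by
  simp_rw [toENNReal_countVector_bernoulliOfMarks, Finsupp.sum, ← ENNReal.tsum_mul_left]
  rw [← Summable.tsum_finsetSum fun _ _ => ENNReal.summable]
  refine tsum_congr fun i => ?_
  simp only [mul_ite, mul_one, mul_zero]
  rw [Finset.sum_ite_eq]
  split_ifs with h
  · rfl
  · simp [Finsupp.notMem_support_iff.1 h]

lemma measurable_of_toENNReal {α : Type*} [MeasurableSpace α] {f : α → ℕ∞}
    (hf : Measurable fun x => (f x : ℝ≥0∞)) : Measurable f := by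
  refine measurable_to_countable' fun m => ?_
  have : f ⁻¹' {m} = (fun x => (f x : ℝ≥0∞)) ⁻¹' {(m : ℝ≥0∞)} := by
    ext x
    simp
  rw [this]
  exact hf (measurableSet_singleton _)

lemma measurable_countVector : Measurable countVector := by
  refine measurable_pi_iff.2 fun d => measurable_of_toENNReal ?_
  simp_rw [toENNReal_countVector]
  refine Measurable.tsum fun n => ?_
  have hset : MeasurableSet {y : ℕ+ → Fin 2 | IsStringAt y d n} := by
    have h1 : ∀ (m : ℕ+) (e : Fin 2), MeasurableSet {y : ℕ+ → Fin 2 | y m = e} := fun m e =>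
      measurableSet_eq_fun (measurable_pi_apply m) measurable_const
    refine (h1 n 1).inter (MeasurableSet.inter ?_ (h1 (n + d) 1))
    refine MeasurableSet.congr (s := ⋂ m : ℕ+, {y | n < m → m < n + d → y m = 0}) ?_
      (by ext y; exact Set.mem_iInter)
    refine MeasurableSet.iInter fun m => ?_
    by_cases h : n < m ∧ m < n + d
    · exact (h1 m 0).congr (by ext y; exact ⟨fun hy _ _ => hy, fun hy => hy h.1 h.2⟩)
    · exact MeasurableSet.univ.congr
        (by ext y; exact ⟨fun _ h1 h2 => absurd ⟨h1, h2⟩ h, fun _ => trivial⟩)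
  have heq : (fun y => {n | IsStringAt y d n}.indicator (1 : ℕ+ → ℝ≥0∞) n) =
      {y : ℕ+ → Fin 2 | IsStringAt y d n}.indicator 1 := by
    ext y
    by_cases h : IsStringAt y d n <;> simp [Set.indicator, h]
  rw [heq]
  exact measurable_one.indicator hset

lemma measurable_markSum (r : ℕ) : Measurable fun l : ℕ → ℕ+ => markSum l r := by
  induction r with
  | zero => exact measurable_pi_apply 0
  | succ r ih =>
    exact (Measurable.of_discrete (f := fun p : ℕ+ × ℕ+ => p.1 + p.2)).comp
      (ih.prodMk (measurable_pi_apply (r + 1)))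

lemma measurable_bernoulliOfMarks : Measurable bernoulliOfMarks := by
  refine measurable_pi_iff.2 fun n => ?_
  refine Measurable.ite ?_ measurable_const measurable_const
  refine MeasurableSet.congr (s := ⋃ r, {l : ℕ → ℕ+ | n = markSum l r}) ?_
    (by ext l; exact Set.mem_iUnion)
  exact MeasurableSet.iUnion fun r =>
    measurableSet_eq_fun measurable_const (measurable_markSum r)

/-! ### Geometric marks -/

lemma geomMean_one {x : ℝ} (h0 : 0 ≤ x) (h1 : x < 1) : geomMean (fun _ => 1) x = 1 := by
  have hx : (0 : ℝ) ≤ 1 - x := sub_nonneg.2 h1.le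
  have h2 : ∑' k : ℕ, ENNReal.ofReal (x ^ k * (1 - x)) = 1 := by
    rw [← ENNReal.ofReal_tsum_of_nonneg (fun k => by positivity)
      ((summable_geometric_of_lt_one h0 h1).mul_right _), tsum_mul_right,
      tsum_geometric_of_lt_one h0 h1, inv_mul_cancel₀ (sub_pos.2 h1).ne', ENNReal.ofReal_one]
  rw [← Equiv.pnatEquivNat.tsum_eq] at h2
  refine Eq.trans ?_ h2
  simp only [geomMean, one_mul, geomMark]
  rfl

lemma geomMean_le_one {x : ℝ} (h0 : 0 ≤ x) (h1 : x < 1) {σ : ℕ+ → ℝ≥0∞} (hσ : ∀ k, σ k ≤ 1) :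
    geomMean σ x ≤ 1 := by
  rw [← geomMean_one h0 h1]
  exact ENNReal.tsum_le_tsum fun k => mul_le_mul_left (hσ k) _

lemma one_sub_geomMean {x : ℝ} (h0 : 0 ≤ x) (h1 : x < 1) {σ : ℕ+ → ℝ≥0∞} (hσ : ∀ k, σ k ≤ 1) :
    1 - geomMean σ x = geomMean (fun k => 1 - σ k) x := by
  refine ENNReal.sub_eq_of_eq_add
    (ne_top_of_le_ne_top ENNReal.one_ne_top (geomMean_le_one h0 h1 hσ)) ?_
  refine (geomMean_one h0 h1).symm.trans ?_
  rw [geomMean, geomMean, geomMean, ← ENNReal.tsum_add]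
  refine tsum_congr fun k => ?_
  rw [← add_mul, tsub_add_cancel_of_le (hσ k)]

/-- The factor `1 - y` of the geometric law cancels the pole of the intensity, and `a * y ^ (k - 1)`
remains. The start `x = 0` is admitted for the case `b = 0`. -/
lemma lintegral_geomMark_recordMeasure {a x : ℝ} (ha : 0 < a) (h0 : 0 ≤ x) (h1 : x < 1) (k : ℕ+) :
    ∫⁻ y, ENNReal.ofReal (geomMark y k) ∂(recordMeasure a x) =
      ENNReal.ofReal (a * (1 - x ^ (k : ℕ)) / k) := by
  rw [lintegral_recordMeasure a x (measurable_geomMark k).ennreal_ofReal]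
  obtain ⟨m, hm⟩ : ∃ m : ℕ, (k : ℕ) = m + 1 := ⟨k.natPred, (k.natPred_add_one).symm⟩
  calc _ = ∫⁻ y in Set.Ioo x 1, ENNReal.ofReal (a * y ^ m) := by
        refine setLIntegral_congr_fun measurableSet_Ioo fun y hy => ?_
        have hy1 : 0 < 1 - y := sub_pos.2 hy.2
        rw [← ENNReal.ofReal_mul (by positivity), geomMark, hm, Nat.add_sub_cancel]
        congr 1
        field_simp
    _ = _ := by
        rw [setLIntegral_congr Ioo_ae_eq_Ioc, ← ofReal_integral_eq_lintegral_ofReal,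
          ← intervalIntegral.integral_of_le h1.le, intervalIntegral.integral_const_mul,
          integral_pow, hm]
        · congr 1
          push_cast
          rw [one_pow]
          ring
        · exact ((continuous_const.mul (continuous_pow m)).integrableOn_Icc (a := x) (b := 1)).mono_set
            Set.Ioc_subset_Icc_self
        · filter_upwards [ae_restrict_mem measurableSet_Ioc] with y hy
          have := h0.trans hy.1.le
          positivity

/-- Marking theorem in Laplace form: `1 - h` is a finite combination of geometric masses, each
integrated against the intensity. Agreement on `(0, 1)` suffices, where the intensity lives, and
this permits a truncated `h`. -/
lemma recordLaplace_geomMean {a x : ℝ} (ha : 0 < a) (h0 : 0 ≤ x) (h1 : x < 1) (n : ℕ+ →₀ ℕ)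
    {h : ℝ → ℝ≥0∞} (hh : Measurable h)
    (heq : ∀ y ∈ Set.Ioo (0 : ℝ) 1, h y = geomMean (fun k => expNeg (n k)) y) :
    recordLaplace a h x = expNeg (n.sum fun k m =>
      (1 - expNeg m) * ENNReal.ofReal (a * (1 - x ^ (k : ℕ)) / k)) := by
  have hterm : ∀ k, Measurable fun y => (1 - expNeg (n k)) * ENNReal.ofReal (geomMark y k) :=
    fun k => (measurable_geomMark k).ennreal_ofReal.const_mul _
  have hsum : ∀ y, geomMean (fun k => 1 - expNeg (n k)) y =
      ∑ k ∈ n.support, (1 - expNeg (n k)) * ENNReal.ofReal (geomMark y k) := fun y => by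
    refine tsum_eq_sum fun k hk => ?_
    simp [Finsupp.notMem_support_iff.1 hk]
  have hint : ∫⁻ y, (1 - h y) ∂(recordMeasure a x) =
      ∫⁻ y, ∑ k ∈ n.support, (1 - expNeg (n k)) * ENNReal.ofReal (geomMark y k)
        ∂(recordMeasure a x) := by
    rw [lintegral_recordMeasure a x (G := fun y => 1 - h y) (measurable_const.sub hh),
      lintegral_recordMeasure a x (Finset.measurable_fun_sum _ fun k _ => hterm k)]
    refine setLIntegral_congr_fun measurableSet_Ioo fun y hy => ?_
    have hy0 := h0.trans_lt hy.1
    simp only [heq y ⟨hy0, hy.2⟩, one_sub_geomMean hy0.le hy.2 fun k => expNeg_le_one _, hsum]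
  rw [recordLaplace, hint, lintegral_finsetSum _ fun k _ => hterm k, Finsupp.sum]
  congr 1
  refine Finset.sum_congr rfl fun k _ => ?_
  rw [lintegral_const_mul _ (measurable_geomMark k).ennreal_ofReal,
    lintegral_geomMark_recordMeasure ha h0 h1]

/-- The factor `geomMean σ`, truncated so as to be at most `1` everywhere. -/
def markFactor (n : ℕ+ →₀ ℕ) (y : ℝ) : ℝ≥0∞ := min (geomMean (fun k => expNeg (n k)) y) 1

@[fun_prop] lemma measurable_markFactor (n : ℕ+ →₀ ℕ) : Measurable (markFactor n) := by
  unfold markFactor; fun_prop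

lemma markFactor_le_one (n : ℕ+ →₀ ℕ) (y : ℝ) : markFactor n y ≤ 1 := min_le_right _ _

lemma markFactor_eq (n : ℕ+ →₀ ℕ) {y : ℝ} (hy : y ∈ Set.Ioo (0 : ℝ) 1) :
    markFactor n y = geomMean (fun k => expNeg (n k)) y :=
  min_eq_left (geomMean_le_one hy.1.le hy.2 fun _ => expNeg_le_one _)

/-! ### The conditional law of the count vector -/

/-- At the multiplier `∞` the Laplace transform is the probability that `A` is empty, here `expNeg 0
= 1`. -/
lemma IsPoissonProcess.ae_eq_zero {Ω E : Type*} [MeasurableSpace Ω] [MeasurableSpace E]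
    {μ : Measure Ω} [IsProbabilityMeasure μ] {N : Ω → Measure E} {Λ : Measure E}
    (h : IsPoissonProcess μ N Λ) {A : Set E} (hA : MeasurableSet A) (h0 : Λ A = 0) :
    ∀ᵐ ω ∂μ, N ω A = 0 := by
  have h1 := h.lintegral_expNeg_mul hA ∞
  rw [h0, mul_zero, expNeg_zero] at h1
  have hs : MeasurableSet {ω | N ω A = 0} := h.measurable A hA (measurableSet_singleton 0)
  have h2 : ∀ ω, expNeg (∞ * N ω A) = {ω | N ω A = 0}.indicator 1 ω := fun ω => by
    by_cases hω : N ω A = 0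
    · rw [Set.indicator_of_mem (by exact hω), hω]; simp
    · rw [Set.indicator_of_notMem (by exact hω), ENNReal.top_mul hω, expNeg_top]
  simp_rw [h2] at h1
  rw [lintegral_indicator_one hs] at h1
  exact (mem_ae_iff_prob_eq_one hs).2 h1

section Model

variable {Ω : Type*} [MeasurableSpace Ω] {P : Measure Ω} [IsProbabilityMeasure P]
  {X : ℕ → Ω → ℝ} {L : ℕ → Ω → ℕ+} {a b : ℝ}

lemma IsCMPP.map_X_zero {r q : ℝ → ℕ+ → ℝ} {lam : ℝ → ℝ → ℝ}
    (h : IsCMPP P (betaPDFReal b a) r lam q X L) : P.map (X 0) = betaMeasure b a :=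
  h.law_X_zero

lemma IsCMPP.measurable_X_pi {g : ℝ → ℝ} {r q : ℝ → ℕ+ → ℝ} {lam : ℝ → ℝ → ℝ}
    (h : IsCMPP P g r lam q X L) : Measurable fun ω (i : ℕ) => X i ω :=
  measurable_pi_iff.2 h.measurable_X

lemma IsCMPP.measurable_L_pi {g : ℝ → ℝ} {r q : ℝ → ℕ+ → ℝ} {lam : ℝ → ℝ → ℝ}
    (h : IsCMPP P g r lam q X L) : Measurable fun ω (i : ℕ) => L i ω :=
  measurable_pi_iff.2 h.measurable_L

/-- The beta law settles `X 0`, and the intensity vanishes outside `(0, 1)` for the rest. On `(0,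
1)` the mark weights are genuine probabilities. -/
lemma IsCMPP.ae_mem_Ioo (h : IsCMPP P (betaPDFReal b a) geomMark (recordIntensity a) geomMark X L) :
    ∀ᵐ ω ∂P, ∀ i, X i ω ∈ Set.Ioo (0 : ℝ) 1 := by
  have hX := h.measurable_X_pi
  have h0 : ∀ᵐ ω ∂P, X 0 ω ∈ Set.Ioo (0 : ℝ) 1 := by
    have := ae_betaMeasure_mem_Ioo b a
    rw [← h.map_X_zero] at this
    exact ae_of_ae_map (h.measurable_X 0).aemeasurable this
  let A : Set ℝ := (Set.Ioo 0 1)ᶜ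
  have hA : MeasurableSet A := measurableSet_Ioo.compl
  have hcond : ∀ᵐ x ∂(P.map (X 0)), ∀ᵐ z ∂(condDistrib (fun ω i => X i ω) (X 0) P x),
      pointProcess z A = 0 := by
    have hIoo := ae_betaMeasure_mem_Ioo b a
    rw [← h.map_X_zero] at hIoo
    filter_upwards [h.poisson, hIoo] with x hx hx1
    refine hx.ae_eq_zero hA ?_
    change recordMeasure a x A = 0
    rw [← lintegral_indicator_one hA, lintegral_recordMeasure _ _ (measurable_one.indicator hA),
      setLIntegral_eq_zero measurableSet_Ioo]
    intro y hy
    have : y ∉ A := fun hyA => hyA ⟨hx1.1.trans hy.1, hy.2⟩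
    simp [this]
  have hN : ∀ᵐ ω ∂P, pointProcess (fun i => X i ω) A = 0 := by
    have hB : MeasurableSet {p : ℝ × (ℕ → ℝ) | pointProcess p.2 A = 0} :=
      ((measurable_pointProcess_apply hA).comp measurable_snd) (measurableSet_singleton 0)
    have h1 := (Measure.ae_compProd_iff hB).2 hcond
    rw [compProd_map_condDistrib hX.aemeasurable] at h1
    exact ae_of_ae_map ((h.measurable_X 0).prodMk hX).aemeasurable h1
  filter_upwards [h0, hN] with ω hω0 hω i
  cases i with
  | zero => exact hω0
  | succ i =>
    rw [pointProcess, Measure.sum_apply _ hA, ENNReal.tsum_eq_zero] at hω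
    have := hω i
    rw [Measure.dirac_apply' _ hA] at this
    by_contra hne
    rw [Set.indicator_of_mem (by exact hne)] at this
    simp at this

/-- The Laplace transform of the marks, given the points. -/
lemma IsCMPP.lintegral_expNeg_marks
    (h : IsCMPP P (betaPDFReal b a) geomMark (recordIntensity a) geomMark X L)
    (n : ℕ → ℕ+ →₀ ℕ) {φ : (ℕ → ℝ) → ℝ≥0∞} (hφ : Measurable φ) (hφ1 : ∀ z, φ z ≤ 1) :
    ∫⁻ ω, φ (fun i => X i ω) * expNeg (∑' i, (n i (L i ω) : ℝ≥0∞)) ∂P =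
      ∫⁻ ω, φ (fun i => X i ω) * expNeg (∑' i, negLog (markFactor (n i) (X i ω))) ∂P := by
  have hX := h.measurable_X
  have hL := h.measurable_L
  have hXp := h.measurable_X_pi
  have hlim : ∀ F : ℕ → Ω → ℝ≥0∞, (∀ i, Measurable (F i)) →
      Tendsto (fun m => ∫⁻ ω, φ (fun i => X i ω) * ∏ i ∈ Finset.range m, expNeg (F i ω) ∂P) atTop
        (𝓝 (∫⁻ ω, φ (fun i => X i ω) * expNeg (∑' i, F i ω) ∂P)) := by
    intro F hF
    refine tendsto_lintegral_of_dominated_convergence (fun _ => 1) (fun m => by fun_prop)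
      (fun m => ae_of_all _ fun ω => ?_) (by simp) (ae_of_all _ fun ω => ?_)
    · exact mul_le_one' (hφ1 _) (Finset.prod_le_one' fun i _ => expNeg_le_one _)
    · exact ENNReal.Tendsto.const_mul (tendsto_prod_expNeg _)
        (Or.inr (ne_top_of_le_ne_top ENNReal.one_ne_top (hφ1 _)))
  have h1 := hlim (fun i ω => (n i (L i ω) : ℝ≥0∞)) fun i =>
    (Measurable.of_discrete (f := fun k : ℕ+ => (n i k : ℝ≥0∞))).comp (hL i)
  have h2 := hlim (fun i ω => negLog (markFactor (n i) (X i ω))) fun i =>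
    measurable_negLog.comp ((measurable_markFactor (n i)).comp (hX i))
  refine tendsto_nhds_unique h1 (h2.congr fun m => ?_)
  rw [h.lintegral_marks (fun i k => expNeg (n i k)) m hφ]
  refine lintegral_congr_ae ?_
  filter_upwards [h.ae_mem_Ioo] with ω hω
  congr 1
  refine Finset.prod_congr rfl fun i _ => ?_
  rw [expNeg_negLog (markFactor_le_one _ _), markFactor_eq (n i) (hω i)]

/-- The Laplace transform of the marks of the points after the initial one. -/
lemma IsCMPP.lintegral_expNeg_marks_succ
    (h : IsCMPP P (betaPDFReal b a) geomMark (recordIntensity a) geomMark X L) (n : ℕ+ →₀ ℕ)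
    {φ : (ℕ → ℝ) → ℝ≥0∞} (hφ : Measurable φ) (hφ1 : ∀ z, φ z ≤ 1) :
    ∫⁻ ω, φ (fun i => X i ω) * expNeg (∑' i, (n (L (i + 1) ω) : ℝ≥0∞)) ∂P =
      ∫⁻ ω, φ (fun i => X i ω) * expNeg (∑' i, negLog (markFactor n (X (i + 1) ω))) ∂P := by
  -- The initial mark is ignored by giving it the zero functional, whose factor is the total
  -- geometric mass `1`.
  obtain ⟨n', h0, hs⟩ : ∃ n' : ℕ → ℕ+ →₀ ℕ, n' 0 = 0 ∧ ∀ i, n' (i + 1) = n :=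
    ⟨fun i => if i = 0 then 0 else n, if_pos rfl, fun i => if_neg i.succ_ne_zero⟩
  have hsplit : ∀ F : ℕ → ℝ≥0∞, ∑' i, F i = F 0 + ∑' i, F (i + 1) := fun F =>
    tsum_eq_zero_add' ENNReal.summable
  refine Eq.trans ?_ ((h.lintegral_expNeg_marks n' hφ hφ1).trans (lintegral_congr_ae ?_))
  · refine lintegral_congr fun ω => ?_
    rw [hsplit fun i => (n' i (L i ω) : ℝ≥0∞), h0]
    simp only [hs, Finsupp.coe_zero, Pi.zero_apply, Nat.cast_zero, zero_add]
  · filter_upwards [h.ae_mem_Ioo] with ω hω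
    have h1 : markFactor 0 (X 0 ω) = 1 := by
      rw [markFactor_eq 0 (hω 0)]
      simpa using geomMean_one (hω 0).1.le (hω 0).2
    rw [hsplit fun i => negLog (markFactor (n' i) (X i ω)), h0, h1, negLog_one, zero_add]
    simp only [hs]

/-- The Laplace functional of the points after the initial one. -/
lemma IsCMPP.lintegral_mul_expNeg_points
    (h : IsCMPP P (betaPDFReal b a) geomMark (recordIntensity a) geomMark X L) {φ η : ℝ → ℝ≥0∞}
    (hφ : Measurable φ) (hη : Measurable η) (hη1 : ∀ y, η y ≤ 1) :
    ∫⁻ ω, φ (X 0 ω) * expNeg (∑' i, negLog (η (X (i + 1) ω))) ∂P =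
      ∫⁻ x, φ x * recordLaplace a η x ∂(betaMeasure b a) := by
  have hX := h.measurable_X_pi
  have hf : Measurable fun y => negLog (η y) := by fun_prop
  have hN : Measurable fun z : ℕ → ℝ => expNeg (∫⁻ y, negLog (η y) ∂(pointProcess z)) :=
    measurable_expNeg.comp (measurable_lintegral_randomMeasure
      (fun A hA => measurable_pointProcess_apply hA) hf)
  have hpt : ∀ ω, ∑' i, negLog (η (X (i + 1) ω)) =
      ∫⁻ y, negLog (η y) ∂(pointProcess fun i => X i ω) := fun ω =>
    (lintegral_pointProcess (fun i => X i ω) hf).symm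
  simp_rw [hpt]
  refine (lintegral_condDistrib_prod (h.measurable_X 0) hX (F := fun p => φ p.1 *
    expNeg (∫⁻ y, negLog (η y) ∂(pointProcess p.2)))
    ((hφ.comp measurable_fst).mul (hN.comp measurable_snd))).trans ?_
  rw [h.map_X_zero]
  refine lintegral_congr_ae ?_
  have hpois := h.poisson
  rw [h.map_X_zero] at hpois
  filter_upwards [hpois] with x hx
  rw [lintegral_const_mul _ hN, hx.laplace hf]
  simp_rw [fun y => expNeg_negLog (hη1 y)]
  rfl

/-- Integrating out the marks leaves a Laplace functional of the Poisson points, computed by the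
marking theorem. The indicator of `B` localises the identity in `X 0`, which makes it a statement
about conditional laws. -/
lemma IsCMPP.setLIntegral_expNeg_countVector (ha : 0 < a)
    (h : IsCMPP P (betaPDFReal b a) geomMark (recordIntensity a) geomMark X L) (n : ℕ+ →₀ ℕ)
    {B : Set ℝ} (hB : MeasurableSet B) :
    ∫⁻ ω, B.indicator 1 (X 0 ω) * expNeg (n.sum fun d k =>
        (k : ℝ≥0∞) * (countVector (bernoulliOfMarks fun i => L i ω) d : ℝ≥0∞)) ∂P =
      ∫⁻ x in B, expNeg (n.sum fun k m =>
        (1 - expNeg m) * ENNReal.ofReal (a * (1 - x ^ (k : ℕ)) / k)) ∂(betaMeasure b a) := by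
  have hI : Measurable (B.indicator (1 : ℝ → ℝ≥0∞)) := measurable_one.indicator hB
  simp_rw [sum_mul_countVector_bernoulliOfMarks]
  rw [h.lintegral_expNeg_marks_succ n (φ := fun z => B.indicator 1 (z 0)) (by fun_prop)
    (fun z => Set.indicator_le_self' (fun _ _ => zero_le) _),
    h.lintegral_mul_expNeg_points hI (measurable_markFactor n) (markFactor_le_one n),
    ← lintegral_indicator hB]
  refine lintegral_congr_ae ?_
  filter_upwards [ae_betaMeasure_mem_Ioo b a] with x hx
  rw [recordLaplace_geomMean ha hx.1.le hx.2 n (measurable_markFactor n)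
    fun y hy => markFactor_eq n hy]
  by_cases hxB : x ∈ B <;> simp [hxB]

lemma IsCMPP.measurable_countVector {g : ℝ → ℝ} {r q : ℝ → ℕ+ → ℝ} {lam : ℝ → ℝ → ℝ}
    (h : IsCMPP P g r lam q X L) :
    Measurable fun ω => countVector (bernoulliOfMarks fun i => L i ω) :=
  _root_.measurable_countVector.comp (measurable_bernoulliOfMarks.comp h.measurable_L_pi)

/-- Each Laplace transform of the conditional law is identified for almost every `x₀`. There are
countably many exponents `n`, so one null set serves all, and the transforms determine the law. -/
theorem IsCMPP.condDistrib_countVector (ha : 0 < a) (hb : 0 < b)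
    (h : IsCMPP P (betaPDFReal b a) geomMark (recordIntensity a) geomMark X L) :
    ∀ᵐ x₀ ∂(betaMeasure b a),
      condDistrib (fun ω => countVector (bernoulliOfMarks fun i => L i ω)) (X 0) P x₀ =
        poissonProd fun k => a * (1 - x₀ ^ (k : ℕ)) / k := by
  have := isProbabilityMeasureBeta hb ha
  have hZ := h.measurable_countVector
  have hLap : ∀ n : ℕ+ →₀ ℕ, Measurable fun z : ℕ+ → ℕ∞ =>
      expNeg (n.sum fun d k => (k : ℝ≥0∞) * (z d : ℝ≥0∞)) := fun n => by
    unfold Finsupp.sum; fun_prop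
  have hn : ∀ n : ℕ+ →₀ ℕ, ∀ᵐ x₀ ∂(betaMeasure b a),
      ∫⁻ z, expNeg (n.sum fun d k => (k : ℝ≥0∞) * (z d : ℝ≥0∞)) ∂(condDistrib
        (fun ω => countVector (bernoulliOfMarks fun i => L i ω)) (X 0) P x₀) =
      expNeg (n.sum fun k m => (1 - expNeg m) * ENNReal.ofReal (a * (1 - x₀ ^ (k : ℕ)) / k)) := by
    intro n
    refine ae_eq_of_forall_setLIntegral_eq_of_sigmaFinite (hLap n).lintegral_kernel
      (by unfold Finsupp.sum; fun_prop) fun B hB _ => ?_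
    rw [← h.setLIntegral_expNeg_countVector ha n hB, lintegral_condDistrib_prod
      (h.measurable_X 0) hZ (F := fun p => B.indicator 1 p.1 *
        expNeg (n.sum fun d k => (k : ℝ≥0∞) * (p.2 d : ℝ≥0∞)))
        (((measurable_one.indicator hB).comp measurable_fst).mul
          ((hLap n).comp measurable_snd)), h.map_X_zero, ← lintegral_indicator hB]
    refine lintegral_congr fun x => ?_
    refine Eq.trans ?_ (lintegral_const_mul (B.indicator (1 : ℝ → ℝ≥0∞) x) (hLap n)).symm
    by_cases hxB : x ∈ B <;> simp [hxB]
  filter_upwards [ae_all_iff.2 hn] with x hx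
  refine Measure.pi_enat_ext _ _ fun n => ?_
  rw [hx n, lintegral_expNeg_poissonProd]

end Model

/-! ### Existence of the model -/

lemma condExp_ae_eq_of_setLIntegral {Ω β : Type*} [MeasurableSpace Ω] [MeasurableSpace β]
    {P : Measure Ω} [IsProbabilityMeasure P] {Z : Ω → β} (hZ : Measurable Z) {s : Set Ω}
    (hs : MeasurableSet s) {u : β → ℝ} (hu : Measurable u) (hu0 : ∀ᵐ ω ∂P, 0 ≤ u (Z ω))
    (h : ∀ B, MeasurableSet B →
      ∫⁻ ω, B.indicator 1 (Z ω) * s.indicator 1 ω ∂P =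
        ∫⁻ ω, B.indicator 1 (Z ω) * ENNReal.ofReal (u (Z ω)) ∂P) :
    P⟦s | MeasurableSpace.comap Z inferInstance⟧ =ᵐ[P] fun ω => u (Z ω) := by
  have hset : ∀ B, MeasurableSet B →
      P (s ∩ Z ⁻¹' B) = ∫⁻ ω in Z ⁻¹' B, ENNReal.ofReal (u (Z ω)) ∂P := by
    intro B hB
    have := h B hB
    rw [← lintegral_indicator (hZ hB), ← lintegral_indicator_one (hs.inter (hZ hB))]
    convert this using 2 <;> ext ω <;>
      by_cases h1 : Z ω ∈ B <;> by_cases h2 : ω ∈ s <;> simp [h1, h2]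
  have hint : Integrable (fun ω => u (Z ω)) P := by
    refine ⟨(hu.comp hZ).aestronglyMeasurable, ?_⟩
    rw [hasFiniteIntegral_iff_ofReal hu0]
    have := hset Set.univ MeasurableSet.univ
    rw [Set.preimage_univ, Set.inter_univ, Measure.restrict_univ] at this
    rw [← this]
    exact measure_lt_top P s
  refine (ae_eq_condExp_of_forall_setIntegral_eq hZ.comap_le ((integrable_const 1).indicator hs)
    (fun t _ _ => hint.integrableOn) ?_ ?_).symm
  · rintro t ⟨B, hB, rfl⟩ _
    rw [integral_indicator hs, setIntegral_const, smul_eq_mul, mul_one, measureReal_def,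
      Measure.restrict_apply hs, hset B hB, integral_eq_lintegral_of_nonneg_ae
        (ae_restrict_of_ae hu0) (hu.comp hZ).aestronglyMeasurable.restrict]
  · exact (hu.comp (comap_measurable Z)).aestronglyMeasurable

open Classical in
/-- A geometric variable with parameter `x`, from a uniform one: the least `k` with `x ^ k ≤ w`. -/
def geomOfUniform (x w : ℝ) : ℕ+ :=
  if h : ∃ k : ℕ+, x ^ (k : ℕ) ≤ w then PNat.find h else 1

lemma measurable_geomOfUniform : Measurable fun p : ℝ × ℝ => geomOfUniform p.1 p.2 := by
  classical
  have hle : ∀ k : ℕ+, MeasurableSet {p : ℝ × ℝ | p.1 ^ (k : ℕ) ≤ p.2} := fun k =>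
    measurableSet_le (by fun_prop) measurable_snd
  have hex : MeasurableSet {p : ℝ × ℝ | ∃ k : ℕ+, p.1 ^ (k : ℕ) ≤ p.2} :=
    (MeasurableSet.iUnion hle).congr (by ext p; exact Set.mem_iUnion)
  refine measurable_to_countable' fun k => ?_
  have hfind : MeasurableSet {p : ℝ × ℝ | p.1 ^ (k : ℕ) ≤ p.2 ∧ ∀ j < k, ¬ p.1 ^ (j : ℕ) ≤ p.2} := by
    refine (hle k).inter (MeasurableSet.congr
      (s := ⋂ j : ℕ+, {p : ℝ × ℝ | j < k → ¬ p.1 ^ (j : ℕ) ≤ p.2}) ?_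
      (by ext p; exact Set.mem_iInter))
    refine MeasurableSet.iInter fun j => ?_
    by_cases hj : j < k
    · exact (hle j).compl.congr (by ext p; exact ⟨fun h _ => h, fun h => h hj⟩)
    · exact MeasurableSet.univ.congr (by ext p; exact ⟨fun _ h => absurd h hj, fun _ => trivial⟩)
  refine ((hex.inter hfind).union (hex.compl.inter (MeasurableSet.const (k = 1)))).congr ?_
  ext p
  by_cases h : ∃ k : ℕ+, p.1 ^ (k : ℕ) ≤ p.2
  · have h1 : geomOfUniform p.1 p.2 = k ↔
        p.1 ^ (k : ℕ) ≤ p.2 ∧ ∀ j < k, ¬ p.1 ^ (j : ℕ) ≤ p.2 := by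
      rw [geomOfUniform, dif_pos h, PNat.find_eq_iff]
    exact ⟨fun hp => hp.elim (fun hp => h1.2 hp.2) (fun hp => absurd h hp.1),
      fun hp => Or.inl ⟨h, h1.1 hp⟩⟩
  · have h1 : geomOfUniform p.1 p.2 = 1 := by rw [geomOfUniform, dif_neg h]
    exact ⟨fun hp => hp.elim (fun hp => absurd hp.1 h) (fun hp => h1.trans hp.2.symm),
      fun hp => Or.inr ⟨h, (h1.symm.trans hp).symm⟩⟩

/-- The uniform law on `(0, 1)`. -/
def uniformLaw : Measure ℝ := volume.restrict (Set.Ioo 0 1)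

instance : IsProbabilityMeasure uniformLaw := ⟨by simp [uniformLaw]⟩

/-- The value is `k` exactly on `x ^ k ≤ w < x ^ (k - 1)`, an interval of length `x ^ (k - 1) * (1 -
x)`. -/
lemma lintegral_geomOfUniform {x : ℝ} (h0 : 0 < x) (h1 : x < 1) (k : ℕ+) :
    ∫⁻ w, ({k} : Set ℕ+).indicator 1 (geomOfUniform x w) ∂uniformLaw =
      ENNReal.ofReal (geomMark x k) := by
  classical
  have hm : MeasurableSet {w | geomOfUniform x w = k} :=
    (measurable_geomOfUniform.comp measurable_prodMk_left) (measurableSet_singleton k)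
  have h2 : ∀ w, ({k} : Set ℕ+).indicator (1 : ℕ+ → ℝ≥0∞) (geomOfUniform x w) =
      {w | geomOfUniform x w = k}.indicator 1 w := fun w => by
    by_cases h : geomOfUniform x w = k <;> simp [Set.indicator, h]
  simp_rw [h2]
  rw [lintegral_indicator_one hm, uniformLaw, Measure.restrict_apply hm]
  obtain ⟨m, hk⟩ : ∃ m : ℕ, (k : ℕ) = m + 1 := ⟨k.natPred, (k.natPred_add_one).symm⟩
  have hset : ({w | geomOfUniform x w = k} ∩ Set.Ioo 0 1 : Set ℝ) =ᵐ[volume]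
      (Set.Ico (x ^ (m + 1)) (x ^ m) : Set ℝ) := by
    have hne : ∀ᵐ w : ℝ, w ≠ 1 := by
      rw [ae_iff]
      simp
    filter_upwards [hne] with w hw
    refine propext ⟨fun hp => ?_, fun hp => ?_⟩
    · obtain ⟨hp, hw01⟩ := hp
      change geomOfUniform x w = k at hp
      have hex : ∃ j : ℕ+, x ^ (j : ℕ) ≤ w := by
        obtain ⟨j, hj⟩ := exists_pow_lt_of_lt_one hw01.1 h1
        exact ⟨j.succPNat, ((pow_le_pow_of_le_one h0.le h1.le (by simp)).trans hj.le)⟩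
      rw [geomOfUniform, dif_pos hex, PNat.find_eq_iff] at hp
      refine ⟨hk ▸ hp.1, ?_⟩
      rcases Nat.eq_zero_or_pos m with rfl | hm0
      · simpa using hw01.2
      · have hlt : Nat.toPNat m hm0 < k := by
          rw [← PNat.coe_lt_coe, hk]
          exact Nat.lt_succ_self m
        exact not_le.1 (hp.2 _ hlt)
    · obtain ⟨hp1, hp2⟩ := hp
      have hw0 : 0 < w := (pow_pos h0 _).trans_le hp1
      refine ⟨?_, hw0, hp2.trans_le (pow_le_one₀ h0.le h1.le)⟩
      have hex : ∃ j : ℕ+, x ^ (j : ℕ) ≤ w := ⟨k, by rw [hk]; exact hp1⟩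
      change geomOfUniform x w = k
      rw [geomOfUniform, dif_pos hex, PNat.find_eq_iff]
      refine ⟨by rw [hk]; exact hp1, fun j hj => not_le.2 (hp2.trans_le ?_)⟩
      refine pow_le_pow_of_le_one h0.le h1.le ?_
      have : (j : ℕ) < k := hj
      omega
  rw [measure_congr hset, Real.volume_Ico, geomMark, hk, Nat.add_sub_cancel]
  congr 1
  ring

/-- The chain as a kernel. -/
def recordKernel (a : ℝ) (ha : 0 < a) : Kernel ℝ (ℕ → ℝ) where
  toFun := recordChainLaw a
  measurable' := by
    have := isProbabilityMeasure_gapLaw ha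
    refine Measure.measurable_of_measurable_coe _ fun S hS => ?_
    simp_rw [recordChainLaw, Measure.map_apply (measurable_recordChain_pi _) hS]
    exact measurable_measure_prodMk_left (ν := gapLaw a)
      ((measurable_pi_iff.2 measurable_uncurry_recordChain) hS)

instance (a : ℝ) (ha : 0 < a) : IsMarkovKernel (recordKernel a ha) :=
  ⟨fun x => isProbabilityMeasure_recordChainLaw ha x⟩

lemma lintegral_recordChainLaw (a x : ℝ) {F : (ℕ → ℝ) → ℝ≥0∞} (hF : Measurable F) :
    ∫⁻ z, F z ∂(recordChainLaw a x) = ∫⁻ v, F (recordChain x v) ∂(gapLaw a) := by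
  rw [recordChainLaw, lintegral_map hF (measurable_recordChain_pi x)]

/-- The model is the chain started from an independent beta variable, with marks made from
independent uniform variables. -/
theorem exists_isCMPP {a b : ℝ} (ha : 0 < a) (hb : 0 < b) :
    ∃ (Ω : Type) (_ : MeasurableSpace Ω) (P : Measure Ω) (_ : IsProbabilityMeasure P)
      (X : ℕ → Ω → ℝ) (L : ℕ → Ω → ℕ+),
      IsCMPP P (betaPDFReal b a) geomMark (recordIntensity a) geomMark X L ∧
      ∀ᵐ ω ∂P, ∀ i : ℕ, X (i + 1) ω < X (i + 2) ω := by
  have := isProbabilityMeasureBeta hb ha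
  have := isProbabilityMeasure_gapLaw ha
  let U : Measure (ℕ → ℝ) := Measure.infinitePi fun _ : ℕ => uniformLaw
  let Q : Measure (ℝ × (ℕ → ℝ)) := (betaMeasure b a).prod (gapLaw a)
  let P : Measure ((ℝ × (ℕ → ℝ)) × (ℕ → ℝ)) := Q.prod U
  let X : ℕ → (ℝ × (ℕ → ℝ)) × (ℕ → ℝ) → ℝ := fun n ω => recordChain ω.1.1 ω.1.2 n
  let L : ℕ → (ℝ × (ℕ → ℝ)) × (ℕ → ℝ) → ℕ+ := fun n ω => geomOfUniform (X n ω) (ω.2 n)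
  have hX : ∀ n, Measurable (X n) := fun n =>
    (measurable_uncurry_recordChain n).comp measurable_fst
  have hXp : Measurable fun ω i => X i ω := measurable_pi_iff.2 hX
  have hL : ∀ n, Measurable (L n) := fun n =>
    measurable_geomOfUniform.comp ((hX n).prodMk ((measurable_pi_apply n).comp measurable_snd))
  have hmap0 : P.map (X 0) = betaMeasure b a := by
    have h1 : X 0 = Prod.fst ∘ Prod.fst := rfl
    rw [h1, ← Measure.map_map measurable_fst measurable_fst]
    have h2 : P.map Prod.fst = Q := Measure.fst_prod
    rw [h2]
    exact Measure.fst_prod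
  have hgood : ∀ᵐ ω ∂P, ω.1.1 ∈ Set.Ioo (0 : ℝ) 1 ∧ ∀ i, ω.1.2 i ∈ Set.Ioo (0 : ℝ) 1 := by
    have h1 : ∀ᵐ p ∂Q, p.1 ∈ Set.Ioo (0 : ℝ) 1 :=
      Measure.quasiMeasurePreserving_fst.ae (ae_betaMeasure_mem_Ioo b a)
    have h2 : ∀ᵐ p ∂Q, ∀ i, p.2 i ∈ Set.Ioo (0 : ℝ) 1 :=
      Measure.quasiMeasurePreserving_snd.ae (ae_gapLaw_mem_Ioo ha)
    exact Measure.quasiMeasurePreserving_fst.ae (h1.and h2)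
  have hmono : ∀ x v, x ∈ Set.Ioo (0 : ℝ) 1 → (∀ i, v i ∈ Set.Ioo (0 : ℝ) 1) →
      ∀ n, recordChain x v n ∈ Set.Ioo (0 : ℝ) 1 := by
    intro x v hx hv n
    refine ⟨?_, recordChain_lt_one hx.2 hv n⟩
    exact hx.1.trans_le
      ((strictMono_nat_of_lt_succ (recordChain_lt_succ hx.2 hv)).monotone (Nat.zero_le n))
  have hmem : ∀ᵐ ω ∂P, ∀ i, X i ω ∈ Set.Ioo (0 : ℝ) 1 := by
    filter_upwards [hgood] with ω hω using hmono _ _ hω.1 hω.2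
  -- the joint law of the marks
  have hmark : ∀ (n : ℕ) (k : ℕ+) {β : Type} [MeasurableSpace β]
      (Z : (ℕ → ℝ) × (Fin n → ℕ+) → β), Measurable Z → ∀ B : Set β, MeasurableSet B →
      ∫⁻ ω, B.indicator 1 (Z (fun i => X i ω, fun j : Fin n => L j ω)) *
        {ω | L n ω = k}.indicator 1 ω ∂P =
      ∫⁻ ω, B.indicator 1 (Z (fun i => X i ω, fun j : Fin n => L j ω)) *
        ENNReal.ofReal (geomMark (X n ω) k) ∂P := by
    intro n k β _ Z hZ B hB
    have hZm : Measurable fun ω => B.indicator (1 : β → ℝ≥0∞)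
        (Z (fun i => X i ω, fun j : Fin n => L j ω)) :=
      (measurable_one.indicator hB).comp
        (hZ.comp (hXp.prodMk (measurable_pi_iff.2 fun j : Fin n => hL j)))
    have hs : MeasurableSet {ω | L n ω = k} := hL n (measurableSet_singleton k)
    refine (lintegral_prod (μ := Q) (ν := U) _
      (hZm.mul (measurable_one.indicator hs)).aemeasurable).trans (Eq.trans ?_
      (lintegral_prod (μ := Q) (ν := U) _ (hZm.mul
        ((measurable_geomMark k).comp (hX n)).ennreal_ofReal).aemeasurable).symm)
    refine lintegral_congr_ae ?_
    have hQ : ∀ᵐ p ∂Q, recordChain p.1 p.2 n ∈ Set.Ioo (0 : ℝ) 1 := by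
      have h1 : ∀ᵐ p ∂Q, p.1 ∈ Set.Ioo (0 : ℝ) 1 :=
        Measure.quasiMeasurePreserving_fst.ae (ae_betaMeasure_mem_Ioo b a)
      have h2 : ∀ᵐ p ∂Q, ∀ i, p.2 i ∈ Set.Ioo (0 : ℝ) 1 :=
        Measure.quasiMeasurePreserving_snd.ae (ae_gapLaw_mem_Ioo ha)
      filter_upwards [h1, h2] with p hp1 hp2 using hmono _ _ hp1 hp2 n
    filter_upwards [hQ] with p hp
    have hFm : Measurable fun w : ℕ → ℝ => B.indicator (1 : β → ℝ≥0∞)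
        (Z (fun i => X i (p, w), fun j : Fin n => L j (p, w))) := hZm.comp measurable_prodMk_left
    -- With the points fixed, the marks before `n` use only the uniform variables before `n`, so the
    -- `n`-th one is fresh.
    have hfresh := lintegral_infinitePi_fresh uniformLaw hFm n (fun v w hvw => by
        have : (fun j : Fin n => L j (p, v)) = fun j : Fin n => L j (p, w) := by
          ext j
          simp only [L, X, hvw j j.2]
        rw [this])
      (ρ := fun c e => c * ({k} : Set ℕ+).indicator 1 (geomOfUniform (recordChain p.1 p.2 n) e))
      (measurable_fst.mul ((measurable_one.indicator (measurableSet_singleton k)).comp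
        (measurable_geomOfUniform.comp (measurable_const.prodMk measurable_snd))))
    refine Eq.trans ?_ (hfresh.trans ?_)
    · refine lintegral_congr fun w => ?_
      congr 1
    · refine lintegral_congr fun w => ?_
      refine (lintegral_const_mul _ ((measurable_one.indicator (measurableSet_singleton k)).comp
        (measurable_geomOfUniform.comp measurable_prodMk_left))).trans ?_
      exact congrArg _ (lintegral_geomOfUniform hp.1 hp.2 k)
  refine ⟨_, inferInstance, P, inferInstance, X, L, ⟨hX, hL, hmap0, ?_, fun k => ?_,
    fun n k _ => ?_⟩, ?_⟩
  -- By uniqueness of disintegration it is enough that the kernel reproduces the joint law of `X 0`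
  -- and the points.
  · have hcond : condDistrib (fun ω n => X n ω) (X 0) P =ᵐ[P.map (X 0)] recordKernel a ha := by
      refine condDistrib_ae_eq_of_measure_eq_compProd (X 0) hXp.aemeasurable ?_
      refine Measure.ext_of_lintegral _ fun F hF => ?_
      rw [lintegral_map hF ((hX 0).prodMk hXp), Measure.lintegral_compProd hF, hmap0]
      refine (lintegral_prod (μ := Q) (ν := U) _
        (hF.comp ((hX 0).prodMk hXp)).aemeasurable).trans ?_
      have hF2 : Measurable fun p : ℝ × (ℕ → ℝ) => F (p.1, recordChain p.1 p.2) :=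
        hF.comp (measurable_fst.prodMk (measurable_pi_iff.2 measurable_uncurry_recordChain))
      calc _ = ∫⁻ p, F (p.1, recordChain p.1 p.2) ∂Q := by
            refine lintegral_congr fun p => ?_
            change ∫⁻ _, F (p.1, recordChain p.1 p.2) ∂U = _
            simp
        _ = ∫⁻ x, ∫⁻ v, F (x, recordChain x v) ∂(gapLaw a) ∂(betaMeasure b a) :=
            lintegral_prod _ hF2.aemeasurable
        _ = _ := by
            refine lintegral_congr fun x => ?_
            exact (lintegral_recordChainLaw a x (hF.comp measurable_prodMk_left)).symm
    rw [hmap0] at hcond ⊢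
    filter_upwards [hcond, ae_betaMeasure_mem_Ioo b a] with x hx hx1
    rw [hx]
    exact isPoissonProcess_recordChainLaw ha hx1.2
  -- For `L 0` the conditioning is on the points only, which is the first projection in place of
  -- `Z`.
  · exact condExp_ae_eq_of_setLIntegral hXp (hL 0 (measurableSet_singleton k))
      (u := fun z => geomMark (z 0) k) ((measurable_geomMark k).comp (measurable_pi_apply 0))
      (by filter_upwards [hmem] with ω hω
          exact mul_nonneg (pow_nonneg (hω 0).1.le _) (sub_nonneg.2 (hω 0).2.le))
      (fun B hB => hmark 0 k Prod.fst measurable_fst B hB)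
  · exact condExp_ae_eq_of_setLIntegral
      (hXp.prodMk (measurable_pi_iff.2 fun j : Fin n => hL j)) (hL n (measurableSet_singleton k))
      (u := fun z => geomMark (z.1 n) k)
      ((measurable_geomMark k).comp ((measurable_pi_apply n).comp measurable_fst))
      (by filter_upwards [hmem] with ω hω
          exact mul_nonneg (pow_nonneg (hω n).1.le _) (sub_nonneg.2 (hω n).2.le))
      (fun B hB => hmark n k id measurable_id B hB)
  · filter_upwards [hgood] with ω hω i using recordChain_lt_succ hω.1.2 hω.2 (i + 1)

/-! ### The law of the points of an ordered model -/

section Model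

variable {Ω : Type*} [MeasurableSpace Ω] {P : Measure Ω} [IsProbabilityMeasure P]
  {X : ℕ → Ω → ℝ} {L : ℕ → Ω → ℕ+} {a b : ℝ}

/-- Given `X 0`, the points of the model and the chain are ordered lists of the same Poisson process
from the same start, so their laws coincide. -/
lemma IsCMPP.condDistrib_points (ha : 0 < a)
    (h : IsCMPP P (betaPDFReal b a) geomMark (recordIntensity a) geomMark X L)
    (hord : ∀ᵐ ω ∂P, ∀ i : ℕ, X (i + 1) ω < X (i + 2) ω) :
    ∀ᵐ x ∂(betaMeasure b a),
      condDistrib (fun ω i => X i ω) (X 0) P x = recordChainLaw a x := by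
  have hset : MeasurableSet {p : ℝ × (ℕ → ℝ) | p.2 0 = p.1 ∧ ∀ i, p.2 (i + 1) < p.2 (i + 2)} := by
    refine (measurableSet_eq_fun (by fun_prop) (by fun_prop)).inter ?_
    refine MeasurableSet.congr (s := ⋂ i, {p : ℝ × (ℕ → ℝ) | p.2 (i + 1) < p.2 (i + 2)}) ?_
      (by ext z; exact Set.mem_iInter)
    exact MeasurableSet.iInter fun i => measurableSet_lt (by fun_prop) (by fun_prop)
  have h1 := ae_condDistrib_of_ae (h.measurable_X 0) h.measurable_X_pi hset
    (by filter_upwards [hord] with ω hω using ⟨rfl, hω⟩)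
  have h2 := h.poisson
  rw [h.map_X_zero] at h1 h2
  filter_upwards [h1, h2, ae_betaMeasure_mem_Ioo b a] with x hx1 hx2 hx
  have := isProbabilityMeasure_recordChainLaw ha x
  refine hx2.map_eq_of_ordered (isPoissonProcess_recordChainLaw ha hx.2) hx1 ?_
  filter_upwards [ae_recordChainLaw ha hx.2] with z hz using ⟨hz.1, fun i => (hz.2 (i + 1)).1⟩

/-- The points of an ordered model have the law of the chain started from a beta variable. -/
lemma IsCMPP.lintegral_points (ha : 0 < a)
    (h : IsCMPP P (betaPDFReal b a) geomMark (recordIntensity a) geomMark X L)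
    (hord : ∀ᵐ ω ∂P, ∀ i : ℕ, X (i + 1) ω < X (i + 2) ω) {F : (ℕ → ℝ) → ℝ≥0∞}
    (hF : Measurable F) :
    ∫⁻ ω, F (fun i => X i ω) ∂P =
      ∫⁻ x, ∫⁻ v, F (recordChain x v) ∂(gapLaw a) ∂(betaMeasure b a) := by
  rw [lintegral_condDistrib_prod (h.measurable_X 0) h.measurable_X_pi (F := fun p => F p.2)
    (hF.comp measurable_snd), h.map_X_zero]
  refine lintegral_congr_ae ?_
  filter_upwards [h.condDistrib_points ha hord] with x hx
  rw [hx, lintegral_recordChainLaw a x hF]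

end Model

/-! ### Success and failure probabilities -/

/-- The probability that the `(m + 1)`-st entry of a `Bern(a, b)` sequence is `c`. -/
def bernMass (a b : ℝ) (m : ℕ) (c : Fin 2) : ℝ≥0∞ :=
  if c = 1 then ENNReal.ofReal (a / (a + b + m)) else ENNReal.ofReal ((b + m) / (a + b + m))

/-- A Bern(a, b) sequence from its `(m + 1)`-st entry on is Bern(a, b + m), matching the beta
parameter after partial sum `m`. -/
lemma bernMass_add (a b : ℝ) (m j : ℕ) (c : Fin 2) :
    bernMass a (b + m) j c = bernMass a b (m + j) c := by
  simp only [bernMass, Nat.cast_add]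
  rw [show a + (b + m) + (j : ℝ) = a + b + (m + j) by ring,
    show b + m + (j : ℝ) = b + (m + j) by ring]

lemma bernMass_add_bernMass {a b : ℝ} (ha : 0 < a) (hb : 0 ≤ b) (m : ℕ) :
    bernMass a b m 0 + bernMass a b m 1 = 1 := by
  have h : 0 < a + b + m := by positivity
  rw [bernMass, bernMass, if_neg (by decide), if_pos rfl,
    ← ENNReal.ofReal_add (by positivity) (by positivity), ← add_div,
    show b + m + a = a + b + (m : ℝ) by ring, div_self h.ne', ENNReal.ofReal_one]

/-- Size-biasing `m` times: each factor `x` raises the parameter `b` by one at the price of one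
failure probability. -/
lemma lintegral_ofReal_pow_mul_betaMeasure {a b : ℝ} (hb : 0 < b) (ha : 0 < a) (m : ℕ)
    {φ : ℝ → ℝ≥0∞} (hφ : Measurable φ) :
    ∫⁻ x, ENNReal.ofReal (x ^ m) * φ x ∂(betaMeasure b a) =
      (∏ j ∈ Finset.range m, bernMass a b j 0) * ∫⁻ x, φ x ∂(betaMeasure (b + m) a) := by
  induction m generalizing φ with
  | zero => simp
  | succ m ih =>
    have h1 : ∫⁻ x, ENNReal.ofReal (x ^ (m + 1)) * φ x ∂(betaMeasure b a) =
        ∫⁻ x, ENNReal.ofReal (x ^ m) * (ENNReal.ofReal x * φ x) ∂(betaMeasure b a) := by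
      refine lintegral_congr_ae ?_
      filter_upwards [ae_betaMeasure_mem_Ioo b a] with x hx
      rw [pow_succ, ENNReal.ofReal_mul (pow_nonneg hx.1.le _), mul_assoc]
    rw [h1, ih (by fun_prop), lintegral_ofReal_mul_betaMeasure (by positivity) ha hφ,
      Finset.prod_range_succ, mul_assoc, bernMass, if_neg (by decide), Nat.cast_add, Nat.cast_one,
      add_assoc a b, add_assoc b]

lemma lintegral_Ioo_rpow {b y : ℝ} (hb : 0 < b) (hy : 0 < y) :
    ∫⁻ x in Set.Ioo 0 y, ENNReal.ofReal (x ^ (b - 1)) = ENNReal.ofReal (y ^ b / b) := by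
  have hint : IntervalIntegrable (fun x : ℝ => x ^ (b - 1)) volume 0 y :=
    intervalIntegral.intervalIntegrable_rpow' (by linarith)
  rw [Measure.restrict_congr_set Ioo_ae_eq_Ioc, ← ofReal_integral_eq_lintegral_ofReal, ←
    intervalIntegral.integral_of_le hy.le, integral_rpow (Or.inl (by linarith))]
  · rw [sub_add_cancel, Real.zero_rpow hb.ne', sub_zero]
  · exact (intervalIntegrable_iff_integrableOn_Ioc_of_le hy.le).1 hint
  · filter_upwards [ae_restrict_mem measurableSet_Ioc] with x hx using Real.rpow_nonneg hx.1.le _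

/-- The powers of `1 - x` cancel and leave the joint density `x ^ (b - 1) * a * (1 - y) ^ (a - 1) /
B(b, a)` on `0 < x < y < 1` (times `φ y`, this is `K`). Integrating out `x` gives `y ^ b / b`, a
multiple of the Beta(b + 1, a) density. -/
lemma lintegral_one_sub_mul_step_betaMeasure {a b : ℝ} (hb : 0 < b) (ha : 0 < a)
    {φ : ℝ → ℝ≥0∞} (hφ : Measurable φ) :
    ∫⁻ x, ENNReal.ofReal (1 - x) * (∫⁻ e, φ (1 - (1 - x) * e) ∂(betaMeasure a 1))
        ∂(betaMeasure b a) =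
      ENNReal.ofReal (a / (a + b)) * ∫⁻ x, φ x ∂(betaMeasure (b + 1) a) := by
  have := isProbabilityMeasureBeta ha one_pos
  have hB := beta_pos hb ha
  let K : ℝ → ℝ → ℝ≥0∞ := fun x y => if 0 < x ∧ x < y ∧ y < 1 then
    ENNReal.ofReal (x ^ (b - 1)) * (ENNReal.ofReal (a * (1 - y) ^ (a - 1) / beta b a) * φ y) else 0
  have hK : Measurable (Function.uncurry K) := by
    refine Measurable.ite ?_ ?_ measurable_const
    · exact (measurableSet_lt measurable_const measurable_fst).inter
        ((measurableSet_lt measurable_fst measurable_snd).inter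
          (measurableSet_lt measurable_snd measurable_const))
    · fun_prop
  have hleft : ∫⁻ x, ENNReal.ofReal (1 - x) * (∫⁻ e, φ (1 - (1 - x) * e) ∂(betaMeasure a 1))
      ∂(betaMeasure b a) = ∫⁻ x, ∫⁻ y, K x y := by
    rw [lintegral_betaMeasure b a ?_, ← lintegral_indicator measurableSet_Ioo]
    · refine lintegral_congr fun x => ?_
      by_cases hx : x ∈ Set.Ioo (0 : ℝ) 1
      · have h1x : 0 < 1 - x := sub_pos.2 hx.2
        have hx0 := hx.1
        rw [Set.indicator_of_mem hx, lintegral_step ha hx.2 hφ, ← mul_assoc,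
          ← ENNReal.ofReal_mul (by positivity), ← lintegral_const_mul _ (by fun_prop),
          ← lintegral_indicator measurableSet_Ioo]
        refine lintegral_congr fun y => ?_
        by_cases hy : y ∈ Set.Ioo x 1
        · have h1y : 0 < 1 - y := sub_pos.2 hy.2
          rw [Set.indicator_of_mem hy]
          simp only [K]
          rw [if_pos ⟨hx.1, hy⟩, ← mul_assoc, ← mul_assoc, ← ENNReal.ofReal_mul (by positivity),
            ← ENNReal.ofReal_mul (by positivity), stepDensity, Real.rpow_sub_one h1x.ne' a]
          congr 2
          have := (Real.rpow_pos_of_pos h1x a).ne'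
          field_simp
        · rw [Set.indicator_of_notMem hy]
          simp only [K]
          rw [if_neg fun h => hy h.2]
      · rw [Set.indicator_of_notMem hx]
        refine (lintegral_eq_zero_of_ae_eq_zero (Eventually.of_forall fun y => ?_)).symm
        exact if_neg fun h => hx ⟨h.1, h.2.1.trans h.2.2⟩
    · have : Measurable fun x => ∫⁻ e, φ (1 - (1 - x) * e) ∂(betaMeasure a 1) :=
        Measurable.lintegral_prod_right' (f := fun p : ℝ × ℝ => φ (1 - (1 - p.1) * p.2))
          (by fun_prop)
      fun_prop
  rw [hleft, lintegral_lintegral_swap hK.aemeasurable, lintegral_betaMeasure _ _ hφ,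
    ← lintegral_const_mul _ (by fun_prop), ← lintegral_indicator measurableSet_Ioo]
  refine lintegral_congr fun y => ?_
  by_cases hy : y ∈ Set.Ioo (0 : ℝ) 1
  · have h1y : 0 < 1 - y := sub_pos.2 hy.2
    have hy0 := hy.1
    have hin : ∀ x, K x y = (Set.Ioo 0 y).indicator (fun x => ENNReal.ofReal (x ^ (b - 1)) *
        (ENNReal.ofReal (a * (1 - y) ^ (a - 1) / beta b a) * φ y)) x := fun x => by
      by_cases hx : x ∈ Set.Ioo 0 y
      · rw [Set.indicator_of_mem hx]
        exact if_pos ⟨hx.1, hx.2, hy.2⟩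
      · rw [Set.indicator_of_notMem hx]
        exact if_neg fun h => hx ⟨h.1, h.2.1⟩
    simp_rw [hin]
    rw [Set.indicator_of_mem hy, lintegral_indicator measurableSet_Ioo,
      lintegral_mul_const _ (by fun_prop), lintegral_Ioo_rpow hb hy.1, ← mul_assoc, ← mul_assoc,
      ← ENNReal.ofReal_mul (by positivity), ← ENNReal.ofReal_mul (by positivity)]
    congr 2
    rw [beta_succ_left hb ha, add_sub_cancel_right]
    field_simp
  · rw [Set.indicator_of_notMem hy]
    refine lintegral_eq_zero_of_ae_eq_zero (Eventually.of_forall fun x => ?_)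
    exact if_neg fun h => hy ⟨h.1.trans h.2.1, h.2.2⟩

/-- Conjugacy: the factor `x ^ (k - 1)` accounts for `k - 1` failures, and `1 - x` together with the
step for the success. The beta family is preserved, so the computation can be iterated along the
chain. -/
lemma lintegral_geomMark_mul_step_betaMeasure {a b : ℝ} (hb : 0 < b) (ha : 0 < a) (k : ℕ+)
    {φ : ℝ → ℝ≥0∞} (hφ : Measurable φ) :
    ∫⁻ x, ENNReal.ofReal (geomMark x k) * (∫⁻ e, φ (1 - (1 - x) * e) ∂(betaMeasure a 1))
        ∂(betaMeasure b a) =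
      (∏ j ∈ Finset.range k.natPred, bernMass a b j 0) * bernMass a b k.natPred 1 *
        ∫⁻ x, φ x ∂(betaMeasure (b + k) a) := by
  have := isProbabilityMeasureBeta ha one_pos
  have hstep : Measurable fun x => ∫⁻ e, φ (1 - (1 - x) * e) ∂(betaMeasure a 1) :=
    Measurable.lintegral_prod_right' (f := fun p : ℝ × ℝ => φ (1 - (1 - p.1) * p.2))
      (by fun_prop)
  have h1 : ∫⁻ x, ENNReal.ofReal (geomMark x k) *
      (∫⁻ e, φ (1 - (1 - x) * e) ∂(betaMeasure a 1)) ∂(betaMeasure b a) =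
      ∫⁻ x, ENNReal.ofReal (x ^ k.natPred) * (ENNReal.ofReal (1 - x) *
        (∫⁻ e, φ (1 - (1 - x) * e) ∂(betaMeasure a 1))) ∂(betaMeasure b a) := by
    refine lintegral_congr_ae ?_
    filter_upwards [ae_betaMeasure_mem_Ioo b a] with x hx
    rw [geomMark, ENNReal.ofReal_mul (pow_nonneg hx.1.le _), mul_assoc]
    rfl
  have hk : ((k : ℕ) : ℝ) = k.natPred + 1 := by
    exact_mod_cast (k.natPred_add_one).symm
  rw [h1, lintegral_ofReal_pow_mul_betaMeasure hb ha _ (by fun_prop),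
    lintegral_one_sub_mul_step_betaMeasure (by positivity) ha hφ, bernMass, if_pos rfl, hk,
    mul_assoc, ← add_assoc a, ← add_assoc b]

/-! ### Sequences generated by marks -/

lemma coe_markSum (l : ℕ → ℕ+) (r : ℕ) :
    (markSum l r : ℕ) = ∑ i ∈ Finset.range (r + 1), (l i : ℕ) := by
  induction r with
  | zero => simp [markSum]
  | succ r ih => rw [markSum, PNat.add_coe, ih, Finset.sum_range_succ _ (r + 1)]

lemma strictMono_sum_range (l : ℕ → ℕ+) :
    StrictMono fun r => ∑ i ∈ Finset.range r, (l i : ℕ) :=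
  strictMono_nat_of_lt_succ fun r => by
    rw [Finset.sum_range_succ]
    exact Nat.lt_add_of_pos_right (l r).pos

lemma bernoulliOfMarks_succPNat_eq_one_iff (l : ℕ → ℕ+) (m : ℕ) :
    bernoulliOfMarks l m.succPNat = 1 ↔
      ∃ r, m + 1 = ∑ i ∈ Finset.range (r + 1), (l i : ℕ) := by
  rw [bernoulliOfMarks_eq_one_iff]
  refine exists_congr fun r => ?_
  rw [← coe_markSum, ← PNat.coe_inj, Nat.succPNat_coe]

/-- The mark `l r` adds a block of `l r - 1` zeros and a one, and the preceding partial sum shifts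
`b`. -/
lemma prod_bernMass_bernoulliOfMarks (a b : ℝ) (l : ℕ → ℕ+) (r : ℕ) :
    ∏ m ∈ Finset.range (∑ i ∈ Finset.range (r + 1), (l i : ℕ)),
        bernMass a b m (bernoulliOfMarks l m.succPNat) =
      (∏ m ∈ Finset.range (∑ i ∈ Finset.range r, (l i : ℕ)),
        bernMass a b m (bernoulliOfMarks l m.succPNat)) *
      ((∏ j ∈ Finset.range (l r).natPred, bernMass a (b + ∑ i ∈ Finset.range r, (l i : ℕ)) j 0) *
        bernMass a (b + ∑ i ∈ Finset.range r, (l i : ℕ)) (l r).natPred 1) := by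
  have hsum : ∑ i ∈ Finset.range (r + 1), (l i : ℕ) =
      ∑ i ∈ Finset.range r, (l i : ℕ) + (l r).natPred + 1 := by
    rw [Finset.sum_range_succ, add_assoc, PNat.natPred_add_one]
  have hone : bernoulliOfMarks l (∑ i ∈ Finset.range r, (l i : ℕ) + (l r).natPred).succPNat = 1 :=
    (bernoulliOfMarks_succPNat_eq_one_iff l _).2 ⟨r, hsum.symm⟩
  rw [hsum, Finset.prod_range_succ, Finset.prod_range_add, hone, mul_assoc]
  simp_rw [bernMass_add]
  congr 2
  refine Finset.prod_congr rfl fun j hj => ?_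
  have hzero : bernoulliOfMarks l (∑ i ∈ Finset.range r, (l i : ℕ) + j).succPNat ≠ 1 := by
    rw [Ne, bernoulliOfMarks_succPNat_eq_one_iff]
    rintro ⟨s, hs⟩
    have hj := Finset.mem_range.1 hj
    have h1 : r < s + 1 := (strictMono_sum_range l).lt_iff_lt.1 (by omega)
    have h2 : s + 1 < r + 1 := (strictMono_sum_range l).lt_iff_lt.1 (by omega)
    omega
  rw [show bernoulliOfMarks l (∑ i ∈ Finset.range r, (l i : ℕ) + j).succPNat = 0 by omega]

/-! ### Initial segments of generated sequences -/

lemma markSum_congr {l l' : ℕ → ℕ+} {r : ℕ} (h : ∀ i ≤ r, l' i = l i) :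
    markSum l' r = markSum l r := by
  induction r with
  | zero => exact h 0 le_rfl
  | succ r ih => rw [markSum, markSum, ih fun i hi => h i (by omega), h _ le_rfl]

lemma bernoulliOfMarks_congr {l l' : ℕ → ℕ+} {r : ℕ} (h : ∀ i ≤ r, l' i = l i) {m : ℕ+}
    (hm : m ≤ markSum l r) : bernoulliOfMarks l' m = bernoulliOfMarks l m := by
  have hone : bernoulliOfMarks l' m = 1 ↔ bernoulliOfMarks l m = 1 := by
    rw [bernoulliOfMarks_eq_one_iff, bernoulliOfMarks_eq_one_iff]
    constructor
    · rintro ⟨j, hj⟩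
      have hjr : j ≤ r := (markSum_strictMono l').le_iff_le.1 (by
        rw [← hj, markSum_congr h]; exact hm)
      exact ⟨j, hj.trans (markSum_congr fun i hi => h i (hi.trans hjr))⟩
    · rintro ⟨j, hj⟩
      have hjr : j ≤ r := (markSum_strictMono l).le_iff_le.1 (hj ▸ hm)
      exact ⟨j, hj.trans (markSum_congr fun i hi => h i (hi.trans hjr)).symm⟩
  omega

/-- The positions of the ones up to `markSum l r` are the partial sums up to `r`, and their
differences are the marks; so a cylinder ending in a one is an event about finitely many marks. -/
lemma bernoulliOfMarks_agree_iff (l l' : ℕ → ℕ+) (r : ℕ) :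
    (∀ m ≤ markSum l r, bernoulliOfMarks l' m = bernoulliOfMarks l m) ↔ ∀ i ≤ r, l' i = l i := by
  refine ⟨fun h => ?_, fun h m hm => bernoulliOfMarks_congr h hm⟩
  -- The `i`-th one of either sequence is a one of the other, of index at least `i` since the
  -- earlier ones are already matched. This gives both inequalities.
  have hsum : ∀ i ≤ r, markSum l' i = markSum l i := by
    intro i
    induction i using Nat.strong_induction_on with
    | _ i ih =>
      intro hi
      have hle : markSum l i ≤ markSum l r := (markSum_strictMono l).monotone hi
      obtain ⟨j, hj⟩ := (bernoulliOfMarks_eq_one_iff l' _).1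
        ((h _ hle).trans ((bernoulliOfMarks_eq_one_iff l _).2 ⟨i, rfl⟩))
      have hij : i ≤ j := by
        by_contra! hlt
        rw [ih j hlt (hlt.le.trans hi)] at hj
        exact hlt.ne' ((markSum_strictMono l).injective hj)
      have hle' : markSum l' i ≤ markSum l i := hj ▸ (markSum_strictMono l').monotone hij
      obtain ⟨j', hj'⟩ := (bernoulliOfMarks_eq_one_iff l _).1
        ((h _ (hle'.trans hle)).symm.trans ((bernoulliOfMarks_eq_one_iff l' _).2 ⟨i, rfl⟩))
      have hij' : i ≤ j' := by
        by_contra! hlt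
        rw [← ih j' hlt (hlt.le.trans hi)] at hj'
        exact hlt.ne' ((markSum_strictMono l').injective hj')
      exact le_antisymm hle' (hj' ▸ (markSum_strictMono l).monotone hij')
  intro i hi
  cases i with
  | zero => exact hsum 0 hi
  | succ i =>
    have h1 := hsum (i + 1) hi
    rw [markSum, markSum, hsum i (by omega)] at h1
    exact add_left_cancel h1

/-- Induction on the position of the last one: the marks for the previous one at `m` are extended by
`n - m`. Marks past index `r` are irrelevant. -/
lemma exists_bernoulliOfMarks_agree (y : ℕ+ → Fin 2) (n : ℕ+) (hn : y n = 1) :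
    ∃ (l : ℕ → ℕ+) (r : ℕ), markSum l r = n ∧ ∀ m ≤ n, bernoulliOfMarks l m = y m := by
  induction n using PNat.strongInductionOn with
  | _ n ih =>
    by_cases hex : ∃ m : ℕ+, m < n ∧ y m = 1
    · obtain ⟨m, ⟨hmn, hm⟩, hmax⟩ : ∃ m : ℕ+, (m < n ∧ y m = 1) ∧
          ∀ m', m' < n ∧ y m' = 1 → m' ≤ m := by
        have hfin : {m : ℕ+ | m < n ∧ y m = 1}.Finite := (Set.finite_Iio n).subset fun m hm => hm.1
        obtain ⟨m, hm, hmax⟩ := hfin.exists_maximal hex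
        exact ⟨m, hm, fun m' hm' => (le_total m' m).elim id (hmax hm')⟩
      obtain ⟨l, r, hr, hl⟩ := ih m hmn hm
      obtain ⟨l', hcongr, hlast⟩ : ∃ l' : ℕ → ℕ+, (∀ i ≤ r, l' i = l i) ∧ l' (r + 1) = n - m :=
        ⟨Function.update l (r + 1) (n - m), fun i hi => Function.update_of_ne (by omega) _ _,
          Function.update_self _ _ _⟩
      have hsr : markSum l' r = m := (markSum_congr hcongr).trans hr
      have hsum : markSum l' (r + 1) = n := by
        rw [markSum, hsr, hlast, PNat.add_sub_of_lt hmn]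
      refine ⟨l', r + 1, hsum, fun k hk => ?_⟩
      rcases le_or_gt k m with hkm | hkm
      · rw [bernoulliOfMarks_congr hcongr (hr.symm ▸ hkm), hl k hkm]
      · rcases hk.eq_or_lt with rfl | hkn
        · rw [hn, bernoulliOfMarks_eq_one_iff]
          exact ⟨_, hsum.symm⟩
        · have h0 : y k = 0 := by
            by_contra hne
            exact hkm.not_ge (hmax k ⟨hkn, by omega⟩)
          rw [h0, bernoulliOfMarks_eq_zero_iff]
          rintro ⟨j, rfl⟩
          rw [← hsr] at hkm
          rw [← hsum] at hkn
          have h1 := (markSum_strictMono l').lt_iff_lt.1 hkm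
          have h2 := (markSum_strictMono l').lt_iff_lt.1 hkn
          omega
    · push Not at hex
      refine ⟨fun _ => n, 0, rfl, fun k hk => ?_⟩
      rcases hk.eq_or_lt with rfl | hkn
      · rw [hn, bernoulliOfMarks_eq_one_iff]
        exact ⟨0, rfl⟩
      · have h0 : y k = 0 := by
          have := hex k hkn
          omega
        rw [h0, bernoulliOfMarks_eq_zero_iff]
        rintro ⟨j, rfl⟩
        exact hkn.not_ge ((markSum_strictMono fun _ => n).monotone (Nat.zero_le j))

/-! ### Laws of `{0,1}`-valued sequences -/

/-- The sequences that agree with `z` up to time `N`. -/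
def cylinderSet (N : ℕ) (z : ℕ+ → Fin 2) : Set (ℕ+ → Fin 2) :=
  {y | ∀ n : ℕ+, (n : ℕ) ≤ N → y n = z n}

lemma cylinderSet_eq_of_mem {N : ℕ} {y z : ℕ+ → Fin 2} (h : y ∈ cylinderSet N z) :
    cylinderSet N z = cylinderSet N y := by
  ext w
  exact ⟨fun hw n hn => (hw n hn).trans (h n hn).symm, fun hw n hn => (hw n hn).trans (h n hn)⟩

lemma measurableSet_cylinderSet (N : ℕ) (z : ℕ+ → Fin 2) : MeasurableSet (cylinderSet N z) := by
  refine MeasurableSet.congr (s := ⋂ n : ℕ+, {y | (n : ℕ) ≤ N → y n = z n}) ?_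
    (by ext w; exact Set.mem_iInter)
  refine MeasurableSet.iInter fun n => ?_
  by_cases hn : (n : ℕ) ≤ N
  · simp only [hn, forall_const]
    exact measurableSet_eq_fun (measurable_pi_apply n) measurable_const
  · simp [hn]

lemma cylinderSet_anti {N N' : ℕ} (h : N ≤ N') (z : ℕ+ → Fin 2) : cylinderSet N' z ⊆ cylinderSet N z :=
  fun _ hy n hn => hy n (hn.trans h)

/-- The law of a `{0,1}`-valued sequence is determined by its initial segments that end in `1`. -/
lemma Measure.ext_of_cylinderSet {μ ν : Measure (ℕ+ → Fin 2)} [IsProbabilityMeasure μ]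
    [IsProbabilityMeasure ν]
    (h : ∀ (n : ℕ+) (z : ℕ+ → Fin 2), z n = 1 → μ (cylinderSet n z) = ν (cylinderSet n z)) :
    μ = ν := by
  have hall : ∀ N z, μ (cylinderSet N z) = ν (cylinderSet N z) := by
    intro N
    induction N with
    | zero =>
      intro z
      have : cylinderSet 0 z = Set.univ := Set.eq_univ_of_forall fun y n hn =>
        absurd n.pos (by omega)
      rw [this, measure_univ, measure_univ]
    | succ N ih =>
      intro z
      by_cases hz : z N.succPNat = 1
      · exact h N.succPNat z hz
      -- A word ending in `0` is its prefix minus the same prefix followed by `1`, so its measure is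
      -- a difference of known ones.
      · have hone := h N.succPNat (Function.update z N.succPNat 1) (Function.update_self _ _ _)
        rw [Nat.succPNat_coe] at hone
        have hmem : ∀ n : ℕ+, (n : ℕ) ≤ N → Function.update z N.succPNat 1 n = z n := fun n hn =>
          Function.update_of_ne (fun he => by rw [he, Nat.succPNat_coe] at hn; omega) _ _
        have hdiff : cylinderSet (N + 1) z =
            cylinderSet N z \ cylinderSet (N + 1) (Function.update z N.succPNat 1) := by
          ext y
          refine ⟨fun hy => ⟨cylinderSet_anti N.le_succ z hy, fun hy' => ?_⟩,
            fun ⟨hy, hy'⟩ n hn => ?_⟩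
          · have h1 := hy N.succPNat (by simp)
            have h2 := hy' N.succPNat (by simp)
            rw [Function.update_self] at h2
            exact hz (h1.symm.trans h2)
          · rcases Nat.lt_or_ge N n with hlt | hle
            · obtain rfl : n = N.succPNat := PNat.eq (by simp; omega)
              by_contra hne
              refine hy' fun k hk => ?_
              rcases Nat.lt_or_ge N k with hlt' | hle'
              · obtain rfl : k = N.succPNat := PNat.eq (by simp; omega)
                rw [Function.update_self]
                omega
              · rw [hmem k hle', hy k hle']
            · exact hy n hle
        have hsub : cylinderSet (N + 1) (Function.update z N.succPNat 1) ⊆ cylinderSet N z :=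
          fun y hy n hn => (hy n (by omega)).trans (hmem n hn)
        rw [hdiff, measure_sdiff hsub (measurableSet_cylinderSet _ _).nullMeasurableSet
          (measure_ne_top _ _), measure_sdiff hsub (measurableSet_cylinderSet _ _).nullMeasurableSet
          (measure_ne_top _ _), ih z, hone]
  refine ext_of_generate_finite {S | ∃ N z, S = cylinderSet N z} ?_ ?_ ?_ (by simp)
  · refine le_antisymm ?_ (MeasurableSpace.generateFrom_le ?_)
    · refine iSup_le fun n => ?_
      rintro _ ⟨T, -, rfl⟩
      -- An event about the `n`-th entry is the union of the cylinders over the words of length `n`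
      -- whose last letter lies in `T`.
      have hT : (fun y : ℕ+ → Fin 2 => y n) ⁻¹' T =
          ⋃ u : {u : {m : ℕ+ // m ≤ n} → Fin 2 // u ⟨n, le_refl n⟩ ∈ T},
            cylinderSet n fun m => if hm : m ≤ n then u.1 ⟨m, hm⟩ else 0 := by
        ext y
        rw [Set.mem_iUnion]
        constructor
        · intro hy
          refine ⟨⟨fun m => y m, hy⟩, fun m hm => ?_⟩
          have hm' : m ≤ n := hm
          simp [hm']
        · rintro ⟨u, hu⟩
          have : y n = u.1 ⟨n, le_refl n⟩ := (hu n le_rfl).trans (dif_pos (le_refl n))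
          change y n ∈ T
          rw [this]
          exact u.2
      rw [hT]
      exact MeasurableSet.iUnion fun u => MeasurableSpace.measurableSet_generateFrom ⟨_, _, rfl⟩
    · rintro _ ⟨N, z, rfl⟩
      exact measurableSet_cylinderSet N z
  · rintro _ ⟨N, z, rfl⟩ _ ⟨N', z', rfl⟩ ⟨w, hw, hw'⟩
    refine ⟨max N N', w, ?_⟩
    rw [cylinderSet_eq_of_mem hw, cylinderSet_eq_of_mem hw']
    ext y
    refine ⟨fun hy n hn => (le_max_iff.1 hn).elim (hy.1 n) (hy.2 n), fun hy => ⟨?_, ?_⟩⟩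
    · exact cylinderSet_anti (le_max_left _ _) w hy
    · exact cylinderSet_anti (le_max_right _ _) w hy
  · rintro _ ⟨N, z, rfl⟩
    exact hall N z

/-! ### Bernoulli sequences as product laws -/

/-- The law of the `n`-th entry of a `Bern(a, b)` sequence. -/
def bernLaw (a b : ℝ) (n : ℕ+) : Measure (Fin 2) :=
  bernMass a b n.natPred 0 • Measure.dirac 0 + bernMass a b n.natPred 1 • Measure.dirac 1

lemma isProbabilityMeasure_bernLaw {a b : ℝ} (ha : 0 < a) (hb : 0 ≤ b) (n : ℕ+) :
    IsProbabilityMeasure (bernLaw a b n) :=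
  ⟨by simpa [bernLaw] using bernMass_add_bernMass ha hb n.natPred⟩

lemma bernLaw_singleton (a b : ℝ) (n : ℕ+) (c : Fin 2) :
    bernLaw a b n {c} = bernMass a b n.natPred c := by
  fin_cases c <;> simp [bernLaw]

lemma bernMass_natPred_one (a b : ℝ) (n : ℕ+) :
    bernMass a b n.natPred 1 = ENNReal.ofReal (a / (a + b + (n : ℝ) - 1)) := by
  have h : ((n : ℕ) : ℝ) = n.natPred + 1 := by exact_mod_cast (n.natPred_add_one).symm
  rw [bernMass, if_pos rfl, h, ← add_assoc, add_sub_cancel_right]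

lemma eq_bernLaw {a b : ℝ} (ha : 0 < a) (hb : 0 ≤ b) (n : ℕ+) {μ : Measure (Fin 2)}
    [IsProbabilityMeasure μ] (h : μ {1} = bernMass a b n.natPred 1) : μ = bernLaw a b n := by
  have := isProbabilityMeasure_bernLaw ha hb n
  have h1 : μ {1} = bernLaw a b n {1} := by rw [h, bernLaw_singleton]
  refine Measure.ext_of_singleton fun c => ?_
  fin_cases c
  · have hc : ({0} : Set (Fin 2)) = {1}ᶜ := by
      ext c
      simp only [Set.mem_singleton_iff, Set.mem_compl_iff]
      omega
    change μ {0} = bernLaw a b n {0}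
    rw [hc, prob_compl_eq_one_sub (measurableSet_singleton _),
      prob_compl_eq_one_sub (measurableSet_singleton _), h1]
  · exact h1

lemma isBern_iff_map_eq {Ω : Type*} [MeasurableSpace Ω] {P : Measure Ω} [IsProbabilityMeasure P]
    {a b : ℝ} (ha : 0 < a) (hb : 0 ≤ b) {Y : ℕ+ → Ω → Fin 2} (hY : ∀ n, Measurable (Y n)) :
    IsBern P a b Y ↔ P.map (fun ω n => Y n ω) = Measure.infinitePi (bernLaw a b) := by
  have := isProbabilityMeasure_bernLaw ha hb
  have hprob : ∀ n, P {ω | Y n ω = 1} = P.map (Y n) {1} := fun n => by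
    rw [Measure.map_apply (hY n) (measurableSet_singleton _)]
    rfl
  constructor
  · intro h
    rw [(iIndepFun_iff_map_fun_eq_infinitePi_map hY).1 h.indep]
    congr 1
    funext n
    have := Measure.isProbabilityMeasure_map (μ := P) (hY n).aemeasurable
    refine eq_bernLaw ha hb n ?_
    rw [← hprob, h.prob_eq_one, bernMass_natPred_one]
  · intro h
    have hn : ∀ n, P.map (Y n) = bernLaw a b n := fun n => by
      rw [← Measure.infinitePi_map_eval (bernLaw a b) n, ← h,
        Measure.map_map (measurable_pi_apply n) (measurable_pi_iff.2 hY)]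
      rfl
    refine ⟨hY, ?_, fun n => ?_⟩
    · rw [iIndepFun_iff_map_fun_eq_infinitePi_map hY, h]
      congr 1
      funext n
      exact (hn n).symm
    · rw [hprob, hn, bernLaw_singleton, bernMass_natPred_one]

lemma infinitePi_bernLaw_cylinderSet {a b : ℝ} (ha : 0 < a) (hb : 0 ≤ b) (N : ℕ)
    (z : ℕ+ → Fin 2) :
    Measure.infinitePi (bernLaw a b) (cylinderSet N z) =
      ∏ m ∈ Finset.range N, bernMass a b m (z m.succPNat) := by
  have := isProbabilityMeasure_bernLaw ha hb
  have hset : cylinderSet N z = Set.pi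
      ((Finset.range N).map ⟨Nat.succPNat, Nat.succPNat_injective⟩ : Finset ℕ+) fun n => {z n} := by
    ext y
    simp only [cylinderSet, Set.mem_ofPred_eq, Set.mem_pi, Finset.coe_map, Set.mem_image,
      Finset.mem_coe, Finset.mem_range, Function.Embedding.coeFn_mk, Set.mem_singleton_iff]
    constructor
    · rintro h _ ⟨m, hm, rfl⟩
      exact h _ (by rw [Nat.succPNat_coe]; omega)
    · intro h n hn
      exact h n ⟨n.natPred, by have := n.natPred_add_one; omega, PNat.succPNat_natPred n⟩
  rw [hset, Measure.infinitePi_pi _ fun _ _ => measurableSet_singleton _, Finset.prod_map]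
  refine Finset.prod_congr rfl fun m _ => ?_
  rw [bernLaw_singleton]
  simp

/-! ### The generated sequence of an ordered model -/

/-- Iterated conjugacy: given the marks before `r`, the point `X r` has law Beta(b + S, a), with `S`
their sum. The test function `φ` carries this law through the induction. -/
lemma lintegral_prod_geomMark_recordChain {a b : ℝ} (hb : 0 < b) (ha : 0 < a) (l : ℕ → ℕ+) (r : ℕ)
    {φ : ℝ → ℝ≥0∞} (hφ : Measurable φ) :
    ∫⁻ x, ∫⁻ v, (∏ i ∈ Finset.range r, ENNReal.ofReal (geomMark (recordChain x v i) (l i))) *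
        φ (recordChain x v r) ∂(gapLaw a) ∂(betaMeasure b a) =
      (∏ m ∈ Finset.range (∑ i ∈ Finset.range r, (l i : ℕ)),
        bernMass a b m (bernoulliOfMarks l m.succPNat)) *
      ∫⁻ x, φ x ∂(betaMeasure (b + (∑ i ∈ Finset.range r, (l i : ℕ) : ℕ)) a) := by
  have := isProbabilityMeasure_gapLaw ha
  have := isProbabilityMeasureBeta ha one_pos
  induction r generalizing φ with
  | zero => simp [recordChain]
  | succ r ih =>
    have hg := fun k => measurable_geomMark k
    have hstep : Measurable fun x => ∫⁻ e, φ (1 - (1 - x) * e) ∂(betaMeasure a 1) :=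
      Measurable.lintegral_prod_right' (f := fun p : ℝ × ℝ => φ (1 - (1 - p.1) * p.2))
        (by fun_prop)
    have hinner : ∀ x, ∫⁻ v, (∏ i ∈ Finset.range (r + 1),
        ENNReal.ofReal (geomMark (recordChain x v i) (l i))) * φ (recordChain x v (r + 1))
          ∂(gapLaw a) =
        ∫⁻ v, (∏ i ∈ Finset.range r, ENNReal.ofReal (geomMark (recordChain x v i) (l i))) *
          (ENNReal.ofReal (geomMark (recordChain x v r) (l r)) *
            ∫⁻ e, φ (1 - (1 - recordChain x v r) * e) ∂(betaMeasure a 1)) ∂(gapLaw a) := by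
      intro x
      refine (lintegral_mul_recordChain_succ ha (n := r)
        (Finset.measurable_prod _ fun i _ => ((hg (l i)).comp
          (measurable_recordChain x i)).ennreal_ofReal) (fun v w hvw => ?_) hφ).trans ?_
      · refine Finset.prod_congr rfl fun i hi => ?_
        rw [Finset.mem_range] at hi
        simp only [Function.comp]
        rw [recordChain_congr x fun j hj => hvw j (by omega)]
      · refine lintegral_congr fun v => ?_
        rw [Finset.prod_range_succ, mul_assoc]
        rfl
    simp_rw [hinner]
    rw [ih (φ := fun y => ENNReal.ofReal (geomMark y (l r)) *
      ∫⁻ e, φ (1 - (1 - y) * e) ∂(betaMeasure a 1)) ((hg (l r)).ennreal_ofReal.mul hstep),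
      lintegral_geomMark_mul_step_betaMeasure (by positivity) ha (l r) hφ,
      prod_bernMass_bernoulliOfMarks, Finset.sum_range_succ, Nat.cast_add, ← add_assoc, mul_assoc,
      mul_assoc, mul_assoc]

lemma geomMean_indicator_singleton (k : ℕ+) (x : ℝ) :
    geomMean (({k} : Set ℕ+).indicator 1) x = ENNReal.ofReal (geomMark x k) := by
  rw [geomMean, tsum_eq_single k fun j hj => by simp [hj]]
  simp

section Model

variable {Ω : Type*} [MeasurableSpace Ω] {P : Measure Ω} [IsProbabilityMeasure P]
  {X : ℕ → Ω → ℝ} {L : ℕ → Ω → ℕ+} {a b : ℝ}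

/-- With the marks integrated out, the event becomes a product of geometric masses along the points,
whose law is that of the chain because they are ordered. -/
lemma IsCMPP.measure_marks_eq (hb : 0 < b) (ha : 0 < a)
    (h : IsCMPP P (betaPDFReal b a) geomMark (recordIntensity a) geomMark X L)
    (hord : ∀ᵐ ω ∂P, ∀ i : ℕ, X (i + 1) ω < X (i + 2) ω) (l : ℕ → ℕ+) (r : ℕ) :
    P {ω | ∀ i ≤ r, L i ω = l i} =
      ∏ m ∈ Finset.range (markSum l r), bernMass a b m (bernoulliOfMarks l m.succPNat) := by
  have hset : MeasurableSet {ω | ∀ i ≤ r, L i ω = l i} := by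
    refine MeasurableSet.congr (s := ⋂ i ∈ Set.Iic r, {ω | L i ω = l i}) ?_ (by ext; simp)
    exact MeasurableSet.biInter (Set.to_countable _) fun i _ =>
      h.measurable_L i (measurableSet_singleton _)
  have hind : ∀ ω, {ω | ∀ i ≤ r, L i ω = l i}.indicator (1 : Ω → ℝ≥0∞) ω =
      1 * ∏ i ∈ Finset.range (r + 1), ({l i} : Set ℕ+).indicator 1 (L i ω) := by
    intro ω
    rw [one_mul]
    by_cases hω : ∀ i ≤ r, L i ω = l i
    · rw [Set.indicator_of_mem (by exact hω), Finset.prod_eq_one fun i hi => by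
        rw [hω i (by simpa [Nat.lt_succ_iff] using hi)]
        simp]
      rfl
    · rw [Set.indicator_of_notMem (by exact hω)]
      push Not at hω
      obtain ⟨i, hi, hne⟩ := hω
      exact (Finset.prod_eq_zero (Finset.mem_range.2 (Nat.lt_succ_of_le hi)) (by simp [hne])).symm
  rw [← lintegral_indicator_one hset]
  simp_rw [hind]
  rw [h.lintegral_marks (fun i => ({l i} : Set ℕ+).indicator 1) (r + 1)
    (φ := fun _ => 1) measurable_const]
  simp_rw [geomMean_indicator_singleton, one_mul]
  have := isProbabilityMeasureBeta (β := a)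
    (add_pos_of_pos_of_nonneg hb (Nat.cast_nonneg (∑ i ∈ Finset.range (r + 1), (l i : ℕ)))) ha
  have hprod := lintegral_prod_geomMark_recordChain hb ha l (r + 1) (φ := fun _ => 1)
    measurable_const
  simp only [mul_one, lintegral_const, measure_univ] at hprod
  rw [coe_markSum, ← hprod]
  exact h.lintegral_points ha hord (F := fun z => ∏ i ∈ Finset.range (r + 1),
    ENNReal.ofReal (geomMark (z i) (l i))) (Finset.measurable_prod _ fun i _ =>
      ((measurable_geomMark (l i)).comp (measurable_pi_apply i)).ennreal_ofReal)

/-- The sequence generated by an ordered model is a Bernoulli sequence. -/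
theorem IsCMPP.isBern (hb : 0 < b) (ha : 0 < a)
    (h : IsCMPP P (betaPDFReal b a) geomMark (recordIntensity a) geomMark X L)
    (hord : ∀ᵐ ω ∂P, ∀ i : ℕ, X (i + 1) ω < X (i + 2) ω) :
    IsBern P a b fun n ω => bernoulliOfMarks (fun i => L i ω) n := by
  have hY : Measurable fun ω => bernoulliOfMarks fun i => L i ω :=
    measurable_bernoulliOfMarks.comp h.measurable_L_pi
  rw [isBern_iff_map_eq ha hb.le (Y := fun n ω => bernoulliOfMarks (fun i => L i ω) n)
    fun n => (measurable_pi_apply n).comp hY]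
  have := isProbabilityMeasure_bernLaw ha hb.le
  have := Measure.isProbabilityMeasure_map (μ := P) hY.aemeasurable
  refine Measure.ext_of_cylinderSet (μ := P.map fun ω => bernoulliOfMarks fun i => L i ω)
    fun n z hz => ?_
  obtain ⟨l, r, hr, hl⟩ := exists_bernoulliOfMarks_agree z n hz
  rw [infinitePi_bernLaw_cylinderSet ha hb.le, Measure.map_apply hY (measurableSet_cylinderSet _ _)]
  have hpre : (fun ω => bernoulliOfMarks fun i => L i ω) ⁻¹' cylinderSet n z =
      {ω | ∀ i ≤ r, L i ω = l i} := by
    ext ω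
    refine Iff.trans ?_ (bernoulliOfMarks_agree_iff l (fun i => L i ω) r)
    rw [hr]
    exact forall₂_congr fun m hm => by rw [hl m hm]
  rw [hpre, h.measure_marks_eq hb ha hord, hr]
  refine Finset.prod_congr rfl fun m hm => ?_
  rw [hl]
  rw [← PNat.coe_le_coe, Nat.succPNat_coe]
  exact Finset.mem_range.1 hm

end Model

/-! ### Count vectors of Bernoulli sequences -/

lemma Measurable.lintegral_condDistrib {Ω α β : Type*} [MeasurableSpace Ω] [MeasurableSpace α]
    [MeasurableSpace β] [StandardBorelSpace β] [Nonempty β] {P : Measure Ω} [IsFiniteMeasure P]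
    {U : Ω → α} {Z : Ω → β} (hU : Measurable U) (hZ : Measurable Z) {G : β → ℝ≥0∞}
    (hG : Measurable G) :
    ∫⁻ ω, G (Z ω) ∂P = ∫⁻ u, ∫⁻ z, G z ∂(condDistrib Z U P u) ∂(P.map U) :=
  lintegral_condDistrib_prod hU hZ (F := fun p => G p.2) (hG.comp measurable_snd)

section Bern

variable {Ω : Type*} [MeasurableSpace Ω] {P : Measure Ω} {a b : ℝ} {Y : ℕ+ → Ω → Fin 2}

lemma IsBern.measurable_pi (h : IsBern P a b Y) : Measurable fun ω n => Y n ω :=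
  measurable_pi_iff.2 h.measurable

lemma IsBern.measurable_countVector (h : IsBern P a b Y) :
    Measurable fun ω => countVector fun n => Y n ω :=
  _root_.measurable_countVector.comp h.measurable_pi

variable [IsProbabilityMeasure P]

/-- A Bernoulli sequence has the law of the sequence generated by an ordered model. -/
lemma IsBern.lintegral_eq_of_isCMPP {Ω' : Type*} [MeasurableSpace Ω'] {Q : Measure Ω'}
    [IsProbabilityMeasure Q] {X : ℕ → Ω' → ℝ} {L : ℕ → Ω' → ℕ+} (h : IsBern P a b Y) (ha : 0 < a)
    (hb : 0 < b) (hm : IsCMPP Q (betaPDFReal b a) geomMark (recordIntensity a) geomMark X L)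
    (hord : ∀ᵐ ω ∂Q, ∀ i : ℕ, X (i + 1) ω < X (i + 2) ω) {G : (ℕ+ → Fin 2) → ℝ≥0∞}
    (hG : Measurable G) :
    ∫⁻ ω, G (fun n => Y n ω) ∂P = ∫⁻ ω, G (bernoulliOfMarks fun i => L i ω) ∂Q := by
  have hQ := hm.isBern hb ha hord
  have h1 := (isBern_iff_map_eq ha hb.le h.measurable).1 h
  have h2 := (isBern_iff_map_eq ha hb.le hQ.measurable).1 hQ
  rw [← lintegral_map hG h.measurable_pi, h1, ← h2, lintegral_map hG hQ.measurable_pi]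

/-- The parameters fix the law of a Bernoulli sequence, so an auxiliary ordered model may replace
it; its count vector is then disintegrated over `X 0`. -/
lemma IsBern.lintegral_countVector (h : IsBern P a b Y) (ha : 0 < a) (hb : 0 < b)
    {G : (ℕ+ → ℕ∞) → ℝ≥0∞} (hG : Measurable G) :
    ∫⁻ ω, G (countVector fun n => Y n ω) ∂P =
      ∫⁻ x, ∫⁻ z, G z ∂(poissonProd fun k => a * (1 - x ^ (k : ℕ)) / k) ∂(betaMeasure b a) := by
  obtain ⟨Ω', _, Q, _, X, L, hm, hord⟩ := exists_isCMPP ha hb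
  refine (h.lintegral_eq_of_isCMPP ha hb hm hord
    (hG.comp _root_.measurable_countVector)).trans ?_
  refine (Measurable.lintegral_condDistrib (hm.measurable_X 0) hm.measurable_countVector hG).trans ?_
  rw [hm.map_X_zero]
  refine lintegral_congr_ae ?_
  filter_upwards [hm.condDistrib_countVector ha hb] with x hx
  rw [hx]

/-- The law of the count vector of a Bernoulli sequence as a mixture of Poisson laws. -/
theorem IsBern.measure_countVector (h : IsBern P a b Y) (ha : 0 < a) (hb : 0 < b)
    {S : Set (ℕ+ → ℕ∞)} (hS : MeasurableSet S) :
    P {ω | countVector (fun n => Y n ω) ∈ S} =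
      ∫⁻ x, poissonProd (fun k => a * (1 - x ^ (k : ℕ)) / k) S ∂(betaMeasure b a) := by
  have key := h.lintegral_countVector ha hb (measurable_one.indicator hS)
  simp_rw [lintegral_indicator_one hS] at key
  exact (lintegral_indicator_one (h.measurable_countVector hS)).symm.trans key

end Bern

/-! ### The limit as `b` decreases to `0` -/

lemma one_sub_expNeg_le (t : ℝ≥0∞) : 1 - expNeg t ≤ t := by
  rcases eq_or_ne t ∞ with rfl | ht
  · exact le_top
  rw [expNeg_of_ne_top ht, ← ENNReal.ofReal_one, ← ENNReal.ofReal_sub _ (Real.exp_pos _).le]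
  refine ENNReal.ofReal_le_of_le_toReal ?_
  have := Real.add_one_le_exp (-t.toReal)
  linarith

/-- The two exponents differ by `D`, a sum of at most `a * x` per index since `x ^ k ≤ x` and `k ≥
1`, and `1 - exp (-D) ≤ D`. The bound is linear in `x`, so only the mean of the beta law matters in
the limit. -/
lemma poissonExponent_bounds {a x : ℝ} (ha : 0 < a) (hx : x ∈ Set.Ioo (0 : ℝ) 1) (n : ℕ+ →₀ ℕ) :
    expNeg (n.sum fun k m => (1 - expNeg m) * ENNReal.ofReal (a / k)) ≤
        expNeg (n.sum fun k m => (1 - expNeg m) * ENNReal.ofReal (a * (1 - x ^ (k : ℕ)) / k)) ∧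
      expNeg (n.sum fun k m => (1 - expNeg m) * ENNReal.ofReal (a * (1 - x ^ (k : ℕ)) / k)) ≤
        expNeg (n.sum fun k m => (1 - expNeg m) * ENNReal.ofReal (a / k)) +
          n.support.card * ENNReal.ofReal a * ENNReal.ofReal x := by
  let D : ℝ≥0∞ := n.sum fun k m => (1 - expNeg m) * ENNReal.ofReal (a * x ^ (k : ℕ) / k)
  have hsplit : n.sum (fun k m => (1 - expNeg m) * ENNReal.ofReal (a / k)) =
      n.sum (fun k m => (1 - expNeg m) * ENNReal.ofReal (a * (1 - x ^ (k : ℕ)) / k)) + D := by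
    simp only [D, Finsupp.sum, ← Finset.sum_add_distrib, ← mul_add]
    refine Finset.sum_congr rfl fun k _ => ?_
    have hk : x ^ (k : ℕ) ≤ 1 := pow_le_one₀ hx.1.le hx.2.le
    have hx0 : 0 ≤ x ^ (k : ℕ) := pow_nonneg hx.1.le _
    have hk' : 0 ≤ 1 - x ^ (k : ℕ) := sub_nonneg.2 hk
    rw [← ENNReal.ofReal_add (by positivity) (by positivity)]
    congr 2
    ring
  have hD : D ≤ n.support.card * ENNReal.ofReal a * ENNReal.ofReal x := by
    rw [mul_assoc, ← nsmul_eq_mul]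
    refine Finset.sum_le_card_nsmul _ _ _ fun k _ => ?_
    refine (mul_le_of_le_one_left zero_le tsub_le_self).trans ?_
    rw [← ENNReal.ofReal_mul ha.le]
    refine ENNReal.ofReal_le_ofReal ?_
    have h1 : x ^ (k : ℕ) ≤ x := pow_le_of_le_one hx.1.le hx.2.le k.ne_zero
    have h2 : (1 : ℝ) ≤ k := by exact_mod_cast one_le (a := k)
    have hx0 : 0 ≤ x ^ (k : ℕ) := pow_nonneg hx.1.le _
    exact (div_le_self (by positivity) h2).trans (by gcongr)
  rw [hsplit, expNeg_add]
  generalize n.sum (fun k m => (1 - expNeg m) * ENNReal.ofReal (a * (1 - x ^ (k : ℕ)) / k)) = E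
  refine ⟨mul_le_of_le_one_right zero_le (expNeg_le_one _), ?_⟩
  calc expNeg E = expNeg E * expNeg D + expNeg E * (1 - expNeg D) := by
        rw [← mul_add, add_tsub_cancel_of_le (expNeg_le_one D), mul_one]
    _ ≤ _ := by
        refine add_le_add le_rfl ?_
        exact (mul_le_of_le_one_left zero_le (expNeg_le_one _)).trans
          ((one_sub_expNeg_le D).trans hD)

lemma lintegral_ofReal_betaMeasure {a b : ℝ} (hb : 0 < b) (ha : 0 < a) :
    ∫⁻ x, ENNReal.ofReal x ∂(betaMeasure b a) = ENNReal.ofReal (b / (a + b)) := by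
  have := isProbabilityMeasureBeta (α := b + 1) (by positivity) ha
  have h := lintegral_ofReal_mul_betaMeasure hb ha (φ := fun _ => 1) measurable_const
  simpa using h

lemma tendsto_lintegral_poissonExponent {a : ℝ} (ha : 0 < a) (n : ℕ+ →₀ ℕ) :
    Tendsto (fun b : ℝ => ∫⁻ x, expNeg (n.sum fun k m =>
        (1 - expNeg m) * ENNReal.ofReal (a * (1 - x ^ (k : ℕ)) / k)) ∂(betaMeasure b a)) (𝓝[>] 0)
      (𝓝 (expNeg (n.sum fun k m => (1 - expNeg m) * ENNReal.ofReal (a / k)))) := by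
  have hlim : Tendsto (fun b : ℝ =>
      expNeg (n.sum fun k m => (1 - expNeg m) * ENNReal.ofReal (a / k)) +
        n.support.card * ENNReal.ofReal a * ENNReal.ofReal (b / (a + b))) (𝓝[>] 0)
      (𝓝 (expNeg (n.sum fun k m => (1 - expNeg m) * ENNReal.ofReal (a / k)))) := by
    have h1 : Tendsto (fun b : ℝ => b / (a + b)) (𝓝[>] 0) (𝓝 0) := by
      have : ContinuousAt (fun b : ℝ => b / (a + b)) 0 :=
        continuousAt_id.div (by fun_prop) (by simpa using ha.ne')
      have h2 := this.tendsto
      simp only [zero_div] at h2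
      exact h2.mono_left nhdsWithin_le_nhds
    have h2 := ENNReal.Tendsto.const_mul (a := (n.support.card : ℝ≥0∞) * ENNReal.ofReal a)
      (ENNReal.tendsto_ofReal h1)
      (Or.inr (ENNReal.mul_ne_top (ENNReal.natCast_ne_top _) ENNReal.ofReal_ne_top))
    simpa using h2.const_add (expNeg (n.sum fun k m => (1 - expNeg m) * ENNReal.ofReal (a / k)))
  refine tendsto_of_tendsto_of_tendsto_of_le_of_le' tendsto_const_nhds hlim ?_ ?_
  · filter_upwards [self_mem_nhdsWithin] with b hb
    have := isProbabilityMeasureBeta hb ha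
    generalize hc : expNeg (n.sum fun k m => (1 - expNeg m) * ENNReal.ofReal (a / k)) = c
    have hconst : ∫⁻ _, c ∂(betaMeasure b a) = c := by simp
    rw [← hconst, ← hc]
    refine lintegral_mono_ae ?_
    filter_upwards [ae_betaMeasure_mem_Ioo b a] with x hx using (poissonExponent_bounds ha hx n).1
  · filter_upwards [self_mem_nhdsWithin] with b hb
    have := isProbabilityMeasureBeta hb ha
    rw [← lintegral_ofReal_betaMeasure hb ha, ← lintegral_const_mul _ (by fun_prop)]
    generalize hc : expNeg (n.sum fun k m => (1 - expNeg m) * ENNReal.ofReal (a / k)) = c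
    have hconst : ∫⁻ _, c ∂(betaMeasure b a) = c := by simp
    rw [← hconst, ← hc, ← lintegral_add_right _ (by fun_prop)]
    refine lintegral_mono_ae ?_
    filter_upwards [ae_betaMeasure_mem_Ioo b a] with x hx using (poissonExponent_bounds ha hx n).2

theorem tendsto_integral_countVector {Ω : Type*} [MeasurableSpace Ω] {a : ℝ} (ha : 0 < a)
    (P : ℝ → Measure Ω) [∀ b, IsProbabilityMeasure (P b)] (Y : ℝ → ℕ+ → Ω → Fin 2)
    (h : ∀ b : ℝ, 0 < b → IsBern (P b) a b (Y b)) (f : (ℕ+ → ℕ∞) →ᵇ ℝ) :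
    Tendsto (fun b : ℝ => ∫ ω, f (countVector fun n => Y b n ω) ∂(P b)) (𝓝[>] 0)
      (𝓝 (∫ z, f z ∂(poissonProd fun k => a / k))) := by
  have hLap : ∀ n : ℕ+ →₀ ℕ, Measurable fun z : ℕ+ → ℕ∞ =>
      expNeg (n.sum fun d k => (k : ℝ≥0∞) * (z d : ℝ≥0∞)) := fun n => by
    unfold Finsupp.sum; fun_prop
  have key := tendsto_integral_of_expNeg (fun (i : ℕ+) (z : ℕ+ → ℕ∞) => (z i : ℝ≥0∞))
    (fun i => ENat.continuous_toENNReal.comp (continuous_apply i))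
    (fun x y hxy => funext fun i => ENat.toENNReal_inj.1 (hxy i)) (𝓝[>] (0 : ℝ))
    (fun b => (P b).map fun ω => countVector fun n => Y b n ω) (poissonProd fun k => a / k) 1
    (fun b => by
      -- Nothing is known for `b ≤ 0`: without measurability the image measure is `0`, and the mass
      -- bound `1` still holds.
      by_cases hm : AEMeasurable (fun ω => countVector fun n => Y b n ω) (P b)
      · have := Measure.isProbabilityMeasure_map hm
        simp
      · simp [Measure.map_of_not_aemeasurable hm]) (by simp) (fun n => ?_) f.toContinuousMap
  · refine key.congr' ?_
    filter_upwards [self_mem_nhdsWithin] with b hb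
    exact integral_map (h b hb).measurable_countVector.aemeasurable
      f.continuous.aestronglyMeasurable
  · rw [lintegral_expNeg_poissonProd]
    refine (tendsto_lintegral_poissonExponent ha n).congr' ?_
    filter_upwards [self_mem_nhdsWithin] with b hb
    rw [lintegral_map (hLap n) (h b hb).measurable_countVector,
      (h b hb).lintegral_countVector ha hb (hLap n)]
    simp_rw [lintegral_expNeg_poissonProd]

/-! ### The case `b = 0` -/

/-- The one-step equation. -/
lemma lintegral_stepDensity_mul_recordLaplace_of_le_one {a x : ℝ} (ha : 0 < a) (hx : x < 1)
    {h : ℝ → ℝ≥0∞} (hh : Measurable h) (h1 : ∀ y, h y ≤ 1) :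
    ∫⁻ y in Set.Ioo x 1, ENNReal.ofReal (stepDensity a x y) * (h y * recordLaplace a h y) =
      recordLaplace a h x := by
  -- The factor is replaced by `1` beyond `u n < 1`, where the equation is known, and `u n ↑ 1`. The
  -- functionals converge monotonically in the exponent, and the step integrals by dominated
  -- convergence.
  obtain ⟨u, hu, hu1, hut⟩ := exists_seq_strictMono_tendsto (1 : ℝ)
  let g : ℕ → ℝ → ℝ≥0∞ := fun n y => if y ≤ u n then h y else 1
  have hg : ∀ n, Measurable (g n) := fun n => Measurable.ite measurableSet_Iic hh measurable_const
  have hg1 : ∀ n y, g n y ≤ 1 := fun n y => by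
    simp only [g]
    split_ifs
    exacts [h1 y, le_rfl]
  have hganti : ∀ y, Antitone fun n => g n y := fun y m n hmn => by
    simp only [g]
    by_cases hm : y ≤ u m
    · rw [if_pos hm, if_pos (hm.trans (hu.monotone hmn))]
    · rw [if_neg hm]
      exact hg1 n y
  have hglim : ∀ y < 1, ∀ᶠ n in atTop, g n y = h y := fun y hy => by
    filter_upwards [hut.eventually (lt_mem_nhds hy)] with n hn using if_pos hn.le
  have hlap : ∀ y, Tendsto (fun n => recordLaplace a (g n) y) atTop (𝓝 (recordLaplace a h y)) := by
    intro y
    refine (continuous_expNeg.tendsto _).comp ?_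
    simp_rw [fun n => lintegral_recordMeasure a y (G := fun t => 1 - g n t)
      (measurable_const.sub (hg n))]
    rw [lintegral_recordMeasure a y (G := fun t => 1 - h t) (measurable_const.sub hh)]
    refine lintegral_tendsto_of_tendsto_of_monotone (fun n => ?_) (ae_of_all _ fun t m n hmn => ?_)
      ?_
    · have := hg n
      fun_prop
    · exact mul_le_mul_right (tsub_le_tsub_left (hganti t hmn) 1) _
    · filter_upwards [ae_restrict_mem measurableSet_Ioo] with t ht
      refine tendsto_const_nhds.congr' ?_
      filter_upwards [hglim t ht.2] with n hn
      rw [hn]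
  refine tendsto_nhds_unique (f := fun n => recordLaplace a (g n) x) (l := atTop) ?_ (hlap x)
  simp_rw [← fun n => lintegral_stepDensity_mul_recordLaplace ha (hu1 n) hx (hg n) (hg1 n)
    fun y hy => if_neg hy.not_ge]
  refine tendsto_lintegral_of_dominated_convergence
    (fun y => ENNReal.ofReal (stepDensity a x y)) (fun n => ?_)
    (fun n => ae_of_all _ fun y => ?_) (by rw [lintegral_stepDensity ha hx]; exact ENNReal.one_ne_top)
    ?_
  · have := measurable_recordLaplace a (hg n)
    have := hg n
    fun_prop
  · exact mul_le_of_le_one_right zero_le (mul_le_one' (hg1 n y) (expNeg_le_one _))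
  · filter_upwards [ae_restrict_mem measurableSet_Ioo] with y hy
    refine ENNReal.Tendsto.const_mul ?_ (Or.inr ENNReal.ofReal_ne_top)
    refine Tendsto.congr' ?_ (ENNReal.Tendsto.const_mul (hlap y)
      (Or.inr (ne_top_of_le_ne_top ENNReal.one_ne_top (h1 y))))
    filter_upwards [hglim y hy.2] with n hn
    rw [hn]

lemma beta_one_left {a : ℝ} (ha : 0 < a) : beta 1 a = 1 / a := by
  rw [← beta_one_right ha, beta, beta, mul_comm, add_comm]

/-- For `b = 1` the initial point is distributed as the next point of a chain at `0`. -/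
lemma lintegral_betaMeasure_one_left {a : ℝ} (ha : 0 < a) {φ : ℝ → ℝ≥0∞} (hφ : Measurable φ) :
    ∫⁻ x, φ x ∂(betaMeasure 1 a) =
      ∫⁻ x in Set.Ioo 0 1, ENNReal.ofReal (stepDensity a 0 x) * φ x := by
  rw [lintegral_betaMeasure _ _ hφ]
  refine lintegral_congr fun x => ?_
  rw [stepDensity, beta_one_left ha]
  simp

/-- The sequence `1, y 1, y 2, …`. -/
def consOne (y : ℕ+ → Fin 2) (n : ℕ+) : Fin 2 := if n = 1 then 1 else y (n - 1)

lemma measurable_consOne : Measurable consOne :=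
  measurable_pi_iff.2 fun n => by
    by_cases h : n = 1
    · simp [consOne, h]
    · simpa [consOne, h] using measurable_pi_apply (n - 1)

lemma consOne_eq {y : ℕ+ → Fin 2} (h : y 1 = 1) : (consOne fun n => y (n + 1)) = y := by
  funext n
  by_cases hn : n = 1
  · rw [consOne, if_pos hn, hn, h]
  · rw [consOne, if_neg hn, PNat.sub_add_of_lt (lt_of_le_of_ne (one_le (a := n)) (Ne.symm hn))]

/-- The marks `1, l 0, l 1, …`. -/
def consMark (l : ℕ → ℕ+) : ℕ → ℕ+
  | 0 => 1
  | i + 1 => l i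

lemma markSum_consMark (l : ℕ → ℕ+) (r : ℕ) : markSum (consMark l) (r + 1) = 1 + markSum l r := by
  induction r with
  | zero => rfl
  | succ r ih => rw [markSum, ih, markSum, add_assoc]; rfl

/-- A one put in front is an initial mark `1`. The former initial mark now follows a one and counts
as a string. -/
lemma bernoulliOfMarks_consMark (l : ℕ → ℕ+) :
    bernoulliOfMarks (consMark l) = consOne (bernoulliOfMarks l) := by
  have h1 : bernoulliOfMarks (consMark l) 1 = 1 :=
    (bernoulliOfMarks_eq_one_iff _ _).2 ⟨0, rfl⟩
  rw [← consOne_eq h1]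
  congr 1
  funext n
  have hone : bernoulliOfMarks (consMark l) (n + 1) = 1 ↔ bernoulliOfMarks l n = 1 := by
    rw [bernoulliOfMarks_eq_one_iff, bernoulliOfMarks_eq_one_iff]
    constructor
    · rintro ⟨r, hr⟩
      cases r with
      | zero => exact absurd hr (PNat.lt_add_left 1 n).ne'
      | succ r =>
        rw [markSum_consMark, add_comm] at hr
        exact ⟨r, add_left_cancel hr⟩
    · rintro ⟨r, hr⟩
      exact ⟨r + 1, by rw [markSum_consMark, add_comm, hr]⟩
  omega

/-- All marks now count, so `X 0` contributes a factor too. Its law Beta(1, a) is a step from `0`,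
and the one-step equation merges it with the later points into the functional at `x = 0`, where the
rates are `a / k`. -/
lemma IsCMPP.lintegral_expNeg_countVector_consOne {Ω : Type*} [MeasurableSpace Ω] {P : Measure Ω}
    [IsProbabilityMeasure P] {X : ℕ → Ω → ℝ} {L : ℕ → Ω → ℕ+} {a : ℝ} (ha : 0 < a)
    (h : IsCMPP P (betaPDFReal 1 a) geomMark (recordIntensity a) geomMark X L) (n : ℕ+ →₀ ℕ) :
    ∫⁻ ω, expNeg (n.sum fun d k => (k : ℝ≥0∞) *
        (countVector (consOne (bernoulliOfMarks fun i => L i ω)) d : ℝ≥0∞)) ∂P =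
      expNeg (n.sum fun k m => (1 - expNeg m) * ENNReal.ofReal (a / k)) := by
  have hf := measurable_markFactor n
  have hf1 := markFactor_le_one n
  have hsplit : ∀ ω, expNeg (∑' i, negLog (markFactor n (X i ω))) =
      markFactor n (X 0 ω) * expNeg (∑' i, negLog (markFactor n (X (i + 1) ω))) := fun ω => by
    rw [tsum_eq_zero_add' ENNReal.summable, expNeg_add, expNeg_negLog (hf1 _)]
  have hmarks := h.lintegral_expNeg_marks (fun _ => n) (φ := fun _ => 1) measurable_const
    fun _ => le_rfl
  simp only [one_mul] at hmarks
  simp_rw [← bernoulliOfMarks_consMark, sum_mul_countVector_bernoulliOfMarks]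
  refine hmarks.trans ?_
  simp_rw [hsplit]
  rw [h.lintegral_mul_expNeg_points hf hf hf1]
  refine (lintegral_betaMeasure_one_left ha (hf.mul (measurable_recordLaplace a hf))).trans ?_
  refine (lintegral_stepDensity_mul_recordLaplace_of_le_one ha one_pos hf hf1).trans ?_
  rw [recordLaplace_geomMean ha le_rfl one_pos n hf fun y hy => markFactor_eq n hy]
  simp

/-- For `b = 0` the success probability at time `1` is `a / a = 1`, and the entries after it form a
Bern(a, 1) sequence, which an ordered model represents. -/
theorem IsBern.map_countVector_zero {Ω : Type*} [MeasurableSpace Ω] {P : Measure Ω}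
    [IsProbabilityMeasure P] {Y : ℕ+ → Ω → Fin 2} {a : ℝ} (ha : 0 < a) (h : IsBern P a 0 Y) :
    P.map (fun ω => countVector (fun n => Y n ω)) = poissonProd fun k => a / k := by
  have hshift : IsBern P a 1 fun n => Y (n + 1) :=
    ⟨fun n => h.measurable _, h.indep.precomp (add_left_injective 1), fun n => by
      rw [h.prob_eq_one]
      congr 2
      push_cast
      ring⟩
  have hone : ∀ᵐ ω ∂P, Y 1 ω = 1 := by
    have hm : MeasurableSet {ω | Y 1 ω = 1} := h.measurable 1 (measurableSet_singleton 1)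
    refine (mem_ae_iff_prob_eq_one hm).2 ?_
    rw [h.prob_eq_one]
    simp [ha.ne']
  have hZ := h.measurable_countVector
  have := Measure.isProbabilityMeasure_map (μ := P) hZ.aemeasurable
  refine Measure.pi_enat_ext _ _ fun n => ?_
  have hLap : Measurable fun z : ℕ+ → ℕ∞ =>
      expNeg (n.sum fun d k => (k : ℝ≥0∞) * (z d : ℝ≥0∞)) := by
    unfold Finsupp.sum; fun_prop
  obtain ⟨Ω', _, Q, _, X, L, hm, hord⟩ := exists_isCMPP ha one_pos
  rw [lintegral_expNeg_poissonProd, lintegral_map hLap hZ,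
    ← hm.lintegral_expNeg_countVector_consOne ha n]
  refine Eq.trans ?_ (hshift.lintegral_eq_of_isCMPP (Y := fun n => Y (n + 1)) ha one_pos hm hord
    (hLap.comp (_root_.measurable_countVector.comp measurable_consOne)))
  refine lintegral_congr_ae ?_
  filter_upwards [hone] with ω hω
  simp only [Function.comp]
  rw [consOne_eq (y := fun n => Y n ω) hω]

end

theorem proposition3p1 (a : ℝ) (ha : 0 < a) :
    -- the model with points listed in increasing order exists
    (∀ b : ℝ, 0 < b →
      ∃ (Ω : Type) (_ : MeasurableSpace Ω) (P : Measure Ω) (_ : IsProbabilityMeasure P)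
        (X : ℕ → Ω → ℝ) (L : ℕ → Ω → ℕ+),
        IsCMPP P (betaPDFReal b a) geomMark (recordIntensity a) geomMark X L ∧
        ∀ᵐ ω ∂P, ∀ i : ℕ, X (i + 1) ω < X (i + 2) ω) ∧
    -- what every such model produces
    (∀ b : ℝ, 0 < b →
      ∀ (Ω : Type*) [MeasurableSpace Ω] (P : Measure Ω) [IsProbabilityMeasure P]
        (X : ℕ → Ω → ℝ) (L : ℕ → Ω → ℕ+),
        IsCMPP P (betaPDFReal b a) geomMark (recordIntensity a) geomMark X L →
        ((∀ᵐ ω ∂P, ∀ i : ℕ, X (i + 1) ω < X (i + 2) ω) →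
          IsBern P a b (fun n ω => bernoulliOfMarks (fun i => L i ω) n)) ∧
        (∀ᵐ x₀ ∂(betaMeasure b a),
          condDistrib (fun ω => countVector (bernoulliOfMarks fun i => L i ω)) (X 0) P x₀ =
            poissonProd fun k => a * (1 - x₀ ^ (k : ℕ)) / k)) ∧
    -- the count vector of an arbitrary Bern(a, b) sequence
    (∀ b : ℝ, 0 < b →
      ∀ (Ω : Type*) [MeasurableSpace Ω] (P : Measure Ω) [IsProbabilityMeasure P]
        (Y : ℕ+ → Ω → Fin 2), IsBern P a b Y →
        ∀ S : Set (ℕ+ → ℕ∞), MeasurableSet S →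
          P {ω | countVector (fun n => Y n ω) ∈ S} =
            ∫⁻ x₀, poissonProd (fun k => a * (1 - x₀ ^ (k : ℕ)) / k) S ∂(betaMeasure b a)) ∧
    -- convergence in distribution of the count vectors as b decreases to 0
    (∀ (Ω : Type*) [MeasurableSpace Ω] (P : ℝ → Measure Ω) [∀ b, IsProbabilityMeasure (P b)]
        (Y : ℝ → ℕ+ → Ω → Fin 2), (∀ b : ℝ, 0 < b → IsBern (P b) a b (Y b)) →
        ∀ f : (ℕ+ → ℕ∞) →ᵇ ℝ,
          Tendsto (fun b : ℝ => ∫ ω, f (countVector fun n => Y b n ω) ∂(P b)) (𝓝[>] 0)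
            (𝓝 (∫ z, f z ∂(poissonProd fun k => a / k)))) ∧
    -- the count vector of a Bern(a, 0) sequence
    (∀ (Ω : Type*) [MeasurableSpace Ω] (P : Measure Ω) [IsProbabilityMeasure P]
        (Y : ℕ+ → Ω → Fin 2), IsBern P a 0 Y →
        P.map (fun ω => countVector (fun n => Y n ω)) = poissonProd fun k => a / k) := by
  refine ⟨fun b hb => exists_isCMPP ha hb, fun b hb Ω _ P _ X L h => ⟨fun hord => h.isBern hb ha hord,
    h.condDistrib_countVector ha hb⟩, fun b hb Ω _ P _ Y h S hS => h.measure_countVector ha hb hS,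
    fun Ω _ P _ Y h f => tendsto_integral_countVector ha P Y h f,
    fun Ω _ P _ Y h => h.map_countVector_zero ha⟩
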